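/- Fix real-valued functions $\rho,\phi\in C_c^\infty(\mathbb R)$, both with (closed) support in $[-4,4]\setminus[-\tfrac14,\tfrac14]$, such that $\rho$ is odd with $\sum_{k\in\mathbb Z}2^k\rho(2^kt)=\frac1t$ for $t\neq0$, and $\phi$ is even with $\sum_{j\in\mathbb Z}\phi(\xi/2^j)=1$ for $\xi\ne0$. For $n\in\mathbb Z$ let $\check\phi_n(x)=\frac1{2\pi}\int_{\mathbb R}\phi(\xi/2^n)e^{i\xi x}\,d\xi$. For $\vec f=(f_1,f_2,f_3,f_4)$ and integers $m\ge 1$, $k\ge m$ put $$\Lambda_m^k(\vec f)=\iint_{\mathbb R^2}(f_1*\check\phi_{m+k})(x-t)\,(f_2*\check\phi_{m+2k})(x+t^2)\,(f_3*\check\phi_{m+3k})(x+t^3)\,f_4(x)\,2^k\rho(2^kt)\,dt\,dx,$$ and let $\widetilde\Lambda_m^k(\vec f)=\Lambda_m^k(f_1,f_2,f_3,f_4*\check\phi_{m+3k})$ be the variant in which the fourth function is also frequency-localized. Set $\Lambda_m^{\ge}(\vec f)=\sum_{k\ge m}\Lambda_m^k(\vec f)$ and $\widetilde\Lambda_m^{\ge}(\vec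 f)=\sum_{k\ge m}\widetilde\Lambda_m^k(\vec f)$. **Proposition.** For every $\vec\theta=(\theta_1,\theta_2,\theta_3)\in(0,1)^3$ there is a constant $C_{\vec\theta}$, depending only on $\vec\theta$ and the fixed functions $\rho,\phi$, such that the following holds. Let $m\ge1$ be an integer and let $F_1,F_2,F_3,F_4\subseteq\mathbb R$ be measurable sets of finite Lebesgue measure. Then there exists a measurable set $F_4'\subseteq F_4$ with $|F_4'|\ge\frac12|F_4|$ such that for all measurable $f_1,f_2,f_3,f_4:\mathbb R\to\mathbb C$ with $|f_j|\le\chi_{F_j}$ a.e. for $j=1,2,3$ and $|f_4|\le\chi_{F_4'}$ a.e., the series defining $\Lambda_m^{\ge}(\vec f)$ and $\widetilde\Lambda_m^{\ge}(\vec f)$ converge absolutely, and for all $\vec\theta\in(0,1)^3$ $$|\Lambda_m^{\ge}(\vec f)|\le C_{\vec\theta}\,m^{10}\,|F_1|^{\theta_1}|F_2|^{\theta_2}|F_3|^{\theta_3}|F_4|^{1-\theta_1-\theta_2-\theta_3},$$ and the same bound holds for $|\widetilde\Lambda_m^{\ge}(\vec f)|$. (If $|F_4|=0$, the right-hand sides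 are read with the convention $0^a=0$ for $a\ne0$ and $0^0=1$; both forms then vanish.) -/

import Mathlib

open MeasureTheory Set

namespace CurvedTHT

/-- The cutoff in the variable `t`: smooth, odd, closed support in `[-4,4] \ [-1/4,1/4]`, and
`∑_{k ∈ ℤ} 2^k ρ(2^k t) = 1/t` for `t ≠ 0`. -/
structure IsSpatialCutoff (ρ : ℝ → ℝ) : Prop where
  smooth : ContDiff ℝ (⊤ : ℕ∞) ρ
  odd : ∀ t, ρ (-t) = -ρ t
  supp : tsupport ρ ⊆ Icc (-4) 4 \ Icc (-(1 / 4)) (1 / 4)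
  sum_eq : ∀ t : ℝ, t ≠ 0 → HasSum (fun k : ℤ => (2 : ℝ) ^ k * ρ ((2 : ℝ) ^ k * t)) (1 / t)

/-- The cutoff in frequency: smooth, even, closed support in `[-4,4] \ [-1/4,1/4]`, and
`∑_{j ∈ ℤ} φ(ξ / 2^j) = 1` for `ξ ≠ 0`. For a real-valued `φ` this is the same as
`∑_{j,l,m} φ(ξ / 2^(j+k)) φ(η / 2^(l+2k)) φ(τ / 2^(m+3k)) = 1` for all nonzero `ξ, η, τ`,
because the triple sum is the product of the three single sums. -/
structure IsFrequencyCutoff (φ : ℝ → ℝ) : Prop where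
  smooth : ContDiff ℝ (⊤ : ℕ∞) φ
  even : ∀ ξ, φ (-ξ) = φ ξ
  supp : tsupport φ ⊆ Icc (-4) 4 \ Icc (-(1 / 4)) (1 / 4)
  sum_eq : ∀ ξ : ℝ, ξ ≠ 0 → HasSum (fun j : ℤ => φ (ξ / (2 : ℝ) ^ j)) 1

/-- The kernel with Fourier transform `ξ ↦ φ(ξ / 2^n)`, namely
`x ↦ (1/2π) ∫ φ(ξ / 2^n) e^{iξx} dξ`. -/
noncomputable def bandKernel (φ : ℝ → ℝ) (n : ℤ) (x : ℝ) : ℂ :=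
  (2 * (Real.pi : ℂ))⁻¹ *
    ∫ ξ : ℝ, (φ (ξ / (2 : ℝ) ^ n) : ℂ) * Complex.exp (Complex.I * (ξ : ℂ) * (x : ℂ))

/-- The frequency-localized function `f * bandKernel φ n`. -/
noncomputable def bandPart (φ : ℝ → ℝ) (n : ℤ) (f : ℝ → ℂ) : ℝ → ℂ :=
  convolution f (bandKernel φ n) (ContinuousLinearMap.mul ℂ ℂ) volume

/-- The piece of the quadrilinear form at spatial scale `2^(-k)` and at frequencies
`2^(j+k)`, `2^(l+2k)`, `2^(m+3k)` in the first three functions. The variable is `p = (x, t)`. -/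
noncomputable def formPiece (ρ φ : ℝ → ℝ) (j l m k : ℤ) (f₁ f₂ f₃ f₄ : ℝ → ℂ) : ℂ :=
  ∫ p : ℝ × ℝ,
    bandPart φ (j + k) f₁ (p.1 - p.2) *
    bandPart φ (l + 2 * k) f₂ (p.1 + p.2 ^ 2) *
    bandPart φ (m + 3 * k) f₃ (p.1 + p.2 ^ 3) *
    f₄ p.1 *
    (((2 : ℝ) ^ k * ρ ((2 : ℝ) ^ k * p.2) : ℝ) : ℂ)

/-- The main diagonal piece, all three frequency parameters being equal to `m`. -/
noncomputable def diagPiece (ρ φ : ℝ → ℝ) (m k : ℕ) (f₁ f₂ f₃ f₄ : ℝ → ℂ) : ℂ :=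
  formPiece ρ φ m m m k f₁ f₂ f₃ f₄

/-- The main diagonal piece in which the fourth function, too, is localized to the dominant
frequency `2^(m+3k)`. -/
noncomputable def diagPieceLoc (ρ φ : ℝ → ℝ) (m k : ℕ) (f₁ f₂ f₃ f₄ : ℝ → ℂ) : ℂ :=
  diagPiece ρ φ m k f₁ f₂ f₃ (bandPart φ (m + 3 * k) f₄)

/-- The multiscale diagonal form: the sum of the diagonal pieces over all `k ≥ m`. -/
noncomputable def multiscaleForm (ρ φ : ℝ → ℝ) (m : ℕ) (f₁ f₂ f₃ f₄ : ℝ → ℂ) : ℂ :=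
  ∑' k : Ici m, diagPiece ρ φ m k f₁ f₂ f₃ f₄

/-- The sum over all `k ≥ m` of the diagonal pieces with localized fourth function. -/
noncomputable def multiscaleFormLoc (ρ φ : ℝ → ℝ) (m : ℕ) (f₁ f₂ f₃ f₄ : ℝ → ℂ) : ℂ :=
  ∑' k : Ici m, diagPieceLoc ρ φ m k f₁ f₂ f₃ f₄

/-- `f` is Lebesgue measurable and `|f| ≤ χ_F` almost everywhere. -/
def Dominated (f : ℝ → ℂ) (F : Set ℝ) : Prop :=
  AEStronglyMeasurable f volume ∧ ∀ᵐ x : ℝ, ‖f x‖ ≤ F.indicator (fun _ => (1 : ℝ)) x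

end CurvedTHT

/-! ### Kernels of the frequency bands -/

namespace CurvedTHT

open scoped ENNReal FourierTransform SchwartzMap ContDiff

/-! Absolute values go inside the form at once: no oscillation along the curve is used, since a
polynomial loss in m is allowed (the argument loses only one factor m). What remains is a positive
form `triForm` at each scale.

Write ε = 2^(-m) and R = 2^(-k). The j-th function has wavelength ε R^j and is translated by ±t^j
with |t| comparable to R. Because k ≥ m, R ≤ ε and hence R^(j+1) ≤ ε R^j: each factor is essentially
constant over the distance by which the next one is translated. For fixed t the third factor, and
then the second, can therefore be replaced by their averages over windows R^3 and R^2 around points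
of the support of the fourth function (`setLIntegral_mul_poi_le`, `lintegral_fiber_first_le`).

Put h_j = 36 |F_j| / |F_4|. The set F_4' is F_4 without the enlarged maximal dyadic intervals in
which some F_j has density above h_j. At most half of F_4 is lost (`volume_exceptional_le_div`), and
at the remaining points every Poisson average of F_j is at most a multiple of min(1, h_j)
(`poi_indicator_le`). Neither m nor the exponents enter this choice.

Each f_j is split at height h_j by a Calderón–Zygmund decomposition, one function after the other.
For a bad part on an interval of length l, the mean zero gains l/(ε R) when l < ε R, while the
removal of the enlarged intervals gains R/l when l is large compared with R (R being the window R^j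
of that function). Only about m scales k lie in between, so summing over k costs a factor m
(`sum_min_le`, `tsum_setLIntegral_badMass_le`), and the total is at most a multiple of m min(1,h_1)
min(1,h_2) min(1,h_3) |F_4|.

When all parts are good, the third is bounded pointwise by min(1, h_3). Cauchy–Schwarz in (x, t) and
in k leaves two square functions, tested against Poisson averages of F_4. These satisfy a Carleson
type estimate (`exists_tsum_sq_bandPart_mul_poi_le`): on the region where the average of F_4 is
about 2^(-n), the square function is localized to a set of measure at most a multiple of 2^n |F_4|,
and orthogonality of the bands applies there. The sum over n loses a logarithm, which `tsum_min_le`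
turns into the power h_j^θ_j.

Since min(1, h) ≤ h^θ for θ in (0, 1), everything is bounded by m h_1^θ₁ h_2^θ₂ h_3^θ₃ |F_4|, which
is the claim. The fourth function enters only through `IsTestWeight`, so both forms are treated
together. -/

/-- The Poisson kernel of width `r`, without the factor `1/π`. -/
noncomputable def pk (r x : ℝ) : ℝ := r / (r ^ 2 + x ^ 2)

/-- A kernel of width `r` with tenth power decay. -/
noncomputable def decayKernel (r x : ℝ) : ℝ := r⁻¹ / (1 + |x| / r) ^ 10

lemma pk_pos {r : ℝ} (hr : 0 < r) (x : ℝ) : 0 < pk r x := by unfold pk; positivity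

lemma decayKernel_nonneg {r : ℝ} (hr : 0 < r) (x : ℝ) : 0 ≤ decayKernel r x := by
  unfold decayKernel; positivity

lemma pk_eq {r : ℝ} (hr : 0 < r) (x : ℝ) : pk r x = r⁻¹ / (1 + (|x| / r) ^ 2) := by
  unfold pk; rw [div_pow, sq_abs]; field_simp

lemma decayKernel_le_pk {r : ℝ} (hr : 0 < r) (x : ℝ) : decayKernel r x ≤ pk r x := by
  rw [pk_eq hr, decayKernel]
  have h0 : 0 ≤ |x| / r := by positivity
  have : 1 + (|x| / r) ^ 2 ≤ (1 + |x| / r) ^ 10 := by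
    calc 1 + (|x| / r) ^ 2 ≤ (1 + |x| / r) ^ 2 := by nlinarith
      _ ≤ _ := pow_le_pow_right₀ (by linarith) (by norm_num)
  gcongr

variable {φ : ℝ → ℝ}

lemma IsFrequencyCutoff.hasCompactSupport (hφ : IsFrequencyCutoff φ) : HasCompactSupport φ :=
  IsCompact.of_isClosed_subset isCompact_Icc (isClosed_tsupport φ) (hφ.supp.trans sdiff_subset)

lemma IsSpatialCutoff.hasCompactSupport {ρ : ℝ → ℝ} (hρ : IsSpatialCutoff ρ) :
    HasCompactSupport ρ :=
  IsCompact.of_isClosed_subset isCompact_Icc (isClosed_tsupport ρ) (hρ.supp.trans sdiff_subset)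

/-- The Fourier multiplier of `f ↦ bandPart φ n f`, in the normalization of Mathlib's Fourier
transform. -/
noncomputable def bandSymbol (hφ : IsFrequencyCutoff φ) (n : ℤ) : 𝓢(ℝ, ℂ) :=
  HasCompactSupport.toSchwartzMap
    (f := fun ξ => ((φ (2 * Real.pi / (2 : ℝ) ^ n * ξ) : ℝ) : ℂ))
    (by
      have h : HasCompactSupport fun ξ : ℝ => φ (2 * Real.pi / (2 : ℝ) ^ n * ξ) := by
        have := hφ.hasCompactSupport.comp_smul
          (c := 2 * Real.pi / (2 : ℝ) ^ n) (by positivity)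
        simpa [smul_eq_mul] using this
      exact h.comp_left (g := fun x : ℝ => (x : ℂ)) (by simp))
    (by
      have h := hφ.smooth
      exact Complex.ofRealCLM.contDiff.comp (h.comp (by fun_prop)))

lemma bandSymbol_apply (hφ : IsFrequencyCutoff φ) (n : ℤ) (ξ : ℝ) :
    bandSymbol hφ n ξ = ((φ (2 * Real.pi / (2 : ℝ) ^ n * ξ) : ℝ) : ℂ) := rfl

lemma bandKernel_eq_fourierInv (hφ : IsFrequencyCutoff φ) (n : ℤ) (x : ℝ) :
    bandKernel φ n x = 𝓕⁻ (bandSymbol hφ n) x := by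
  rw [SchwartzMap.fourierInv_coe, Real.fourierInv_eq']
  have := Measure.integral_comp_mul_left (fun η : ℝ => (φ (η / (2 : ℝ) ^ n) : ℂ) *
    Complex.exp (Complex.I * (η : ℂ) * (x : ℂ))) (2 * Real.pi)
  unfold bandKernel
  have h2 : ((2 * (Real.pi : ℂ))⁻¹) = ((|(2 * Real.pi)⁻¹| : ℝ) : ℂ) := by
    rw [abs_of_pos (by positivity)]; push_cast; rfl
  rw [h2, ← Complex.real_smul, ← this]
  refine integral_congr_ae (Filter.Eventually.of_forall fun ξ => ?_)
  simp only [bandSymbol_apply, smul_eq_mul, RCLike.inner_apply, conj_trivial]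
  rw [mul_comm]
  congr 1
  · congr 1; push_cast; ring
  · congr 2; ring

lemma bandKernel_scale (φ : ℝ → ℝ) (n : ℤ) (x : ℝ) :
    bandKernel φ n x = (2 : ℂ) ^ n * bandKernel φ 0 ((2 : ℝ) ^ n * x) := by
  have := Measure.integral_comp_mul_left (fun η : ℝ => (φ η : ℂ) *
    Complex.exp (Complex.I * (η : ℂ) * (((2 : ℝ) ^ n * x : ℝ) : ℂ))) (((2 : ℝ) ^ n)⁻¹)
  have h2 : (|(((2 : ℝ) ^ n)⁻¹)⁻¹| : ℝ) = (2 : ℝ) ^ n := by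
    rw [inv_inv, abs_of_pos (by positivity)]
  rw [h2, Complex.real_smul] at this
  unfold bandKernel
  simp only [zpow_zero, div_one]
  rw [mul_left_comm]
  congr 1
  push_cast at this ⊢
  rw [← this]
  refine integral_congr_ae (Filter.Eventually.of_forall fun ξ => ?_)
  have : (2 : ℂ) ^ n ≠ 0 := zpow_ne_zero _ two_ne_zero
  simp only
  congr 2
  · rw [div_eq_inv_mul]
  · field_simp

lemma norm_two_zpow (n : ℤ) : ‖(2 : ℂ) ^ n‖ = (2 : ℝ) ^ n := by simp

/-- Decay of the band kernels and of their derivatives. -/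
lemma exists_bandKernel_bounds (hφ : IsFrequencyCutoff φ) :
    ∃ C : ℝ, 0 < C ∧ (∀ (n : ℤ) (x : ℝ),
      ‖bandKernel φ n x‖ ≤ C * decayKernel ((2 : ℝ) ^ n)⁻¹ x) ∧
      ∀ (n : ℤ) (x s : ℝ), |s| ≤ ((2 : ℝ) ^ n)⁻¹ →
        ‖bandKernel φ n (x + s) - bandKernel φ n x‖ ≤
          C * (|s| / ((2 : ℝ) ^ n)⁻¹) * pk ((2 : ℝ) ^ n)⁻¹ x := by
  -- All band kernels are dilates of this one, so Schwartz decay of κ and of its derivative gives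
  -- bounds uniform in n.
  set κ : 𝓢(ℝ, ℂ) := 𝓕⁻ (bandSymbol hφ 0) with hκ
  have hk0 : ∀ x, bandKernel φ 0 x = κ x := fun x => bandKernel_eq_fourierInv hφ 0 x
  obtain ⟨A, hA⟩ : ∃ A : ℝ, ∀ x, (1 + ‖x‖) ^ 10 * ‖κ x‖ ≤ A :=
    ⟨_, fun x => by
      simpa using SchwartzMap.one_add_le_sup_seminorm_apply (𝕜 := ℝ) (m := (10, 1)) (k := 10)
        (n := 0) le_rfl (by norm_num) κ x⟩
  obtain ⟨B, hB⟩ : ∃ B : ℝ, ∀ x, (1 + ‖x‖) ^ 10 * ‖deriv κ x‖ ≤ B :=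
    ⟨_, fun x => by
      have := SchwartzMap.one_add_le_sup_seminorm_apply (𝕜 := ℝ) (m := (10, 1)) (k := 10)
        (n := 1) le_rfl (by norm_num) κ x
      rwa [norm_iteratedFDeriv_eq_norm_iteratedDeriv, iteratedDeriv_one] at this⟩
  have hA0 : 0 ≤ A := le_trans (by positivity) (hA 0)
  have hB0 : 0 ≤ B := le_trans (by positivity) (hB 0)
  have hdiff : Differentiable ℝ κ := κ.differentiable
  have key : ∀ x s : ℝ, |s| ≤ 1 → ‖κ (x + s) - κ x‖ ≤ (5 * B * |s|) / (1 + x ^ 2) := by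
    intro x s hs
    have hb : ∀ y ∈ Metric.closedBall x |s|, ‖deriv κ y‖ ≤ 5 * B / (1 + x ^ 2) := by
      intro y hy
      rw [Metric.mem_closedBall, Real.dist_eq] at hy
      have h1 := hB y
      have h2 : |x| ≤ 1 + |y| := by
        have := abs_sub_abs_le_abs_sub x y
        rw [abs_sub_comm] at this; linarith
      have h3 : 1 + x ^ 2 ≤ 5 * (1 + ‖y‖) ^ 10 := by
        have h4 : (1 + ‖y‖) ^ 2 ≤ (1 + ‖y‖) ^ 10 :=
          pow_le_pow_right₀ (by linarith [norm_nonneg y]) (by norm_num)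
        rw [Real.norm_eq_abs] at *
        have := abs_nonneg y
        have := sq_abs x
        nlinarith [abs_nonneg x]
      rw [le_div_iff₀ (by positivity)]
      calc ‖deriv κ y‖ * (1 + x ^ 2) ≤ ‖deriv κ y‖ * (5 * (1 + ‖y‖) ^ 10) := by gcongr
        _ = 5 * ((1 + ‖y‖) ^ 10 * ‖deriv κ y‖) := by ring
        _ ≤ _ := by gcongr
    have := (convex_closedBall x |s|).norm_image_sub_le_of_norm_deriv_le
      (f := κ) (fun y _ => hdiff y) hb (Metric.mem_closedBall_self (abs_nonneg s))
      (y := x + s) (by simp)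
    rw [add_sub_cancel_left, Real.norm_eq_abs] at this
    calc _ ≤ _ := this
      _ = _ := by ring
  refine ⟨A + 5 * B + 1, by positivity, fun n x => ?_, fun n x s hs => ?_⟩
  · rw [bandKernel_scale, norm_mul, norm_two_zpow, hk0, decayKernel, inv_inv, div_inv_eq_mul]
    have h1 := hA (2 ^ n * x)
    rw [Real.norm_eq_abs, abs_mul, abs_of_pos (by positivity : (0 : ℝ) < 2 ^ n),
      mul_comm ((2 : ℝ) ^ n) |x|] at h1
    have h5 : ‖κ (2 ^ n * x)‖ ≤ A / (1 + |x| * 2 ^ n) ^ 10 := by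
      rw [le_div_iff₀ (by positivity)]; linarith
    calc (2 : ℝ) ^ n * ‖κ (2 ^ n * x)‖ ≤ 2 ^ n * ((A + 5 * B + 1) / (1 + |x| * 2 ^ n) ^ 10) := by
          gcongr; exact h5.trans (by gcongr; linarith)
      _ = _ := by ring
  · rw [bandKernel_scale, bandKernel_scale φ n x, ← mul_sub, norm_mul, norm_two_zpow, hk0, hk0,
      mul_add]
    have hp : (0 : ℝ) < 2 ^ n := by positivity
    have h1 := key (2 ^ n * x) (2 ^ n * s) (by
      rw [abs_mul, abs_of_pos hp]
      calc (2 : ℝ) ^ n * |s| ≤ 2 ^ n * (2 ^ n)⁻¹ := by gcongr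
        _ = 1 := by field_simp)
    rw [pk_eq (by positivity), inv_inv, div_inv_eq_mul, div_inv_eq_mul, mul_pow, sq_abs]
    rw [abs_mul, abs_of_pos hp] at h1
    calc (2 : ℝ) ^ n * ‖κ (2 ^ n * x + 2 ^ n * s) - κ (2 ^ n * x)‖
        ≤ 2 ^ n * (5 * B * (2 ^ n * |s|) / (1 + (2 ^ n * x) ^ 2)) := by gcongr
      _ ≤ 2 ^ n * ((A + 5 * B + 1) * (2 ^ n * |s|) / (1 + (2 ^ n * x) ^ 2)) := by
          gcongr; linarith
      _ = _ := by ring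

/-- Only boundedly many of the symbols overlap. -/
lemma exists_tsum_bandSymbol_sq_le (hφ : IsFrequencyCutoff φ) :
    ∃ C : ℝ, 0 < C ∧ ∀ (N : Finset ℤ) (ξ : ℝ), ∑ n ∈ N, ‖bandSymbol hφ n ξ‖ ^ 2 ≤ C := by
  obtain ⟨M, hM⟩ := hφ.smooth.continuous.bounded_above_of_compact_support hφ.hasCompactSupport
  have hM0 : 0 ≤ M := (norm_nonneg _).trans (hM 0)
  refine ⟨8 * M ^ 2 + 1, by positivity, fun N ξ => ?_⟩
  have hφ0 : ∀ η, φ η ≠ 0 → 1 / 4 < |η| ∧ |η| ≤ 4 := by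
    intro η h
    have := hφ.supp (subset_tsupport φ h)
    refine ⟨?_, abs_le.2 this.1⟩
    by_contra! hc
    exact this.2 (abs_le.1 hc)
  set a := |2 * Real.pi * ξ| with ha
  classical
  have hsub : ∀ n ∈ N, bandSymbol hφ n ξ ≠ 0 → (2 : ℝ) ^ n < 4 * a ∧ a ≤ 4 * 2 ^ n := by
    intro n _ hn
    rw [bandSymbol_apply] at hn
    have h1 := hφ0 _ (by exact_mod_cast hn)
    have h2 : |2 * Real.pi / (2 : ℝ) ^ n * ξ| = a / 2 ^ n := by
      rw [ha, ← abs_of_pos (by positivity : (0 : ℝ) < 2 ^ n), ← abs_div,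
        abs_of_pos (by positivity : (0 : ℝ) < 2 ^ n)]
      congr 1; ring
    rw [h2, lt_div_iff₀ (by positivity), div_le_iff₀ (by positivity)] at h1
    exact ⟨by linarith [h1.1], h1.2⟩
  rw [← Finset.sum_filter_add_sum_filter_not N (fun n => bandSymbol hφ n ξ ≠ 0)]
  have h0 : ∑ n ∈ N with ¬ bandSymbol hφ n ξ ≠ 0, ‖bandSymbol hφ n ξ‖ ^ 2 = 0 := by
    refine Finset.sum_eq_zero fun n hn => ?_
    have := (Finset.mem_filter.1 hn).2
    push Not at this
    simp [this]
  rw [h0, add_zero]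
  have hcard : (N.filter fun n => bandSymbol hφ n ξ ≠ 0).card ≤ 8 := by
    by_cases hne : (N.filter fun n => bandSymbol hφ n ξ ≠ 0).Nonempty
    · set S := N.filter fun n => bandSymbol hφ n ξ ≠ 0
      set p := S.min' hne
      have hp := hsub p (Finset.mem_filter.1 (S.min'_mem hne)).1
        (Finset.mem_filter.1 (S.min'_mem hne)).2
      -- For p and q in S, 2^q < 4a ≤ 16 · 2^p, so q lies within four steps above the minimum p.
      have : S ⊆ Finset.Ico p (p + 4) := by
        intro q hq
        have hq' := hsub q (Finset.mem_filter.1 hq).1 (Finset.mem_filter.1 hq).2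
        refine Finset.mem_Ico.2 ⟨S.min'_le q hq, ?_⟩
        have : (2 : ℝ) ^ q < 2 ^ (p + 4) := by
          rw [zpow_add₀ (by norm_num)]
          norm_num
          linarith [hq'.1, hp.2]
        exact (zpow_lt_zpow_iff_right₀ (by norm_num)).1 this
      calc S.card ≤ (Finset.Ico p (p + 4)).card := Finset.card_le_card this
        _ ≤ 8 := by simp
    · rw [Finset.not_nonempty_iff_eq_empty] at hne
      simp [hne]
  calc ∑ n ∈ N with bandSymbol hφ n ξ ≠ 0, ‖bandSymbol hφ n ξ‖ ^ 2
      ≤ ∑ n ∈ N with bandSymbol hφ n ξ ≠ 0, M ^ 2 := by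
        refine Finset.sum_le_sum fun n _ => ?_
        gcongr
        rw [bandSymbol_apply, Complex.norm_real]
        exact hM _
    _ ≤ 8 * M ^ 2 + 1 := by
        rw [Finset.sum_const, nsmul_eq_mul]
        have : ((N.filter fun n => bandSymbol hφ n ξ ≠ 0).card : ℝ) ≤ 8 := by exact_mod_cast hcard
        nlinarith [sq_nonneg M]

end CurvedTHT

/-! ### Poisson averages and replacement of a factor by its averages -/

namespace CurvedTHT

open scoped ENNReal

/-- The Poisson average of width `r`, without the factor `1/π`. -/
noncomputable def poi (r : ℝ) (h : ℝ → ℝ≥0∞) (x : ℝ) : ℝ≥0∞ :=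
  ∫⁻ y, ENNReal.ofReal (pk r (x - y)) * h y

@[fun_prop]
lemma measurable_pk (r : ℝ) : Measurable (pk r) := by unfold pk; fun_prop

@[fun_prop]
lemma measurable_decayKernel (r : ℝ) : Measurable (decayKernel r) := by
  unfold decayKernel; fun_prop

@[fun_prop]
lemma measurable_poi (r : ℝ) {h : ℝ → ℝ≥0∞} (hh : Measurable h) : Measurable (poi r h) := by
  unfold poi
  apply Measurable.lintegral_prod_right' (f := fun p : ℝ × ℝ =>
    ENNReal.ofReal (pk r (p.1 - p.2)) * h p.2)
  fun_prop

lemma poi_mono (r : ℝ) {g h : ℝ → ℝ≥0∞} (hgh : ∀ᵐ y, g y ≤ h y) (x : ℝ) :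
    poi r g x ≤ poi r h x :=
  lintegral_mono_ae (hgh.mono fun y hy => by gcongr)

lemma lintegral_pk {r : ℝ} (hr : 0 < r) :
    ∫⁻ x, ENNReal.ofReal (pk r x) = ENNReal.ofReal Real.pi := by
  have h1 : ∀ x, pk r x = r⁻¹ * (1 + (x / r) ^ 2)⁻¹ := fun x => by
    rw [pk_eq hr, div_pow, sq_abs, ← div_pow, div_eq_mul_inv]
  have hint : Integrable fun x => pk r x := by
    simp_rw [h1]
    exact (integrable_inv_one_add_sq.comp_div hr.ne').const_mul _
  rw [← ofReal_integral_eq_lintegral_ofReal hint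
    (Filter.Eventually.of_forall fun x => (pk_pos hr x).le)]
  congr 1
  simp_rw [h1]
  rw [integral_const_mul, Measure.integral_comp_div (fun x : ℝ => (1 + x ^ 2)⁻¹),
    integral_univ_inv_one_add_sq, abs_of_pos hr, smul_eq_mul]
  field_simp

lemma lintegral_pk_sub_left {r : ℝ} (hr : 0 < r) (x : ℝ) :
    ∫⁻ y, ENNReal.ofReal (pk r (x - y)) = ENNReal.ofReal Real.pi := by
  rw [lintegral_sub_left_eq_self (fun y => ENNReal.ofReal (pk r y)), lintegral_pk hr]

lemma lintegral_pk_sub_right {r : ℝ} (hr : 0 < r) (x : ℝ) :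
    ∫⁻ y, ENNReal.ofReal (pk r (y - x)) = ENNReal.ofReal Real.pi := by
  rw [lintegral_sub_right_eq_self (fun y => ENNReal.ofReal (pk r y)), lintegral_pk hr]

/-- Quadratic decay of the kernel means quadratic growth under translation. Three such factors give
the sixth power which `IsTestWeight` tolerates. -/
lemma pk_add_le {r : ℝ} (hr : 0 < r) (x s : ℝ) :
    pk r (x + s) ≤ 2 * (1 + |s| / r) ^ 2 * pk r x := by
  unfold pk
  rw [mul_div_assoc', div_le_div_iff₀ (by positivity) (by positivity)]
  have h1 : r ^ 2 + x ^ 2 ≤ 2 * (1 + |s| / r) ^ 2 * (r ^ 2 + (x + s) ^ 2) := by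
    have h2 : s ^ 2 = (|s| / r) ^ 2 * r ^ 2 := by rw [div_pow, sq_abs]; field_simp
    have h3 : 0 ≤ |s| / r := by positivity
    have h4 : 1 + (|s| / r) ^ 2 ≤ (1 + |s| / r) ^ 2 := by nlinarith
    calc r ^ 2 + x ^ 2 ≤ 2 * r ^ 2 + 2 * s ^ 2 + 2 * (x + s) ^ 2 := by
          nlinarith [sq_nonneg (x + 2 * s), sq_nonneg r]
      _ ≤ 2 * (1 + (|s| / r) ^ 2) * (r ^ 2 + (x + s) ^ 2) := by
          rw [h2]; nlinarith [sq_nonneg (|s| / r), sq_nonneg (x + s),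
            mul_nonneg (sq_nonneg (|s| / r)) (sq_nonneg (x + s))]
      _ ≤ _ := by gcongr
  nlinarith

lemma poi_add_le {r : ℝ} (hr : 0 < r) (h : ℝ → ℝ≥0∞) (x s : ℝ) :
    poi r h (x + s) ≤ ENNReal.ofReal (2 * (1 + |s| / r) ^ 2) * poi r h x := by
  unfold poi
  rw [← lintegral_const_mul' _ _ ENNReal.ofReal_ne_top]
  refine lintegral_mono fun y => ?_
  rw [← mul_assoc, ← ENNReal.ofReal_mul (by positivity)]
  gcongr
  have := pk_add_le hr (x - y) s
  rwa [show x - y + s = x + s - y by ring] at this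

/-- Poisson averages are essentially constant at their own scale. -/
lemma poi_le_poi_of_abs_sub_le {r c : ℝ} (hr : 0 < r) (_hc : 0 ≤ c) (h : ℝ → ℝ≥0∞) {x x' : ℝ}
    (hx : |x - x'| ≤ c * r) : poi r h x ≤ ENNReal.ofReal (2 * (1 + c) ^ 2) * poi r h x' := by
  have := poi_add_le hr h x' (x - x')
  rw [add_sub_cancel] at this
  refine this.trans ?_
  gcongr
  rwa [div_le_iff₀ hr]

/-- Since v = (v - y) + y, one of |v - y| and |y| is at least |v|/2. In the first case the wide
kernel at v - y is comparable to the one at v. In the second, the narrow kernel at y is at most a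
multiple of R/v², which suffices if |v| ≥ R; if |v| < R, then `pk R v` is comparable to the maximum
1/R of the wide kernel. -/
lemma pk_mul_pk_le {r R : ℝ} (hr : 0 < r) (hrR : r ≤ R) (v y : ℝ) :
    pk R (v - y) * pk r y ≤ 8 * pk R v * (pk r y + pk R (v - y)) := by
  have hR : 0 < R := hr.trans_le hrR
  have h1 := pk_pos hR v
  have h2 := pk_pos hr y
  have h3 := pk_pos hR (v - y)
  by_cases hv : v ^ 2 ≤ 4 * (v - y) ^ 2
  · have : pk R (v - y) ≤ 4 * pk R v := by
      unfold pk
      rw [mul_div_assoc', div_le_div_iff₀ (by positivity) (by positivity)]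
      nlinarith [sq_nonneg R]
    nlinarith [mul_pos h1 h2, mul_pos h1 h3]
  · have hy : v ^ 2 ≤ 4 * y ^ 2 := by nlinarith [sq_nonneg (v - 2 * y), sq_nonneg v]
    by_cases hvR : R ^ 2 ≤ v ^ 2
    · have : pk r y ≤ 8 * pk R v := by
        unfold pk
        rw [mul_div_assoc', div_le_div_iff₀ (by positivity) (by positivity)]
        calc r * (R ^ 2 + v ^ 2) ≤ R * (8 * y ^ 2) := by gcongr; linarith
          _ ≤ _ := by nlinarith [mul_pos hR (pow_pos hr 2)]
      nlinarith [mul_pos h1 h2, mul_pos h1 h3]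
    · have : pk R (v - y) ≤ 2 * pk R v := by
        unfold pk
        rw [mul_div_assoc', div_le_div_iff₀ (by positivity) (by positivity)]
        nlinarith [sq_nonneg R, mul_nonneg hR.le (sq_nonneg (v - y))]
      nlinarith [mul_pos h1 h2, mul_pos h1 h3]

/-- The constant in `poi_poi_le`. -/
noncomputable def poiConst : ℝ := 16 * Real.pi

lemma poiConst_pos : 0 < poiConst := by unfold poiConst; positivity

lemma lintegral_pk_mul_pk_le {r R : ℝ} (hr : 0 < r) (hrR : r ≤ R) (v : ℝ) :
    ∫⁻ y, ENNReal.ofReal (pk R (v - y)) * ENNReal.ofReal (pk r y) ≤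
      ENNReal.ofReal poiConst * ENNReal.ofReal (pk R v) := by
  have hR : 0 < R := hr.trans_le hrR
  calc ∫⁻ y, ENNReal.ofReal (pk R (v - y)) * ENNReal.ofReal (pk r y)
      ≤ ∫⁻ y, ENNReal.ofReal (8 * pk R v) *
          (ENNReal.ofReal (pk r y) + ENNReal.ofReal (pk R (v - y))) := by
        refine lintegral_mono fun y => ?_
        rw [← ENNReal.ofReal_mul (pk_pos hR _).le,
          ← ENNReal.ofReal_add (pk_pos hr _).le (pk_pos hR _).le,
          ← ENNReal.ofReal_mul (by have := pk_pos hR v; positivity)]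
        exact ENNReal.ofReal_le_ofReal (pk_mul_pk_le hr hrR v y)
    _ = ENNReal.ofReal (8 * pk R v) * (ENNReal.ofReal Real.pi + ENNReal.ofReal Real.pi) := by
        rw [lintegral_const_mul' _ _ ENNReal.ofReal_ne_top, lintegral_add_left (by fun_prop),
          lintegral_pk hr, lintegral_pk_sub_left hR]
    _ ≤ _ := by
        have := pk_pos hR v
        rw [← ENNReal.ofReal_add (by positivity) (by positivity),
          ← ENNReal.ofReal_mul (by positivity), ← ENNReal.ofReal_mul poiConst_pos.le]
        refine ENNReal.ofReal_le_ofReal (le_of_eq ?_)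
        unfold poiConst; ring

/-- A substitute for the semigroup law: averaging first at the finer scale costs only a constant. It
lets a piece of wavelength r be averaged over a window R and then be compared with the averages of F
at scale R. -/
lemma poi_poi_le {r R : ℝ} (hr : 0 < r) (hrR : r ≤ R) {h : ℝ → ℝ≥0∞} (hh : Measurable h)
    (x : ℝ) : poi R (poi r h) x ≤ ENNReal.ofReal poiConst * poi R h x := by
  unfold poi
  calc ∫⁻ y, ENNReal.ofReal (pk R (x - y)) * ∫⁻ z, ENNReal.ofReal (pk r (y - z)) * h z
      = ∫⁻ y, ∫⁻ z, ENNReal.ofReal (pk R (x - y)) * (ENNReal.ofReal (pk r (y - z)) * h z) := by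
        simp_rw [lintegral_const_mul' _ _ ENNReal.ofReal_ne_top]
    _ = ∫⁻ z, ∫⁻ y, ENNReal.ofReal (pk R (x - y)) * (ENNReal.ofReal (pk r (y - z)) * h z) := by
        rw [lintegral_lintegral_swap]
        exact Measurable.aemeasurable (by unfold Function.uncurry; fun_prop)
    _ ≤ ∫⁻ z, ENNReal.ofReal poiConst * (ENNReal.ofReal (pk R (x - z)) * h z) := by
        refine lintegral_mono fun z => ?_
        simp_rw [← mul_assoc]
        rw [lintegral_mul_const _ (by fun_prop)]
        gcongr
        have := lintegral_pk_mul_pk_le hr hrR (x - z)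
        rw [← lintegral_sub_right_eq_self _ z] at this
        refine le_trans (le_of_eq ?_) this
        refine lintegral_congr fun y => ?_
        rw [sub_sub_sub_cancel_right]
    _ = _ := lintegral_const_mul' _ _ ENNReal.ofReal_ne_top

lemma setLIntegral_poi (r : ℝ) {h : ℝ → ℝ≥0∞} (hh : Measurable h) (S : Set ℝ) :
    ∫⁻ x in S, poi r h x = ∫⁻ y, (∫⁻ x in S, ENNReal.ofReal (pk r (x - y))) * h y := by
  unfold poi
  rw [lintegral_lintegral_swap
    (Measurable.aemeasurable (by unfold Function.uncurry; fun_prop))]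
  refine lintegral_congr fun y => ?_
  rw [lintegral_mul_const _ (by fun_prop)]

lemma lintegral_poi {r : ℝ} (hr : 0 < r) {h : ℝ → ℝ≥0∞} (hh : Measurable h) :
    ∫⁻ x, poi r h x = ENNReal.ofReal Real.pi * ∫⁻ y, h y := by
  have := setLIntegral_poi r hh univ
  simp only [Measure.restrict_univ, lintegral_pk_sub_right hr] at this
  rw [this, lintegral_const_mul' _ _ ENNReal.ofReal_ne_top]

lemma poi_one {r : ℝ} (hr : 0 < r) (x : ℝ) : poi r (fun _ => 1) x = ENNReal.ofReal Real.pi := by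
  simp [poi, lintegral_pk_sub_left hr]

lemma inv_le_pk {R v : ℝ} (hv : |v| < R) : R⁻¹ ≤ 2 * pk R v := by
  have hR : 0 < R := (abs_nonneg v).trans_lt hv
  unfold pk
  rw [mul_div_assoc', le_div_iff₀ (by positivity)]
  have : v ^ 2 ≤ R ^ 2 := sq_le_sq' (by linarith [neg_abs_le v]) (by linarith [le_abs_self v])
  calc R⁻¹ * (R ^ 2 + v ^ 2) ≤ R⁻¹ * (2 * R ^ 2) := by gcongr; linarith
    _ = 2 * R := by field_simp

/-- An average over an interval is bounded by the Poisson average. -/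
lemma setLIntegral_ball_le_poi {R : ℝ} (hR : 0 < R) (h : ℝ → ℝ≥0∞) (x : ℝ) :
    ∫⁻ y in Metric.ball x R, h y ≤ ENNReal.ofReal (2 * R) * poi R h x := by
  unfold poi
  rw [← lintegral_const_mul' _ _ ENNReal.ofReal_ne_top]
  calc ∫⁻ y in Metric.ball x R, h y
      ≤ ∫⁻ y in Metric.ball x R,
          ENNReal.ofReal (2 * R) * (ENNReal.ofReal (pk R (x - y)) * h y) := by
        refine setLIntegral_mono' measurableSet_ball fun y hy => ?_
        rw [Metric.mem_ball, dist_comm, Real.dist_eq] at hy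
        rw [← mul_assoc, ← ENNReal.ofReal_mul (by positivity)]
        refine le_mul_of_one_le_left zero_le ?_
        rw [← ENNReal.ofReal_one]
        apply ENNReal.ofReal_le_ofReal
        have := inv_le_pk hy
        rw [inv_le_iff_one_le_mul₀ hR] at this
        linarith
    _ ≤ _ := setLIntegral_le_lintegral _ _

/-- If `g` is essentially constant at scale `R`, then in `∫ g c` the factor `c` may be replaced by
its averages at scale `R`. -/
lemma setLIntegral_mul_le_of_average_le {S : Set ℝ} (hS : MeasurableSet S) {g c : ℝ → ℝ≥0∞}
    (hg : Measurable g) (hc : Measurable c) {R : ℝ} (hR : 0 < R) {D M : ℝ≥0∞}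
    (hgD : ∀ x x', |x - x'| < R → g x ≤ D * g x')
    (hcM : ∀ x ∈ Metric.thickening R S, ∫⁻ y in Metric.ball x R, c y ≤ M * ENNReal.ofReal R) :
    ∫⁻ x in S, g x * c x ≤ D * M * ∫⁻ x in Metric.thickening R S, g x := by
  have hR0 : ENNReal.ofReal R ≠ 0 := by simpa using hR
  refine (ENNReal.mul_le_mul_iff_right hR0 ENNReal.ofReal_ne_top).1 ?_
  have hmeas : MeasurableSet {p : ℝ × ℝ | p.2 ∈ Metric.ball p.1 R} := by
    simp only [Metric.mem_ball]
    exact measurableSet_lt (by fun_prop) (by fun_prop)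
  have hmeas' : Measurable fun p : ℝ × ℝ =>
      {p : ℝ × ℝ | p.2 ∈ Metric.ball p.1 R}.indicator (fun p => g p.2 * c p.1) p :=
    Measurable.indicator (by fun_prop) hmeas
  -- The factor R is dominated by the measure of the ball of radius R at x, over which g may be
  -- replaced by D times its value at another point x'. After Fubini the integral over x sees c
  -- alone, on a ball around x'.
  calc ENNReal.ofReal R * ∫⁻ x in S, g x * c x
      ≤ ∫⁻ x in S, ∫⁻ x' in Metric.ball x R, D * (g x' * c x) := by
        rw [← lintegral_const_mul' _ _ ENNReal.ofReal_ne_top]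
        refine lintegral_mono fun x => ?_
        calc ENNReal.ofReal R * (g x * c x) ≤ ∫⁻ x' in Metric.ball x R, g x * c x := by
              rw [setLIntegral_const, Real.volume_ball, mul_comm]
              gcongr; linarith
          _ ≤ _ := by
              refine setLIntegral_mono' measurableSet_ball fun x' hx' => ?_
              rw [← mul_assoc]
              gcongr
              exact hgD x x' (by rwa [Metric.mem_ball, dist_comm, Real.dist_eq] at hx')
    _ = ∫⁻ x in S, ∫⁻ x', D * {p : ℝ × ℝ | p.2 ∈ Metric.ball p.1 R}.indicator
          (fun p => g p.2 * c p.1) (x, x') := by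
        refine lintegral_congr fun x => ?_
        rw [← lintegral_indicator measurableSet_ball]
        refine lintegral_congr fun x' => ?_
        by_cases h : x' ∈ Metric.ball x R
        · rw [indicator_of_mem h, indicator_of_mem (by exact h)]
        · rw [indicator_of_notMem h, indicator_of_notMem (by exact h), mul_zero]
    _ = ∫⁻ x', ∫⁻ x in S, D * {p : ℝ × ℝ | p.2 ∈ Metric.ball p.1 R}.indicator
          (fun p => g p.2 * c p.1) (x, x') := by
        rw [lintegral_lintegral_swap]
        exact ((measurable_const.mul hmeas').aemeasurable)
    _ ≤ ∫⁻ x', (Metric.thickening R S).indicator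
          (fun x' => D * (g x' * (M * ENNReal.ofReal R))) x' := by
        refine lintegral_mono fun x' => ?_
        by_cases h : x' ∈ Metric.thickening R S
        · rw [indicator_of_mem h]
          calc ∫⁻ x in S, D * {p : ℝ × ℝ | p.2 ∈ Metric.ball p.1 R}.indicator
                  (fun p => g p.2 * c p.1) (x, x')
              ≤ ∫⁻ x, (Metric.ball x' R).indicator (fun x => D * g x' * c x) x := by
                refine (setLIntegral_le_lintegral _ _).trans (lintegral_mono fun x => ?_)
                by_cases hx : x' ∈ Metric.ball x R
                · rw [indicator_of_mem (by exact hx), indicator_of_mem (Metric.mem_ball_comm.1 hx),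
                    mul_assoc]
                · rw [indicator_of_notMem (by exact hx), mul_zero]
                  exact zero_le
            _ = D * g x' * ∫⁻ x in Metric.ball x' R, c x := by
                rw [lintegral_indicator measurableSet_ball, lintegral_const_mul _ hc]
            _ ≤ _ := by
                rw [mul_assoc]
                gcongr
                exact hcM x' h
        · rw [indicator_of_notMem h, setLIntegral_congr_fun (g := fun _ => 0) hS, lintegral_zero]
          intro x hx
          simp only
          rw [indicator_of_notMem, mul_zero]
          intro hx'
          exact h (Metric.mem_thickening_iff.2 ⟨x, hx, hx'⟩)
    _ = ENNReal.ofReal R * (D * M * ∫⁻ x in Metric.thickening R S, g x) := by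
        rw [lintegral_indicator Metric.isOpen_thickening.measurableSet,
          ← mul_assoc, ← lintegral_const_mul _ hg]
        refine lintegral_congr fun x => ?_
        ring

end CurvedTHT

/-! ### Frequency bands in L²: pointwise control and almost orthogonality -/

namespace CurvedTHT

open scoped ENNReal FourierTransform SchwartzMap ContDiff

lemma sq_lintegral_mul_le {α : Type*} [MeasurableSpace α] (μ : Measure α) {f g : α → ℝ≥0∞}
    (hf : AEMeasurable f μ) (hg : AEMeasurable g μ) :
    (∫⁻ x, f x * g x ∂μ) ^ 2 ≤ (∫⁻ x, f x ^ 2 ∂μ) * ∫⁻ x, g x ^ 2 ∂μ := by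
  have h := ENNReal.lintegral_mul_le_Lp_mul_Lq μ Real.HolderConjugate.two_two hf hg
  simp only [Pi.mul_apply, ENNReal.rpow_two] at h
  calc _ ≤ _ := pow_le_pow_left' h 2
    _ = _ := by
      rw [mul_pow, ← ENNReal.rpow_natCast, ← ENNReal.rpow_natCast, ← ENNReal.rpow_mul,
        ← ENNReal.rpow_mul]
      norm_num

lemma sq_lintegral_weight_mul_le {α : Type*} [MeasurableSpace α] (μ : Measure α)
    {w f g : α → ℝ≥0∞} (hw : Measurable w) (hf : Measurable f) (hg : Measurable g) :
    (∫⁻ x, w x * (f x * g x) ∂μ) ^ 2 ≤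
      (∫⁻ x, w x * f x ^ 2 ∂μ) * ∫⁻ x, w x * g x ^ 2 ∂μ := by
  have h := sq_lintegral_mul_le (μ.withDensity w) hf.aemeasurable hg.aemeasurable
  have hd : ∀ {u : α → ℝ≥0∞}, Measurable u →
      ∫⁻ x, u x ∂μ.withDensity w = ∫⁻ x, w x * u x ∂μ :=
    fun hu => lintegral_withDensity_eq_lintegral_mul _ hw hu
  rwa [hd (u := fun x => f x * g x) (hf.mul hg), hd (hf.pow_const 2), hd (hg.pow_const 2)] at h

lemma sq_poi_le {r : ℝ} (hr : 0 < r) {h : ℝ → ℝ≥0∞} (hh : AEMeasurable h) (x : ℝ) :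
    poi r h x ^ 2 ≤ ENNReal.ofReal Real.pi * poi r (fun y => h y ^ 2) x := by
  have hm : poi r h x = poi r (hh.mk h) x :=
    lintegral_congr_ae (hh.ae_eq_mk.mono fun y hy => by simp only [hy])
  have hm2 : poi r (fun y => h y ^ 2) x = poi r (fun y => hh.mk h y ^ 2) x :=
    lintegral_congr_ae (hh.ae_eq_mk.mono fun y hy => by simp only [hy])
  have hmm := hh.measurable_mk
  rw [hm, hm2]
  have := sq_lintegral_weight_mul_le volume (w := fun y => ENNReal.ofReal (pk r (x - y)))
    (f := fun _ => 1) (g := hh.mk h) (by fun_prop) (by fun_prop) hmm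
  simpa [poi, lintegral_pk_sub_left hr] using this

variable {φ : ℝ → ℝ}

lemma continuous_bandKernel (hφ : IsFrequencyCutoff φ) (n : ℤ) : Continuous (bandKernel φ n) := by
  rw [show bandKernel φ n = 𝓕⁻ (bandSymbol hφ n) from
    funext fun x => bandKernel_eq_fourierInv hφ n x]
  exact SchwartzMap.continuous _

lemma exists_norm_bandKernel_le (hφ : IsFrequencyCutoff φ) (n : ℤ) :
    ∃ M, ∀ x, ‖bandKernel φ n x‖ ≤ M := by
  exact ⟨SchwartzMap.seminorm ℝ 0 0 (𝓕⁻ (bandSymbol hφ n)), fun x => by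
    rw [bandKernel_eq_fourierInv hφ n x]
    exact SchwartzMap.norm_le_seminorm ℝ _ x⟩

lemma bandPart_apply (φ : ℝ → ℝ) (n : ℤ) (f : ℝ → ℂ) (x : ℝ) :
    bandPart φ n f x = ∫ y, f y * bandKernel φ n (x - y) := rfl

lemma integrable_mul_bandKernel (hφ : IsFrequencyCutoff φ) (n : ℤ) {f : ℝ → ℂ}
    (hf : Integrable f) (x : ℝ) : Integrable fun y => f y * bandKernel φ n (x - y) := by
  obtain ⟨M, hM⟩ := exists_norm_bandKernel_le hφ n
  exact hf.mul_bdd (c := M)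
    (((continuous_bandKernel hφ n).comp (by fun_prop)).aestronglyMeasurable)
    (Filter.Eventually.of_forall fun y => hM _)

lemma bandPart_add (hφ : IsFrequencyCutoff φ) (n : ℤ) {f g : ℝ → ℂ}
    (hf : Integrable f) (hg : Integrable g) (x : ℝ) :
    bandPart φ n (fun y => f y + g y) x = bandPart φ n f x + bandPart φ n g x := by
  simp only [bandPart_apply, add_mul]
  exact integral_add (integrable_mul_bandKernel hφ n hf x) (integrable_mul_bandKernel hφ n hg x)

lemma continuous_bandPart (hφ : IsFrequencyCutoff φ) (n : ℤ) {f : ℝ → ℂ} (hf : Integrable f) :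
    Continuous (bandPart φ n f) := by
  obtain ⟨M, hM⟩ := exists_norm_bandKernel_le hφ n
  exact BddAbove.continuous_convolution_right_of_integrable _
    ⟨M, by rintro _ ⟨x, rfl⟩; exact hM x⟩ hf (continuous_bandKernel hφ n)

lemma bandPart_congr_ae (φ : ℝ → ℝ) (n : ℤ) {f g : ℝ → ℂ} (h : f =ᵐ[volume] g) :
    bandPart φ n f = bandPart φ n g := by
  ext x
  exact integral_congr_ae (h.mono fun y hy => by simp only [hy])

/-- `C` bounds the band kernels of all frequencies. -/
structure IsKernelBound (φ : ℝ → ℝ) (C : ℝ) : Prop where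
  pos : 0 < C
  decay : ∀ (n : ℤ) (x : ℝ), ‖bandKernel φ n x‖ ≤ C * decayKernel ((2 : ℝ) ^ n)⁻¹ x
  smooth : ∀ (n : ℤ) (x s : ℝ), |s| ≤ ((2 : ℝ) ^ n)⁻¹ →
    ‖bandKernel φ n (x + s) - bandKernel φ n x‖ ≤
      C * (|s| / ((2 : ℝ) ^ n)⁻¹) * pk ((2 : ℝ) ^ n)⁻¹ x

lemma exists_isKernelBound (hφ : IsFrequencyCutoff φ) : ∃ C, IsKernelBound φ C := by
  obtain ⟨C, h0, h1, h2⟩ := exists_bandKernel_bounds hφ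
  exact ⟨C, h0, h1, h2⟩

lemma IsKernelBound.enorm_bandPart_le_decay {C : ℝ} (hC : IsKernelBound φ C) (n : ℤ) (f : ℝ → ℂ)
    (x : ℝ) : ‖bandPart φ n f x‖ₑ ≤ ENNReal.ofReal C *
      ∫⁻ y, ENNReal.ofReal (decayKernel ((2 : ℝ) ^ n)⁻¹ (x - y)) * ‖f y‖ₑ := by
  rw [bandPart_apply, ← lintegral_const_mul' _ _ ENNReal.ofReal_ne_top]
  refine (enorm_integral_le_lintegral_enorm _).trans (lintegral_mono fun y => ?_)
  rw [enorm_mul, mul_comm, ← mul_assoc, ← ENNReal.ofReal_mul hC.pos.le]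
  gcongr
  rw [← ofReal_norm]
  exact ENNReal.ofReal_le_ofReal (hC.decay n _)

lemma IsKernelBound.enorm_bandPart_le {C : ℝ} (hC : IsKernelBound φ C) (n : ℤ) (f : ℝ → ℂ)
    (x : ℝ) : ‖bandPart φ n f x‖ₑ ≤
      ENNReal.ofReal C * poi ((2 : ℝ) ^ n)⁻¹ (fun y => ‖f y‖ₑ) x := by
  refine (hC.enorm_bandPart_le_decay n f x).trans ?_
  unfold poi
  gcongr
  exact decayKernel_le_pk (by positivity) _

/-- Jensen's inequality for the Poisson average, then Fubini. It controls approximation errors in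
the orthogonality estimate, where a loss in the number of bands is harmless. -/
lemma IsKernelBound.lintegral_sq_bandPart_le {C : ℝ} (hC : IsKernelBound φ C) (n : ℤ)
    {f : ℝ → ℂ} (hf : AEStronglyMeasurable f) :
    ∫⁻ x, ‖bandPart φ n f x‖ₑ ^ 2 ≤
      ENNReal.ofReal (C * Real.pi) ^ 2 * ∫⁻ x, ‖f x‖ₑ ^ 2 := by
  have hr : (0 : ℝ) < ((2 : ℝ) ^ n)⁻¹ := by positivity
  obtain ⟨g, hg, hfg⟩ := hf
  have hgm := hg.measurable
  have hfg' : ∫⁻ x, ‖f x‖ₑ ^ 2 = ∫⁻ x, ‖g x‖ₑ ^ 2 :=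
    lintegral_congr_ae (hfg.mono fun x hx => by simp only [hx])
  rw [bandPart_congr_ae φ n hfg, hfg']
  calc ∫⁻ x, ‖bandPart φ n g x‖ₑ ^ 2
      ≤ ∫⁻ x, ENNReal.ofReal C ^ 2 * (ENNReal.ofReal Real.pi *
          poi ((2 : ℝ) ^ n)⁻¹ (fun y => ‖g y‖ₑ ^ 2) x) := by
        refine lintegral_mono fun x => ?_
        calc _ ≤ _ := pow_le_pow_left' (hC.enorm_bandPart_le n g x) 2
          _ ≤ _ := by
            rw [mul_pow]
            gcongr
            exact sq_poi_le hr (by fun_prop) x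
    _ = _ := by
        rw [lintegral_const_mul' _ _ (by simp), lintegral_const_mul' _ _ (by simp),
          lintegral_poi hr (by fun_prop), ENNReal.ofReal_mul hC.pos.le]
        ring

lemma ofReal_integral_sq_norm (g : 𝓢(ℝ, ℂ)) :
    ENNReal.ofReal (∫ x, ‖g x‖ ^ 2) = ∫⁻ x, ‖g x‖ₑ ^ 2 := by
  rw [ofReal_integral_eq_lintegral_ofReal]
  · refine lintegral_congr fun x => ?_
    rw [ENNReal.ofReal_pow (norm_nonneg _), ofReal_norm]
  · exact (g.memLp 2).integrable_norm_pow (by norm_num)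
  · exact Filter.Eventually.of_forall fun x => by positivity

/-- Plancherel and the convolution theorem. Once each band is multiplication by its symbol, the
bounded overlap of the symbols can be summed under the integral. -/
lemma lintegral_sq_bandPart_schwartz (hφ : IsFrequencyCutoff φ) (n : ℤ) (g : 𝓢(ℝ, ℂ)) :
    ∫⁻ x, ‖bandPart φ n g x‖ₑ ^ 2 = ∫⁻ ξ, ‖bandSymbol hφ n ξ‖ₑ ^ 2 * ‖𝓕 g ξ‖ₑ ^ 2 := by
  set κ : 𝓢(ℝ, ℂ) := 𝓕⁻ (bandSymbol hφ n) with hκ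
  have h1 : ∀ x, bandPart φ n g x =
      SchwartzMap.convolution (ContinuousLinearMap.mul ℂ ℂ) g κ x := fun x => by
    rw [SchwartzMap.convolution_apply]
    unfold bandPart
    rw [show bandKernel φ n = κ from funext fun x => bandKernel_eq_fourierInv hφ n x]
  simp_rw [h1]
  rw [← ofReal_integral_sq_norm, ← SchwartzMap.integral_norm_sq_fourier, ofReal_integral_sq_norm,
    SchwartzMap.fourier_convolution]
  refine lintegral_congr fun ξ => ?_
  rw [SchwartzMap.pairing_apply_apply, hκ]
  simp only [FourierTransform.fourier_fourierInv_eq, ContinuousLinearMap.mul_apply']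
  rw [enorm_mul, mul_pow, mul_comm]

/-- Almost orthogonality of the frequency bands. -/
lemma exists_sum_lintegral_sq_bandPart_le (hφ : IsFrequencyCutoff φ) :
    ∃ C : ℝ, 0 < C ∧ ∀ f : ℝ → ℂ, Integrable f → MemLp f 2 volume → ∀ N : Finset ℤ,
      ∑ n ∈ N, ∫⁻ x, ‖bandPart φ n f x‖ₑ ^ 2 ≤ ENNReal.ofReal C * ∫⁻ x, ‖f x‖ₑ ^ 2 := by
  obtain ⟨A, hA0, hA⟩ := exists_tsum_bandSymbol_sq_le hφ
  obtain ⟨K, hK⟩ := exists_isKernelBound hφ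
  have hS : ∀ (g : 𝓢(ℝ, ℂ)) (N : Finset ℤ),
      ∑ n ∈ N, ∫⁻ x, ‖bandPart φ n g x‖ₑ ^ 2 ≤ ENNReal.ofReal A * ∫⁻ x, ‖g x‖ₑ ^ 2 := by
    intro g N
    simp_rw [lintegral_sq_bandPart_schwartz hφ]
    rw [← lintegral_finsetSum' _ (fun n _ => by
      have := (bandSymbol hφ n).continuous
      have := (𝓕 g).continuous
      fun_prop), ← ofReal_integral_sq_norm g, ← SchwartzMap.integral_norm_sq_fourier,
      ofReal_integral_sq_norm, ← lintegral_const_mul' _ _ ENNReal.ofReal_ne_top]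
    refine lintegral_mono fun ξ => ?_
    rw [← Finset.sum_mul]
    gcongr
    have := ENNReal.ofReal_le_ofReal (hA N ξ)
    rw [ENNReal.ofReal_sum_of_nonneg (fun _ _ => by positivity)] at this
    simpa [ENNReal.ofReal_pow] using this
  have hsq : ∀ a b : ℂ, ‖a + b‖ₑ ^ 2 ≤ 2 * ‖a‖ₑ ^ 2 + 2 * ‖b‖ₑ ^ 2 := by
    intro a b
    have h : ‖a + b‖ ^ 2 ≤ 2 * ‖a‖ ^ 2 + 2 * ‖b‖ ^ 2 := by
      nlinarith [norm_add_le a b, norm_nonneg (a + b), sq_nonneg (‖a‖ - ‖b‖)]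
    have := ENNReal.ofReal_le_ofReal h
    rw [ENNReal.ofReal_add (by positivity) (by positivity), ENNReal.ofReal_mul (by norm_num),
      ENNReal.ofReal_mul (by norm_num)] at this
    simpa [ENNReal.ofReal_pow] using this
  -- One factor 2 comes from splitting f into a smooth approximant and an error on each band, the
  -- other from bounding the norm of the approximant by that of f.
  refine ⟨4 * A, by positivity, fun f hf hf2 N => ?_⟩
  -- The coefficient of the squared approximation error. It depends on the number of bands, which
  -- disappears when ε tends to zero with N fixed.
  set L : ℝ≥0∞ := 4 * ENNReal.ofReal A + 2 * N.card * ENNReal.ofReal (K * Real.pi) ^ 2 with hL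
  have hLtop : L ≠ ⊤ := by simp [hL, ENNReal.mul_eq_top]
  have key : ∀ ε : ℝ, 0 < ε → ∑ n ∈ N, ∫⁻ x, ‖bandPart φ n f x‖ₑ ^ 2 ≤
      ENNReal.ofReal (4 * A) * (∫⁻ x, ‖f x‖ₑ ^ 2) + L * ENNReal.ofReal ε ^ 2 := by
    intro ε hε
    obtain ⟨g, hg1, hg2, hg3⟩ := hf2.exist_eLpNorm_sub_le (by norm_num) (by norm_num) hε
    set G : 𝓢(ℝ, ℂ) := hg1.toSchwartzMap hg2 with hG
    have hGg : ∀ x, G x = g x := fun _ => rfl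
    have hfg : ∫⁻ x, ‖f x - G x‖ₑ ^ 2 ≤ ENNReal.ofReal ε ^ 2 := by
      have h1 := eLpNorm_nnreal_pow_eq_lintegral (f := f - g) (μ := volume) (p := 2) (by norm_num)
      simp only [NNReal.coe_ofNat, ENNReal.rpow_two, ENNReal.coe_ofNat] at h1
      calc ∫⁻ x, ‖f x - G x‖ₑ ^ 2 = ∫⁻ x, ‖(f - g) x‖ₑ ^ 2 := rfl
        _ = _ := h1.symm
        _ ≤ _ := pow_le_pow_left' hg3 2
    have hGi : Integrable G := G.integrable
    have hb : ∀ n x, ‖bandPart φ n f x‖ₑ ^ 2 ≤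
        2 * ‖bandPart φ n G x‖ₑ ^ 2 + 2 * ‖bandPart φ n (fun y => f y - G y) x‖ₑ ^ 2 := by
      intro n x
      have h := bandPart_add hφ n hGi (hf.sub hGi) x
      simp only [Pi.sub_apply, add_sub_cancel] at h
      rw [h]
      exact hsq _ _
    have hGf : ∫⁻ x, ‖G x‖ₑ ^ 2 ≤ 2 * (∫⁻ x, ‖f x‖ₑ ^ 2) + 2 * ENNReal.ofReal ε ^ 2 := by
      calc ∫⁻ x, ‖G x‖ₑ ^ 2 ≤ ∫⁻ x, (2 * ‖f x‖ₑ ^ 2 + 2 * ‖f x - G x‖ₑ ^ 2) := by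
            refine lintegral_mono fun x => ?_
            have := hsq (f x) (-(f x - G x))
            rwa [enorm_neg, neg_sub, add_sub_cancel] at this
        _ = 2 * (∫⁻ x, ‖f x‖ₑ ^ 2) + 2 * ∫⁻ x, ‖f x - G x‖ₑ ^ 2 := by
            have hfm : AEMeasurable (fun x => 2 * ‖f x‖ₑ ^ 2) volume :=
              (hf.1.enorm.pow_const 2).const_mul 2
            rw [lintegral_add_left' hfm, lintegral_const_mul' _ _ (by norm_num),
              lintegral_const_mul' _ _ (by norm_num)]
        _ ≤ _ := by gcongr
    calc ∑ n ∈ N, ∫⁻ x, ‖bandPart φ n f x‖ₑ ^ 2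
        ≤ ∑ n ∈ N, (2 * (∫⁻ x, ‖bandPart φ n G x‖ₑ ^ 2) +
            2 * (ENNReal.ofReal (K * Real.pi) ^ 2 * ENNReal.ofReal ε ^ 2)) := by
          refine Finset.sum_le_sum fun n _ => ?_
          calc _ ≤ ∫⁻ x, (2 * ‖bandPart φ n G x‖ₑ ^ 2 +
                2 * ‖bandPart φ n (fun y => f y - G y) x‖ₑ ^ 2) := lintegral_mono (hb n)
            _ = 2 * (∫⁻ x, ‖bandPart φ n G x‖ₑ ^ 2) +
                2 * ∫⁻ x, ‖bandPart φ n (fun y => f y - G y) x‖ₑ ^ 2 := by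
              have := continuous_bandPart hφ n hGi
              rw [lintegral_add_left (by fun_prop), lintegral_const_mul' _ _ (by norm_num),
                lintegral_const_mul' _ _ (by norm_num)]
            _ ≤ _ := by
              gcongr
              refine (hK.lintegral_sq_bandPart_le n (hf.sub hGi).1).trans ?_
              gcongr
              exact hfg
      _ = 2 * (∑ n ∈ N, ∫⁻ x, ‖bandPart φ n G x‖ₑ ^ 2) +
            2 * N.card * ENNReal.ofReal (K * Real.pi) ^ 2 * ENNReal.ofReal ε ^ 2 := by
          rw [Finset.sum_add_distrib, ← Finset.mul_sum, Finset.sum_const, nsmul_eq_mul]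
          ring
      _ ≤ 2 * (ENNReal.ofReal A * (2 * (∫⁻ x, ‖f x‖ₑ ^ 2) + 2 * ENNReal.ofReal ε ^ 2)) +
            2 * N.card * ENNReal.ofReal (K * Real.pi) ^ 2 * ENNReal.ofReal ε ^ 2 := by
          gcongr
          exact (hS G N).trans (by gcongr)
      _ = _ := by
          rw [hL, ENNReal.ofReal_mul (p := 4) (by norm_num), ENNReal.ofReal_ofNat]
          ring
  have hlim : Filter.Tendsto (fun ε : ℝ => ENNReal.ofReal (4 * A) * (∫⁻ x, ‖f x‖ₑ ^ 2) +
      L * ENNReal.ofReal ε ^ 2) (nhdsWithin 0 (Ioi 0))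
      (nhds (ENNReal.ofReal (4 * A) * ∫⁻ x, ‖f x‖ₑ ^ 2)) := by
    have h1 : Filter.Tendsto (fun ε : ℝ => ENNReal.ofReal ε ^ 2) (nhdsWithin 0 (Ioi 0))
        (nhds 0) := by
      have : Continuous fun ε : ℝ => ENNReal.ofReal ε ^ 2 := 
      (ENNReal.continuous_pow 2).comp ENNReal.continuous_ofReal
      simpa using (this.tendsto 0).mono_left nhdsWithin_le_nhds
    have h2 := ENNReal.Tendsto.const_mul (a := L) h1 (Or.inr hLtop)
    simpa using h2.const_add (ENNReal.ofReal (4 * A) * ∫⁻ x, ‖f x‖ₑ ^ 2)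
  exact ge_of_tendsto hlim (eventually_nhdsWithin_of_forall fun ε hε => key ε hε)

end CurvedTHT

/-! ### Maximal dyadic intervals and the exceptional set -/

namespace CurvedTHT

open scoped ENNReal

/-- The dyadic interval `[a 2^q, (a+1) 2^q)` with index `(q, a)`. -/
def dyadic (i : ℤ × ℤ) : Set ℝ := Ico ((i.2 : ℝ) * 2 ^ i.1) (((i.2 : ℝ) + 1) * 2 ^ i.1)

/-- The length of a dyadic interval. -/
noncomputable def dyLen (i : ℤ × ℤ) : ℝ := 2 ^ i.1

/-- The center of a dyadic interval. -/
noncomputable def dyCenter (i : ℤ × ℤ) : ℝ := ((i.2 : ℝ) + 1 / 2) * 2 ^ i.1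

lemma dyLen_pos (i : ℤ × ℤ) : 0 < dyLen i := by unfold dyLen; positivity

lemma measurableSet_dyadic (i : ℤ × ℤ) : MeasurableSet (dyadic i) := measurableSet_Ico

lemma volume_dyadic (i : ℤ × ℤ) : volume (dyadic i) = ENNReal.ofReal (dyLen i) := by
  rw [dyadic, Real.volume_Ico, dyLen]; congr 1; ring

lemma mem_dyadic_iff {i : ℤ × ℤ} {x : ℝ} : x ∈ dyadic i ↔ ⌊x / 2 ^ i.1⌋ = i.2 := by
  rw [Int.floor_eq_iff, dyadic, mem_Ico, le_div_iff₀ (by positivity), div_lt_iff₀ (by positivity)]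

lemma mem_dyadic_floor (q : ℤ) (x : ℝ) : x ∈ dyadic (q, ⌊x / 2 ^ q⌋) := mem_dyadic_iff.2 rfl

lemma abs_sub_dyCenter_le {i : ℤ × ℤ} {x : ℝ} (hx : x ∈ dyadic i) :
    |x - dyCenter i| ≤ dyLen i / 2 := by
  obtain ⟨h1, h2⟩ := hx
  rw [abs_le]
  unfold dyCenter dyLen
  constructor <;> linarith

lemma dyadic_subset_of_le {i j : ℤ × ℤ} (hij : i.1 ≤ j.1) {x : ℝ} (hi : x ∈ dyadic i)
    (hj : x ∈ dyadic j) : dyadic i ⊆ dyadic j := by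
  obtain ⟨d, hd⟩ := Int.eq_ofNat_of_zero_le (sub_nonneg.2 hij)
  have hpow : (2 : ℝ) ^ j.1 = 2 ^ i.1 * ((2 ^ d : ℤ) : ℝ) := by
    rw [show j.1 = i.1 + d by lia, zpow_add₀ two_ne_zero]; push_cast; rfl
  have hp : (0 : ℝ) < 2 ^ i.1 := by positivity
  obtain ⟨h1, h2⟩ := hi
  obtain ⟨h3, h4⟩ := hj
  rw [hpow] at h3 h4
  -- The endpoints of the longer interval are integer multiples of the shorter length, so the strict
  -- inequalities satisfied by x are inequalities between integers and sharpen by one unit to the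
  -- inclusion.
  have a1 : j.2 * 2 ^ d < i.2 + 1 := by
    have : (j.2 : ℝ) * ((2 ^ d : ℤ) : ℝ) < (i.2 : ℝ) + 1 := by
      refine lt_of_mul_lt_mul_right ?_ hp.le
      linarith
    exact_mod_cast this
  have a2 : i.2 < (j.2 + 1) * 2 ^ d := by
    have : (i.2 : ℝ) < ((j.2 : ℝ) + 1) * ((2 ^ d : ℤ) : ℝ) := by
      refine lt_of_mul_lt_mul_right ?_ hp.le
      linarith
    exact_mod_cast this
  have b1 : (j.2 : ℝ) * ((2 ^ d : ℤ) : ℝ) ≤ i.2 := by exact_mod_cast Int.lt_add_one_iff.1 a1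
  have b2 : (i.2 : ℝ) + 1 ≤ ((j.2 : ℝ) + 1) * ((2 ^ d : ℤ) : ℝ) := by
    exact_mod_cast Int.add_one_le_of_lt a2
  refine Ico_subset_Ico ?_ ?_ <;> rw [hpow]
  · calc _ = (j.2 : ℝ) * ((2 ^ d : ℤ) : ℝ) * 2 ^ i.1 := by ring
      _ ≤ _ := by gcongr
  · calc _ ≤ ((j.2 : ℝ) + 1) * ((2 ^ d : ℤ) : ℝ) * 2 ^ i.1 := by gcongr
      _ = _ := by ring

/-- `F` has density more than `h` in the dyadic interval `i`. -/
def DenseIn (F : Set ℝ) (h : ℝ) (i : ℤ × ℤ) : Prop :=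
  ENNReal.ofReal (h * dyLen i) < volume (F ∩ dyadic i)

/-- The maximal dyadic intervals in which `F` has density more than `h`. -/
def stopping (F : Set ℝ) (h : ℝ) : Set (ℤ × ℤ) :=
  {i | DenseIn F h i ∧ ∀ j : ℤ × ℤ, i.1 < j.1 → dyadic i ⊆ dyadic j → ¬ DenseIn F h j}

/-- The union of the stopping intervals. -/
def stopSet (F : Set ℝ) (h : ℝ) : Set ℝ := ⋃ i : stopping F h, dyadic i

/-- The union of enlarged stopping intervals. -/
def exceptional (F : Set ℝ) (h : ℝ) : Set ℝ :=
  ⋃ i : stopping F h, Metric.ball (dyCenter i) (3 * dyLen i)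

variable {F : Set ℝ} {h : ℝ}

lemma stopping_eq_of_mem {i j : ℤ × ℤ} (hi : i ∈ stopping F h) (hj : j ∈ stopping F h) {x : ℝ}
    (hxi : x ∈ dyadic i) (hxj : x ∈ dyadic j) : i = j := by
  rcases lt_trichotomy i.1 j.1 with hlt | heq | hlt
  · exact absurd hj.1 (hi.2 j hlt (dyadic_subset_of_le hlt.le hxi hxj))
  · rw [mem_dyadic_iff] at hxi hxj
    refine Prod.ext heq ?_
    rw [← hxi, ← hxj, heq]
  · exact absurd hi.1 (hj.2 i hlt (dyadic_subset_of_le hlt.le hxj hxi))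

lemma pairwise_disjoint_stopping (F : Set ℝ) (h : ℝ) :
    Pairwise (Function.onFun Disjoint fun i : stopping F h => dyadic i) := by
  intro i j hij
  rw [Function.onFun, Set.disjoint_left]
  intro x hxi hxj
  exact hij (Subtype.ext (stopping_eq_of_mem i.2 j.2 hxi hxj))

lemma measurableSet_stopSet (F : Set ℝ) (h : ℝ) : MeasurableSet (stopSet F h) :=
  MeasurableSet.iUnion fun i => measurableSet_dyadic i

lemma setLIntegral_stopSet (F : Set ℝ) (h : ℝ) (f : ℝ → ℝ≥0∞) :
    ∫⁻ y in stopSet F h, f y = ∑' i : stopping F h, ∫⁻ y in dyadic i, f y :=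
  lintegral_iUnion (s := fun i : stopping F h => dyadic i)
    (fun i => measurableSet_dyadic i) (pairwise_disjoint_stopping F h) f

lemma isOpen_exceptional (F : Set ℝ) (h : ℝ) : IsOpen (exceptional F h) :=
  isOpen_iUnion fun _ => Metric.isOpen_ball

/-- The dyadic parent has twice the length and, by maximality, density at most h. -/
lemma volume_inter_le_of_stopping {i : ℤ × ℤ} (hi : i ∈ stopping F h) :
    volume (F ∩ dyadic i) ≤ ENNReal.ofReal (2 * h * dyLen i) := by
  set x : ℝ := (i.2 : ℝ) * 2 ^ i.1
  have hx : x ∈ dyadic i := ⟨le_rfl, by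
    have : (0 : ℝ) < 2 ^ i.1 := by positivity
    simp only [x]; linarith⟩
  have hsub := dyadic_subset_of_le (i := i) (j := (i.1 + 1, ⌊x / 2 ^ (i.1 + 1)⌋)) (by simp) hx
    (mem_dyadic_floor _ _)
  have := hi.2 _ (by simp) hsub
  rw [DenseIn, not_lt] at this
  calc volume (F ∩ dyadic i) ≤ _ := measure_mono (inter_subset_inter_right F hsub)
    _ ≤ _ := this
    _ = _ := by
      congr 1
      simp only [dyLen]
      rw [zpow_add₀ two_ne_zero]; ring

/-- Density above h forces the length below |F|/h, so among the dense dyadic intervals through a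
given point there is a longest one. -/
lemma exists_stopping_of_denseIn (hh : 0 < h) (hF : volume F ≠ ⊤) {i : ℤ × ℤ}
    (hi : DenseIn F h i) : ∃ j ∈ stopping F h, dyadic i ⊆ dyadic j := by
  have hne : ∃ x, x ∈ dyadic i := ⟨(i.2 : ℝ) * 2 ^ i.1, le_rfl, by
    have : (0 : ℝ) < 2 ^ i.1 := by positivity
    linarith⟩
  obtain ⟨x, hx⟩ := hne
  have hfl := mem_dyadic_iff.1 hx
  have hbdd : ∃ b : ℤ, ∀ q : ℤ, (i.1 ≤ q ∧ DenseIn F h (q, ⌊x / 2 ^ q⌋)) → q ≤ b := by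
    obtain ⟨b, hb⟩ := pow_unbounded_of_one_lt ((volume F).toReal / h) (one_lt_two (α := ℝ))
    refine ⟨b, fun q hq => ?_⟩
    by_contra! hlt
    have h1 : (2 : ℝ) ^ (b : ℤ) ≤ 2 ^ q := zpow_le_zpow_right₀ one_le_two hlt.le
    have h2 := hq.2.trans_le (measure_mono inter_subset_left)
    rw [ENNReal.ofReal_lt_iff_lt_toReal (by have := dyLen_pos (q, ⌊x / 2 ^ q⌋); positivity) hF] at h2
    rw [div_lt_iff₀ hh] at hb
    simp only [dyLen] at h2
    rw [zpow_natCast] at h1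
    nlinarith
  obtain ⟨q, hq, hmax⟩ := Int.exists_greatest_of_bdd hbdd ⟨i.1, le_rfl, by rwa [hfl]⟩
  have hxq := mem_dyadic_floor q x
  refine ⟨(q, ⌊x / 2 ^ q⌋), ⟨hq.2, fun j hj hsub hd => ?_⟩, dyadic_subset_of_le hq.1 hx hxq⟩
  have hxj := mem_dyadic_iff.1 (hsub hxq)
  simp only at hj
  have := hmax j.1 ⟨hq.1.trans hj.le, by rwa [hxj]⟩
  lia

lemma stopping_eq_empty (hh : 1 ≤ h) : stopping F h = ∅ := by
  rw [Set.eq_empty_iff_forall_notMem]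
  intro i hi
  have h1 := hi.1.trans_le (measure_mono inter_subset_right)
  rw [volume_dyadic] at h1
  refine absurd h1 (not_lt.2 (ENNReal.ofReal_le_ofReal ?_))
  nlinarith [dyLen_pos i]

/-- By Lebesgue's density theorem the stopping intervals cover almost all of `F`. -/
lemma volume_diff_stopSet (hh : 0 < h) (hh1 : h < 1) (hF : volume F ≠ ⊤)
    (hFm : MeasurableSet F) : volume (F \ stopSet F h) = 0 := by
  -- The dyadic intervals are not centred at x. This form of the density theorem only asks that x
  -- lie in the closed balls, whose centres w n may vary. The limiting density 1 exceeds h because h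
  -- < 1.
  have hd := IsUnifLocDoublingMeasure.ae_tendsto_measure_inter_div (volume : Measure ℝ) F 1
  rw [ae_restrict_iff' hFm] at hd
  rw [← compl_mem_ae_iff]
  filter_upwards [hd] with x hx
  intro hxF
  refine hxF.2 ?_
  set w : ℕ → ℝ := fun n => dyCenter (-(n : ℤ), ⌊x / 2 ^ (-(n : ℤ))⌋) with hw
  set δ : ℕ → ℝ := fun n => (1 / 2) ^ (n + 1) with hδ
  have hlen : ∀ n : ℕ, dyLen (-(n : ℤ), ⌊x / 2 ^ (-(n : ℤ))⌋) = 2 * δ n := by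
    intro n
    simp only [dyLen, hδ]
    rw [zpow_neg, zpow_natCast, pow_succ, one_div, inv_pow]; ring
  have hδ0 : Filter.Tendsto δ Filter.atTop (nhdsWithin 0 (Ioi 0)) := by
    rw [tendsto_nhdsWithin_iff]
    refine ⟨?_, Filter.Eventually.of_forall fun n => by simp only [hδ, mem_Ioi]; positivity⟩
    exact (tendsto_pow_atTop_nhds_zero_of_lt_one (by norm_num) (by norm_num)).comp
      (Filter.tendsto_add_atTop_nat 1)
  have hlim := hx hxF.1 w δ hδ0 (Filter.Eventually.of_forall fun n => by
    rw [Metric.mem_closedBall, Real.dist_eq, one_mul]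
    have := abs_sub_dyCenter_le (mem_dyadic_floor (-(n : ℤ)) x)
    rw [hlen] at this
    linarith)
  have hlt : ENNReal.ofReal h < 1 := by
    rw [← ENNReal.ofReal_one]; exact (ENNReal.ofReal_lt_ofReal_iff one_pos).2 hh1
  obtain ⟨n, hn⟩ := (hlim.eventually (lt_mem_nhds hlt)).exists
  set i : ℤ × ℤ := (-(n : ℤ), ⌊x / 2 ^ (-(n : ℤ))⌋) with hi
  have hcb : Metric.closedBall (w n) (δ n) = Icc ((i.2 : ℝ) * 2 ^ i.1) (((i.2 : ℝ) + 1) * 2 ^ i.1) := by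
    rw [Real.closedBall_eq_Icc]
    have h1 : w n = ((i.2 : ℝ) + 1 / 2) * 2 ^ i.1 := rfl
    have h2 : (2 : ℝ) ^ i.1 = 2 * δ n := hlen n
    rw [h1, h2]
    congr 1 <;> ring
  have hdense : DenseIn F h i := by
    have hae : (F ∩ Metric.closedBall (w n) (δ n) : Set ℝ) =ᵐ[volume] (F ∩ dyadic i : Set ℝ) := by
      rw [hcb, dyadic]
      exact (Filter.EventuallyEq.refl _ F).inter Ico_ae_eq_Icc.symm
    have hv : volume (Metric.closedBall (w n) (δ n)) = ENNReal.ofReal (dyLen i) := by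
      rw [Real.volume_closedBall, hlen n]
    rw [measure_congr hae, hv] at hn
    rw [DenseIn, ENNReal.ofReal_mul hh.le]
    rwa [ENNReal.lt_div_iff_mul_lt
      (Or.inl (by simpa using dyLen_pos i)) (Or.inl ENNReal.ofReal_ne_top)] at hn
  obtain ⟨j, hj, hsub⟩ := exists_stopping_of_denseIn hh hF hdense
  exact mem_iUnion.2 ⟨⟨j, hj⟩, hsub (mem_dyadic_floor _ x)⟩

lemma tsum_volume_inter_stopping_le (hFm : MeasurableSet F) :
    ∑' i : stopping F h, volume (F ∩ dyadic i) ≤ volume F := by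
  rw [← measure_iUnion]
  · exact measure_mono (iUnion_subset fun i => inter_subset_left)
  · intro i j hij
    exact (pairwise_disjoint_stopping F h hij).mono inter_subset_right inter_subset_right
  · exact fun i => hFm.inter (measurableSet_dyadic i)

/-- The weak type (1,1) estimate: the disjoint stopping intervals each contain more than the
fraction h of F, and an enlarged interval is 6 times as long. -/
lemma volume_exceptional_le (hh : 0 < h) (hFm : MeasurableSet F) :
    ENNReal.ofReal h * volume (exceptional F h) ≤ 6 * volume F := by
  calc ENNReal.ofReal h * volume (exceptional F h)
      ≤ ENNReal.ofReal h * ∑' i : stopping F h, ENNReal.ofReal (6 * dyLen i) := by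
        gcongr
        refine (measure_iUnion_le _).trans (ENNReal.tsum_le_tsum fun i => ?_)
        rw [Real.volume_ball]
        exact ENNReal.ofReal_le_ofReal (by linarith)
    _ = ∑' i : stopping F h, 6 * ENNReal.ofReal (h * dyLen i) := by
        rw [← ENNReal.tsum_mul_left]
        refine tsum_congr fun i => ?_
        rw [ENNReal.ofReal_mul (by norm_num), ENNReal.ofReal_mul hh.le, ENNReal.ofReal_ofNat]
        ring
    _ ≤ 6 * ∑' i : stopping F h, volume (F ∩ dyadic i) := by
        rw [ENNReal.tsum_mul_left]
        gcongr with i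
        exact i.2.1.le
    _ ≤ _ := by gcongr; exact tsum_volume_inter_stopping_le hFm

lemma three_mul_dyLen_le {x : ℝ} (hx : x ∉ exceptional F h) {i : ℤ × ℤ} (hi : i ∈ stopping F h) :
    3 * dyLen i ≤ |x - dyCenter i| := by
  by_contra! hlt
  exact hx (mem_iUnion.2 ⟨⟨i, hi⟩, by rwa [Metric.mem_ball, Real.dist_eq]⟩)

lemma pk_le_four_mul_pk {R u v : ℝ} (hR : 0 < R) (huv : |v| ≤ 2 * |u|) :
    pk R u ≤ 4 * pk R v := by
  unfold pk
  rw [mul_div_assoc', div_le_div_iff₀ (by positivity) (by positivity)]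
  have : v ^ 2 ≤ 4 * u ^ 2 := by
    rw [← sq_abs v, ← sq_abs u]; nlinarith [abs_nonneg v, abs_nonneg u]
  nlinarith [sq_nonneg R]

/-- Outside the exceptional set all Poisson averages of `F` are controlled by `h`. -/
lemma poi_indicator_le (hh : 0 < h) (hF : volume F ≠ ⊤) (hFm : MeasurableSet F) {x : ℝ}
    (hx : x ∉ exceptional F h) {R : ℝ} (hR : 0 < R) :
    poi R (F.indicator 1) x ≤ ENNReal.ofReal (32 * Real.pi * min 1 h) := by
  rcases le_or_gt 1 h with h1 | h1
  · rw [min_eq_left h1]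
    calc poi R (F.indicator 1) x ≤ poi R (fun _ => 1) x :=
          poi_mono R (Filter.Eventually.of_forall fun y => indicator_le_self' (by simp) y) x
      _ = _ := poi_one hR x
      _ ≤ _ := ENNReal.ofReal_le_ofReal (by linarith [Real.pi_pos])
  rw [min_eq_right h1.le]
  -- As x is at least three lengths away from the centre, the kernel on the interval is within a
  -- factor 4 of its value at the centre, in both directions. With the density bound 2h this gives
  -- 32 = 4 · 2 · 4: the mass of F may be spread evenly over the interval, and the spread masses add
  -- up to at most the integral of the kernel.
  have hQ : ∀ i : stopping F h, ∫⁻ y in F ∩ dyadic i, ENNReal.ofReal (pk R (x - y)) ≤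
      ENNReal.ofReal (32 * h) * ∫⁻ y in dyadic i, ENNReal.ofReal (pk R (x - y)) := by
    intro i
    have h3 := three_mul_dyLen_le hx i.2
    have hl := dyLen_pos (i : ℤ × ℤ)
    set c := dyCenter (i : ℤ × ℤ)
    have hpc := pk_pos hR (x - c)
    have hup : ∀ y ∈ dyadic (i : ℤ × ℤ), pk R (x - y) ≤ 4 * pk R (x - c) := fun y hy => by
      have := abs_sub_dyCenter_le hy
      refine pk_le_four_mul_pk hR ?_
      have h5 := abs_add_le (x - y) (y - c)
      rw [sub_add_sub_cancel] at h5
      linarith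
    have hlo : ∀ y ∈ dyadic (i : ℤ × ℤ), pk R (x - c) ≤ 4 * pk R (x - y) := fun y hy => by
      have := abs_sub_dyCenter_le hy
      rw [abs_sub_comm] at this
      refine pk_le_four_mul_pk hR ?_
      have h5 := abs_add_le (x - c) (c - y)
      rw [sub_add_sub_cancel] at h5
      linarith
    calc ∫⁻ y in F ∩ dyadic i, ENNReal.ofReal (pk R (x - y))
        ≤ ∫⁻ y in F ∩ dyadic i, ENNReal.ofReal (4 * pk R (x - c)) :=
          setLIntegral_mono' (hFm.inter (measurableSet_dyadic i)) fun y hy =>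
            ENNReal.ofReal_le_ofReal (hup y hy.2)
      _ ≤ ENNReal.ofReal (4 * pk R (x - c)) * ENNReal.ofReal (2 * h * dyLen i) := by
          rw [setLIntegral_const]
          gcongr
          exact volume_inter_le_of_stopping i.2
      _ = ENNReal.ofReal (8 * h) * ∫⁻ y in dyadic i, ENNReal.ofReal (pk R (x - c)) := by
          rw [setLIntegral_const, volume_dyadic, ← ENNReal.ofReal_mul (by positivity),
            ← ENNReal.ofReal_mul (by positivity), ← ENNReal.ofReal_mul (by positivity)]
          congr 1; ring
      _ ≤ ENNReal.ofReal (8 * h) *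
            ∫⁻ y in dyadic i, ENNReal.ofReal 4 * ENNReal.ofReal (pk R (x - y)) := by
          gcongr 1
          refine setLIntegral_mono' (measurableSet_dyadic i) fun y hy => ?_
          rw [← ENNReal.ofReal_mul (by norm_num)]
          exact ENNReal.ofReal_le_ofReal (hlo y hy)
      _ = _ := by
          rw [lintegral_const_mul' _ _ ENNReal.ofReal_ne_top, ← mul_assoc,
            ← ENNReal.ofReal_mul (by positivity)]
          congr 2; ring
  have hcov : volume.restrict F ≤ volume.restrict (⋃ i : stopping F h, F ∩ dyadic i) := by
    refine Measure.restrict_mono_ae ?_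
    have := volume_diff_stopSet hh h1 hF hFm
    rw [← compl_mem_ae_iff] at this
    filter_upwards [this] with y hy hyF
    by_contra hn
    refine hy ⟨hyF, fun hs => hn ?_⟩
    rw [stopSet, mem_iUnion] at hs
    obtain ⟨i, hi⟩ := hs
    exact mem_iUnion.2 ⟨i, hyF, hi⟩
  calc poi R (F.indicator 1) x = ∫⁻ y in F, ENNReal.ofReal (pk R (x - y)) := by
        rw [poi, ← lintegral_indicator hFm]
        refine lintegral_congr fun y => ?_
        by_cases hy : y ∈ F <;> simp [hy]
    _ ≤ ∫⁻ y in ⋃ i : stopping F h, F ∩ dyadic i, ENNReal.ofReal (pk R (x - y)) :=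
        lintegral_mono' hcov le_rfl
    _ ≤ ∑' i : stopping F h, ∫⁻ y in F ∩ dyadic i, ENNReal.ofReal (pk R (x - y)) :=
        lintegral_iUnion_le _ _
    _ ≤ ∑' i : stopping F h,
          ENNReal.ofReal (32 * h) * ∫⁻ y in dyadic i, ENNReal.ofReal (pk R (x - y)) :=
        ENNReal.tsum_le_tsum hQ
    _ = ENNReal.ofReal (32 * h) * ∫⁻ y in stopSet F h, ENNReal.ofReal (pk R (x - y)) := by
        rw [ENNReal.tsum_mul_left, setLIntegral_stopSet]
    _ ≤ ENNReal.ofReal (32 * h) * ENNReal.ofReal Real.pi := by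
        gcongr
        exact (setLIntegral_le_lintegral _ _).trans (lintegral_pk_sub_left hR x).le
    _ = _ := by
        rw [← ENNReal.ofReal_mul (by positivity)]; congr 1; ring

end CurvedTHT

/-! ### Calderón–Zygmund decomposition and the total contribution of a bad part -/

namespace CurvedTHT

open scoped ENNReal

open Classical in
/-- The good part of `f`: on each stopping interval `f` is replaced by its mean. -/
noncomputable def good (F : Set ℝ) (h : ℝ) (f : ℝ → ℂ) (y : ℝ) : ℂ :=
  if hy : ∃ i : stopping F h, y ∈ dyadic i then ⨍ z in dyadic (hy.choose : ℤ × ℤ), f z else f y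

/-- The bad part of `f`. -/
noncomputable def bad (F : Set ℝ) (h : ℝ) (f : ℝ → ℂ) (y : ℝ) : ℂ := f y - good F h f y

variable {F : Set ℝ} {h : ℝ} {f : ℝ → ℂ}

lemma good_of_mem (i : stopping F h) {y : ℝ} (hy : y ∈ dyadic i) :
    good F h f y = ⨍ z in dyadic i, f z := by
  have hex : ∃ i : stopping F h, y ∈ dyadic i := ⟨i, hy⟩
  rw [good, dif_pos hex, stopping_eq_of_mem hex.choose.2 i.2 hex.choose_spec hy]

lemma good_of_notMem {y : ℝ} (hy : y ∉ stopSet F h) : good F h f y = f y := by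
  rw [good, dif_neg]
  simpa [stopSet] using hy

lemma bad_of_notMem {y : ℝ} (hy : y ∉ stopSet F h) : bad F h f y = 0 := by
  rw [bad, good_of_notMem hy, sub_self]

lemma good_add_bad (y : ℝ) : good F h f y + bad F h f y = f y := by simp [bad]

lemma measurable_good (hf : Measurable f) : Measurable (good F h f) := by
  intro s hs
  -- The choice in the definition of `good` is immaterial because the stopping intervals are
  -- disjoint: the function is constant on each of countably many intervals and equals f elsewhere.
  have : good F h f ⁻¹' s = (⋃ i : {i : stopping F h // (⨍ z in dyadic i, f z) ∈ s}, dyadic i.1) ∪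
      (f ⁻¹' s ∩ (stopSet F h)ᶜ) := by
    ext y
    by_cases hy : y ∈ stopSet F h
    · obtain ⟨i, hi⟩ := mem_iUnion.1 hy
      simp only [mem_preimage, good_of_mem i hi, mem_union, mem_iUnion, mem_inter_iff, mem_compl_iff,
        hy, not_true_eq_false, and_false, or_false]
      constructor
      · exact fun hs => ⟨⟨i, hs⟩, hi⟩
      · rintro ⟨⟨j, hj⟩, hyj⟩
        rwa [Subtype.ext (stopping_eq_of_mem i.2 j.2 hi hyj)]
    · simp only [mem_preimage, good_of_notMem hy, mem_union, mem_iUnion, mem_inter_iff,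
        mem_compl_iff, hy, not_false_eq_true, and_true]
      constructor
      · exact Or.inr
      · rintro (⟨⟨j, hj⟩, hyj⟩ | h')
        · exact absurd (mem_iUnion.2 ⟨j, hyj⟩) hy
        · exact h'
  rw [this]
  exact (MeasurableSet.iUnion fun i => measurableSet_dyadic _).union
    ((hf hs).inter (measurableSet_stopSet F h).compl)

lemma measurable_bad (hf : Measurable f) : Measurable (bad F h f) := hf.sub (measurable_good hf)

lemma enorm_good_mul_le (i : stopping F h) {y : ℝ} (hy : y ∈ dyadic i) :
    ENNReal.ofReal (dyLen i) * ‖good F h f y‖ₑ ≤ ∫⁻ z in dyadic i, ‖f z‖ₑ := by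
  have hl := dyLen_pos (i : ℤ × ℤ)
  rw [good_of_mem i hy, setAverage_eq, enorm_smul, measureReal_def, volume_dyadic,
    ENNReal.toReal_ofReal hl.le, Real.enorm_eq_ofReal (by positivity), ← mul_assoc,
    ← ENNReal.ofReal_mul hl.le, mul_inv_cancel₀ hl.ne', ENNReal.ofReal_one, one_mul]
  exact enorm_integral_le_lintegral_enorm _

lemma lintegral_good_le :
    ∫⁻ y, ‖good F h f y‖ₑ ≤ ∫⁻ y, ‖f y‖ₑ := by
  rw [← lintegral_add_compl _ (measurableSet_stopSet F h),
    ← lintegral_add_compl (fun y => ‖f y‖ₑ) (measurableSet_stopSet F h),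
    setLIntegral_stopSet, setLIntegral_stopSet]
  refine add_le_add (ENNReal.tsum_le_tsum fun i => ?_) ?_
  · have hl := dyLen_pos (i : ℤ × ℤ)
    have hv : ENNReal.ofReal (dyLen i) ≠ 0 := by simpa using hl
    calc ∫⁻ y in dyadic i, ‖good F h f y‖ₑ
        ≤ ∫⁻ y in dyadic i, (ENNReal.ofReal (dyLen i))⁻¹ * ∫⁻ z in dyadic i, ‖f z‖ₑ := by
          refine setLIntegral_mono' (measurableSet_dyadic i) fun y hy => ?_
          rw [← ENNReal.mul_le_iff_le_inv hv ENNReal.ofReal_ne_top]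
          exact enorm_good_mul_le i hy
      _ = _ := by
          rw [setLIntegral_const, volume_dyadic, mul_right_comm,
            ENNReal.inv_mul_cancel hv ENNReal.ofReal_ne_top, one_mul]
  · exact (setLIntegral_congr_fun (measurableSet_stopSet F h).compl fun y hy => by
      simp only [good_of_notMem hy]).le

lemma lintegral_bad_le (hf : Measurable f) :
    ∫⁻ y, ‖bad F h f y‖ₑ ≤ 2 * ∫⁻ y, ‖f y‖ₑ := by
  calc ∫⁻ y, ‖bad F h f y‖ₑ ≤ ∫⁻ y, (‖f y‖ₑ + ‖good F h f y‖ₑ) :=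
        lintegral_mono fun y => enorm_sub_le
    _ = (∫⁻ y, ‖f y‖ₑ) + ∫⁻ y, ‖good F h f y‖ₑ := lintegral_add_left (by fun_prop) _
    _ ≤ _ := by rw [two_mul]; exact add_le_add_right (lintegral_good_le) _

/-- No density exceeds one, so heights h ≥ 1 select no intervals and the decomposition is trivial.
This is why the bounds for good and bad parts carry `min 1 h`. -/
lemma bad_eq_zero (hh : 1 ≤ h) (y : ℝ) : bad F h f y = 0 := by
  refine bad_of_notMem fun hy => ?_
  obtain ⟨i, -⟩ := mem_iUnion.1 hy
  exact (stopping_eq_empty hh).subset i.2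

lemma enorm_le_of_dominated (hf : ∀ᵐ y, ‖f y‖ ≤ F.indicator (fun _ => (1 : ℝ)) y) :
    ∀ᵐ y, ‖f y‖ₑ ≤ F.indicator 1 y := by
  filter_upwards [hf] with y hy
  by_cases hyF : y ∈ F
  · rw [indicator_of_mem hyF] at hy ⊢
    rw [← ofReal_norm, Pi.one_apply, ENNReal.ofReal_le_one]
    exact hy
  · rw [indicator_of_notMem hyF] at hy ⊢
    rw [← ofReal_norm]
    simpa using hy

lemma lintegral_le_of_dominated (hFm : MeasurableSet F)
    (hf : ∀ᵐ y, ‖f y‖ₑ ≤ F.indicator 1 y) : ∫⁻ y, ‖f y‖ₑ ≤ volume F :=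
  (lintegral_mono_ae hf).trans (lintegral_indicator_one hFm).le

/-- The good part is bounded by the stopping height. -/
lemma enorm_good_le (hh : 0 < h) (hF : volume F ≠ ⊤) (hFm : MeasurableSet F)
    (hf : ∀ᵐ y, ‖f y‖ₑ ≤ F.indicator 1 y) :
    ∀ᵐ y, ‖good F h f y‖ₑ ≤ ENNReal.ofReal (2 * min 1 h) := by
  rcases le_or_gt 1 h with h1 | h1
  · filter_upwards [hf] with y hy
    have h0 : good F h f y = f y := by
      rw [← good_add_bad (F := F) (h := h) (f := f) y, bad_eq_zero h1, add_zero]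
    rw [h0, min_eq_left h1]
    refine hy.trans ((indicator_le_self' (by simp) y).trans ?_)
    simp
  · rw [min_eq_right h1.le]
    have := volume_diff_stopSet hh h1 hF hFm
    rw [← compl_mem_ae_iff] at this
    filter_upwards [hf, this] with y hy hyF
    by_cases hyS : y ∈ stopSet F h
    · obtain ⟨i, hi⟩ := mem_iUnion.1 hyS
      have hl := dyLen_pos (i : ℤ × ℤ)
      have hv : ENNReal.ofReal (dyLen i) ≠ 0 := by simpa using hl
      refine (ENNReal.mul_le_mul_iff_right hv ENNReal.ofReal_ne_top).1 ?_
      calc _ ≤ _ := enorm_good_mul_le i hi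
        _ ≤ ∫⁻ z in dyadic i, F.indicator 1 z := lintegral_mono_ae (ae_restrict_of_ae hf)
        _ = volume (F ∩ dyadic i) := by
            rw [lintegral_indicator_one hFm, Measure.restrict_apply hFm]
        _ ≤ _ := volume_inter_le_of_stopping i.2
        _ = _ := by
            rw [← ENNReal.ofReal_mul hl.le]; congr 1; ring
    · rw [good_of_notMem hyS]
      have : y ∉ F := fun hy' => hyF ⟨hy', hyS⟩
      rw [indicator_of_notMem this] at hy
      exact hy.trans zero_le

lemma integrable_of_lintegral_ne_top {g : ℝ → ℂ} (hg : Measurable g)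
    (h : ∫⁻ y, ‖g y‖ₑ ≠ ⊤) : Integrable g :=
  ⟨hg.aestronglyMeasurable, lt_top_iff_ne_top.2 h⟩

lemma setIntegral_bad (hfi : Integrable f) (i : stopping F h) :
    ∫ y in dyadic i, bad F h f y = 0 := by
  have hl := dyLen_pos (i : ℤ × ℤ)
  have h1 : ∫ y in dyadic i, bad F h f y = ∫ y in dyadic i, (f y - ⨍ z in dyadic i, f z) :=
    setIntegral_congr_fun (measurableSet_dyadic i) fun y hy => by
      simp only [bad, good_of_mem i hy]
  have hv : volume (dyadic (i : ℤ × ℤ)) ≠ ⊤ := by rw [volume_dyadic]; exact ENNReal.ofReal_ne_top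
  rw [h1, integral_sub hfi.integrableOn (integrableOn_const hv), setIntegral_const, setAverage_eq,
    measureReal_def, volume_dyadic, ENNReal.toReal_ofReal hl.le, smul_smul,
    mul_inv_cancel₀ hl.ne', one_smul, sub_self]

/-- The bad part, each stopping interval of length `l` being weighted with `min 1 (l / r)`. -/
noncomputable def badMass (F : Set ℝ) (h : ℝ) (f : ℝ → ℂ) (r : ℝ) (y : ℝ) : ℝ≥0∞ :=
  ∑' i : stopping F h, (dyadic (i : ℤ × ℤ)).indicator
    (fun y => ENNReal.ofReal (min 1 (dyLen i / r)) * ‖bad F h f y‖ₑ) y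

lemma measurable_badMass (hf : Measurable f) (r : ℝ) : Measurable (badMass F h f r) := by
  have := measurable_bad (F := F) (h := h) hf
  exact Measurable.tsum fun i => Measurable.indicator (by fun_prop) (measurableSet_dyadic i)

lemma lintegral_mul_badMass (hf : Measurable f) (r : ℝ) {w : ℝ → ℝ≥0∞} (hw : Measurable w) :
    ∫⁻ y, w y * badMass F h f r y = ∑' i : stopping F h,
      ENNReal.ofReal (min 1 (dyLen i / r)) * ∫⁻ y in dyadic i, w y * ‖bad F h f y‖ₑ := by
  have hb := measurable_bad (F := F) (h := h) hf
  unfold badMass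
  simp_rw [← ENNReal.tsum_mul_left]
  have hm : ∀ i : stopping F h, AEMeasurable (fun y => w y * (dyadic (i : ℤ × ℤ)).indicator
      (fun y => ENNReal.ofReal (min 1 (dyLen i / r)) * ‖bad F h f y‖ₑ) y) := fun i =>
    (hw.mul (Measurable.indicator (by fun_prop) (measurableSet_dyadic i))).aemeasurable
  rw [lintegral_tsum hm]
  refine tsum_congr fun i => ?_
  rw [← lintegral_const_mul _ (by fun_prop), ← lintegral_indicator (measurableSet_dyadic i)]
  refine lintegral_congr fun y => ?_
  by_cases hy : y ∈ dyadic (i : ℤ × ℤ)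
  · simp only [indicator_of_mem hy]; ring
  · simp only [indicator_of_notMem hy, mul_zero]

variable {φ : ℝ → ℝ}

/-- The cancellation of the bad part gains on stopping intervals shorter than the wavelength. -/
lemma IsKernelBound.enorm_bandPart_bad_le {C : ℝ} (hC : IsKernelBound φ C)
    (hφ : IsFrequencyCutoff φ) (n : ℤ) (hf : Measurable f) (hfi : Integrable f) (x : ℝ) :
    ‖bandPart φ n (bad F h f) x‖ₑ ≤
      ENNReal.ofReal C * poi ((2 : ℝ) ^ n)⁻¹ (badMass F h f ((2 : ℝ) ^ n)⁻¹) x := by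
  set r : ℝ := ((2 : ℝ) ^ n)⁻¹ with hr
  have hr0 : 0 < r := by positivity
  have hbm := measurable_bad (F := F) (h := h) hf
  have hbi : Integrable (bad F h f) := by
    refine integrable_of_lintegral_ne_top hbm (ne_top_of_le_ne_top ?_ (lintegral_bad_le hf))
    exact ENNReal.mul_ne_top (by norm_num) hfi.2.ne
  have hint := integrable_mul_bandKernel hφ n hbi x
  have hsupp : bandPart φ n (bad F h f) x =
      ∫ y in ⋃ i : stopping F h, dyadic i, bad F h f y * bandKernel φ n (x - y) := by
    rw [bandPart_apply, setIntegral_eq_integral_of_forall_compl_eq_zero]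
    intro y hy
    rw [bad_of_notMem hy, zero_mul]
  rw [hsupp, ← (hasSum_integral_iUnion (fun i : stopping F h => measurableSet_dyadic i)
    (pairwise_disjoint_stopping F h) hint.integrableOn).tsum_eq, poi,
    lintegral_mul_badMass hf r (by fun_prop), ← ENNReal.tsum_mul_left]
  refine enorm_tsum_le_tsum_enorm.trans (ENNReal.tsum_le_tsum fun i => ?_)
  have hl := dyLen_pos (i : ℤ × ℤ)
  have hm0 : 0 ≤ min 1 (dyLen (i : ℤ × ℤ) / r) := by positivity
  set c := dyCenter (i : ℤ × ℤ) with hc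
  have key : ‖∫ y in dyadic i, bad F h f y * bandKernel φ n (x - y)‖ₑ ≤
      ∫⁻ y in dyadic i, ENNReal.ofReal (C * min 1 (dyLen i / r) * pk r (x - y)) *
        ‖bad F h f y‖ₑ := by
    rcases le_or_gt r (dyLen (i : ℤ × ℤ)) with hrl | hrl
    · refine (enorm_integral_le_lintegral_enorm _).trans (lintegral_mono fun y => ?_)
      rw [enorm_mul, mul_comm, min_eq_left (by rwa [one_le_div hr0]), mul_one]
      gcongr
      rw [← ofReal_norm]
      refine ENNReal.ofReal_le_ofReal ((hC.decay n _).trans ?_)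
      have := decayKernel_le_pk hr0 (x - y)
      have := hC.pos
      gcongr
    -- For intervals shorter than the wavelength, the mean zero of the bad part permits subtracting
    -- the kernel at the centre; the kernel difference gains l/r.
    · have h0 : ∫ y in dyadic i, bad F h f y * bandKernel φ n (x - c) = 0 := by
        rw [integral_mul_const, setIntegral_bad hfi, zero_mul]
      have h1 : ∫ y in dyadic i, bad F h f y * bandKernel φ n (x - y) =
          ∫ y in dyadic i, bad F h f y * (bandKernel φ n (x - y) - bandKernel φ n (x - c)) := by
        simp_rw [mul_sub]
        rw [integral_sub hint.integrableOn (hbi.integrableOn.mul_const _), h0, sub_zero]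
      rw [h1]
      refine (enorm_integral_le_lintegral_enorm _).trans
        (setLIntegral_mono' (measurableSet_dyadic i) fun y hy => ?_)
      rw [enorm_mul, mul_comm]
      gcongr
      rw [← ofReal_norm]
      refine ENNReal.ofReal_le_ofReal ?_
      have hd := abs_sub_dyCenter_le hy
      rw [← hc] at hd
      -- The base point is x - y rather than x - c, so that the bound is already a Poisson kernel in
      -- the variable of integration.
      have := hC.smooth n (x - y) (y - c) (by linarith)
      rw [sub_add_sub_cancel, norm_sub_rev] at this
      refine this.trans ?_
      have hp := pk_pos hr0 (x - y)
      have := hC.pos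
      rw [← hr, min_eq_right (by rw [div_le_one hr0]; exact hrl.le)]
      gcongr
      linarith
  refine key.trans (le_of_eq ?_)
  rw [← lintegral_const_mul _ (by fun_prop), ← lintegral_const_mul _ (by fun_prop)]
  refine lintegral_congr fun y => ?_
  have hp := pk_pos hr0 (x - y)
  rw [ENNReal.ofReal_mul (by have := hC.pos; positivity), ENNReal.ofReal_mul hC.pos.le]
  ring

/-- A family of scales indexed by `k`, with wavelengths `2^(-m-s k)` and windows `2^(-s k)`, costs
only a factor `m` in the bad part. -/
lemma sum_min_le (m : ℕ) (q : ℤ) {s : ℕ → ℤ} (hs : Function.Injective s) :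
    ∑' k : ℕ, ENNReal.ofReal (min 1 ((2 : ℝ) ^ q / ((2 : ℝ) ^ (m + s k))⁻¹) *
      min 1 (((2 : ℝ) ^ s k)⁻¹ / 2 ^ q)) ≤ ENNReal.ofReal (4 * (m + 1)) := by
  have hgeo : ∀ c : ℤ, ∑' l : ℤ, ENNReal.ofReal ((1 / 2 : ℝ) ^ (l - c).natAbs) ≤ 4 := by
    intro c
    have h1 : ∑' l : ℤ, ENNReal.ofReal ((1 / 2 : ℝ) ^ (l - c).natAbs) =
        ∑' l : ℤ, ENNReal.ofReal ((1 / 2 : ℝ) ^ l.natAbs) :=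
      (Equiv.subRight c).tsum_eq fun l : ℤ => ENNReal.ofReal ((1 / 2 : ℝ) ^ l.natAbs)
    have h2 : ∀ n : ℕ, ENNReal.ofReal ((1 / 2 : ℝ) ^ n) = (2⁻¹ : ℝ≥0∞) ^ n := fun n => by
      rw [ENNReal.ofReal_pow (by norm_num), one_div, ENNReal.ofReal_inv_of_pos (by norm_num),
        ENNReal.ofReal_ofNat]
    rw [h1, tsum_of_nat_of_neg_add_one ENNReal.summable ENNReal.summable]
    have h3 : ∀ n : ℕ, (-((n : ℤ) + 1)).natAbs = n + 1 := fun n => by lia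
    simp_rw [h3, Int.natAbs_natCast, h2, pow_succ]
    rw [ENNReal.tsum_mul_right, ENNReal.tsum_geometric, ENNReal.one_sub_inv_two, inv_inv,
      ENNReal.mul_inv_cancel (by norm_num) (by norm_num)]
    norm_num
  -- The first minimum decays for l < -q - m and the second for l > -q. The m + 1 integers -q - i
  -- with 0 ≤ i ≤ m lie in between, where neither factor helps. Every l is charged to the nearest of
  -- them with geometric decay in the distance.
  have hpt : ∀ l : ℤ, ENNReal.ofReal (min 1 ((2 : ℝ) ^ q / ((2 : ℝ) ^ (m + l))⁻¹) *
      min 1 (((2 : ℝ) ^ l)⁻¹ / 2 ^ q)) ≤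
      ∑ i ∈ Finset.range (m + 1), ENNReal.ofReal ((1 / 2 : ℝ) ^ (l - (-q - i)).natAbs) := by
    intro l
    have hA : (2 : ℝ) ^ q / ((2 : ℝ) ^ (m + l))⁻¹ = 2 ^ (q + m + l) := by
      rw [div_inv_eq_mul, ← zpow_add₀ two_ne_zero]; congr 1; ring
    have hB : ((2 : ℝ) ^ l)⁻¹ / 2 ^ q = 2 ^ (-q - l) := by
      rw [div_eq_mul_inv, ← zpow_neg, ← zpow_neg, ← zpow_add₀ two_ne_zero]; congr 1; ring
    rw [hA, hB]
    have hneg : ∀ z : ℤ, 0 ≤ z → (2 : ℝ) ^ (-z) = (1 / 2) ^ z.natAbs := by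
      intro z hz
      obtain ⟨d, rfl⟩ := Int.eq_ofNat_of_zero_le hz
      simp
    have hsingle : ∀ i ≤ m, ∀ t : ℝ, t ≤ (1 / 2 : ℝ) ^ (l - (-q - i)).natAbs →
        ENNReal.ofReal t ≤
          ∑ i ∈ Finset.range (m + 1), ENNReal.ofReal ((1 / 2 : ℝ) ^ (l - (-q - i)).natAbs) := by
      intro i hi t ht
      refine (ENNReal.ofReal_le_ofReal ht).trans ?_
      exact Finset.single_le_sum (f := fun i : ℕ =>
        ENNReal.ofReal ((1 / 2 : ℝ) ^ (l - (-q - i)).natAbs)) (fun _ _ => zero_le)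
        (Finset.mem_range.2 (by lia))
    have hx0 : (0 : ℝ) ≤ min 1 (2 ^ (q + m + l)) := by positivity
    have hy0 : (0 : ℝ) ≤ min 1 (2 ^ (-q - l)) := by positivity
    have hx1 : min 1 ((2 : ℝ) ^ (q + m + l)) ≤ 1 := min_le_left _ _
    have hy1 : min 1 ((2 : ℝ) ^ (-q - l)) ≤ 1 := min_le_left _ _
    rcases le_or_gt 0 (l + q) with h1 | h1
    · refine hsingle 0 (by lia) _ ?_
      calc _ ≤ min 1 ((2 : ℝ) ^ (-q - l)) := mul_le_of_le_one_left hy0 hx1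
        _ ≤ 2 ^ (-(l + q)) := (min_le_right _ _).trans (by
          rw [show -q - l = -(l + q) by ring])
        _ = _ := by rw [hneg _ h1]; congr 2; push_cast; ring
    · rcases le_or_gt (q + m + l) 0 with h2 | h2
      · refine hsingle m le_rfl _ ?_
        calc _ ≤ min 1 ((2 : ℝ) ^ (q + m + l)) := mul_le_of_le_one_right hx0 hy1
          _ ≤ 2 ^ (-(-(q + m + l))) := (min_le_right _ _).trans (by rw [neg_neg])
          _ = _ := by rw [hneg _ (by lia)]; congr 1; lia
      · refine hsingle (-(l + q)).natAbs (by lia) _ ?_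
        rw [show (l - (-q - (((-(l + q)).natAbs : ℕ) : ℤ))).natAbs = 0 by lia, pow_zero]
        exact mul_le_one₀ hx1 hy0 hy1
  calc ∑' k : ℕ, ENNReal.ofReal (min 1 ((2 : ℝ) ^ q / ((2 : ℝ) ^ (m + s k))⁻¹) *
          min 1 (((2 : ℝ) ^ s k)⁻¹ / 2 ^ q))
      ≤ ∑' l : ℤ, ENNReal.ofReal (min 1 ((2 : ℝ) ^ q / ((2 : ℝ) ^ (m + l))⁻¹) *
          min 1 (((2 : ℝ) ^ l)⁻¹ / 2 ^ q)) := ENNReal.tsum_comp_le_tsum_of_injective hs _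
    _ ≤ ∑' l : ℤ, ∑ i ∈ Finset.range (m + 1),
          ENNReal.ofReal ((1 / 2 : ℝ) ^ (l - (-q - i)).natAbs) := ENNReal.tsum_le_tsum hpt
    _ = ∑ i ∈ Finset.range (m + 1), ∑' l : ℤ,
          ENNReal.ofReal ((1 / 2 : ℝ) ^ (l - (-q - i)).natAbs) :=
        Summable.tsum_finsetSum fun _ _ => ENNReal.summable
    _ ≤ ∑ i ∈ Finset.range (m + 1), 4 := Finset.sum_le_sum fun i _ => hgeo _
    _ = _ := by
        rw [Finset.sum_const, Finset.card_range, nsmul_eq_mul, ENNReal.ofReal_mul (by norm_num),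
          ENNReal.ofReal_ofNat, mul_comm, ← Nat.cast_succ, ENNReal.ofReal_natCast]

lemma lintegral_pk_far {r d : ℝ} (hr : 0 < r) (hd : 0 < d) :
    ∫⁻ v in {v : ℝ | d ≤ |v|}, ENNReal.ofReal (pk r v) ≤ ENNReal.ofReal (2 * r / d) := by
  have hsub : {v : ℝ | d ≤ |v|} ⊆ Ici d ∪ (Neg.neg ⁻¹' Ici d) := by
    intro v hv
    rcases le_abs.1 hv.out with h | h
    · exact Or.inl h
    · exact Or.inr h
  have h1 : ∫⁻ v in Ici d, ENNReal.ofReal (pk r v) ≤ ENNReal.ofReal (r / d) := by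
    have hI : IntegrableOn (fun v : ℝ => v ^ (-2 : ℝ)) (Ioi d) :=
      integrableOn_Ioi_rpow_of_lt (by norm_num) hd
    calc ∫⁻ v in Ici d, ENNReal.ofReal (pk r v)
        = ∫⁻ v in Ioi d, ENNReal.ofReal (pk r v) := setLIntegral_congr Ioi_ae_eq_Ici.symm
      _ ≤ ∫⁻ v in Ioi d, ENNReal.ofReal r * ENNReal.ofReal (v ^ (-2 : ℝ)) := by
          refine setLIntegral_mono' measurableSet_Ioi fun v hv => ?_
          have hv0 : 0 < v := hd.trans hv
          rw [← ENNReal.ofReal_mul hr.le]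
          refine ENNReal.ofReal_le_ofReal ?_
          rw [Real.rpow_neg hv0.le, Real.rpow_two, pk, div_eq_mul_inv]
          gcongr
          nlinarith
      _ = ENNReal.ofReal r * ENNReal.ofReal (∫ v in Ioi d, v ^ (-2 : ℝ)) := by
          rw [lintegral_const_mul' _ _ ENNReal.ofReal_ne_top, ofReal_integral_eq_lintegral_ofReal hI]
          exact (ae_restrict_iff' measurableSet_Ioi).2 (Filter.Eventually.of_forall fun v hv =>
            Real.rpow_nonneg (hd.trans hv).le _)
      _ = _ := by
          rw [integral_Ioi_rpow_of_lt (by norm_num) hd, ← ENNReal.ofReal_mul hr.le]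
          congr 1
          norm_num
          rw [Real.rpow_neg_one, div_eq_mul_inv]
  have h2 : ∫⁻ v in Neg.neg ⁻¹' Ici d, ENNReal.ofReal (pk r v) =
      ∫⁻ v in Ici d, ENNReal.ofReal (pk r v) := by
    have := (Measure.measurePreserving_neg (volume : Measure ℝ)).setLIntegral_comp_preimage
      (measurableSet_Ici (a := d)) (f := fun v => ENNReal.ofReal (pk r v)) (by fun_prop)
    rw [← this]
    simp [pk]
  calc _ ≤ _ := lintegral_mono_set hsub
    _ ≤ _ := lintegral_union_le _ _ _
    _ ≤ ENNReal.ofReal (r / d) + ENNReal.ofReal (r / d) := by rw [h2]; gcongr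
    _ = _ := by rw [← ENNReal.ofReal_add (by positivity) (by positivity)]; congr 1; ring

/-- Total contribution of the bad part, near a set which avoids the exceptional set. -/
lemma tsum_setLIntegral_badMass_le (hf : Measurable f) {S : Set ℝ}
    (hS : ∀ x ∈ S, x ∉ exceptional F h) (m : ℕ) {s : ℕ → ℤ} (hs : Function.Injective s) :
    ∑' k : ℕ, ∫⁻ u in Metric.thickening (100 * ((2 : ℝ) ^ s k)⁻¹) S,
      poi ((2 : ℝ) ^ (m + s k))⁻¹ (badMass F h f ((2 : ℝ) ^ (m + s k))⁻¹) u ≤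
      ENNReal.ofReal (1600 * (m + 1)) * ∫⁻ y, ‖bad F h f y‖ₑ := by
  have hb := measurable_bad (F := F) (h := h) hf
  have hpt : ∀ (k : ℕ) (i : stopping F h) (y : ℝ), y ∈ dyadic (i : ℤ × ℤ) →
      ∫⁻ u in Metric.thickening (100 * ((2 : ℝ) ^ s k)⁻¹) S,
        ENNReal.ofReal (pk ((2 : ℝ) ^ (m + s k))⁻¹ (u - y)) ≤
      ENNReal.ofReal (400 * min 1 (((2 : ℝ) ^ s k)⁻¹ / dyLen i)) := by
    intro k i y hy
    set R : ℝ := ((2 : ℝ) ^ s k)⁻¹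
    set r : ℝ := ((2 : ℝ) ^ (m + s k))⁻¹
    have hR : 0 < R := by positivity
    have hr : 0 < r := by positivity
    have hrR : r ≤ R := by
      simp only [r, R]
      gcongr
      · norm_num
      · lia
    have hl := dyLen_pos (i : ℤ × ℤ)
    -- If the length l is at most 100R, the minimum is at least 1/100 and the total mass π of the
    -- kernel suffices. If l > 100R, then u is within l of a point at distance at least 3l from the
    -- centre, while y is within l/2 of the centre; hence |u - y| ≥ l and only the tail of the
    -- kernel is seen.
    rcases le_or_gt (dyLen (i : ℤ × ℤ)) (100 * R) with h1 | h1
    · calc _ ≤ _ := setLIntegral_le_lintegral _ _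
        _ = _ := lintegral_pk_sub_right hr y
        _ ≤ _ := by
          refine ENNReal.ofReal_le_ofReal ?_
          have : 1 / 100 ≤ min 1 (R / dyLen (i : ℤ × ℤ)) := by
            refine le_min (by norm_num) ?_
            rw [le_div_iff₀ hl]; linarith
          linarith [Real.pi_lt_four]
    · have hfar : ∀ u ∈ Metric.thickening (100 * R) S, dyLen (i : ℤ × ℤ) ≤ |u - y| := by
        intro u hu
        obtain ⟨x, hx, hux⟩ := Metric.mem_thickening_iff.1 hu
        rw [Real.dist_eq] at hux
        have h3 := three_mul_dyLen_le (hS x hx) i.2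
        have h4 := abs_sub_dyCenter_le hy
        have h5 := abs_add_le (x - u) (u - y)
        have h6 := abs_add_le (x - y) (y - dyCenter i)
        rw [sub_add_sub_cancel] at h5 h6
        rw [abs_sub_comm x u] at h5
        linarith
      calc ∫⁻ u in Metric.thickening (100 * R) S, ENNReal.ofReal (pk r (u - y))
          ≤ ∫⁻ u in (fun u => u - y) ⁻¹' {v : ℝ | dyLen i ≤ |v|}, ENNReal.ofReal (pk r (u - y)) :=
            lintegral_mono_set hfar
        _ = ∫⁻ v in {v : ℝ | dyLen i ≤ |v|}, ENNReal.ofReal (pk r v) := by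
            exact (measurePreserving_sub_right volume y).setLIntegral_comp_preimage
              (measurableSet_le measurable_const (by fun_prop))
              (f := fun v => ENNReal.ofReal (pk r v)) (by fun_prop)
        _ ≤ ENNReal.ofReal (2 * r / dyLen i) := lintegral_pk_far hr hl
        _ ≤ _ := by
            refine ENNReal.ofReal_le_ofReal ?_
            rw [min_eq_right (by rw [div_le_one hl]; linarith), mul_div_assoc]
            have : r / dyLen (i : ℤ × ℤ) ≤ R / dyLen i := by gcongr
            have h0 : 0 ≤ R / dyLen (i : ℤ × ℤ) := by positivity
            linarith
  calc _ = ∑' k : ℕ, ∑' i : stopping F h,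
        ENNReal.ofReal (min 1 (dyLen i / ((2 : ℝ) ^ (m + s k))⁻¹)) *
          ∫⁻ y in dyadic i, (∫⁻ u in Metric.thickening (100 * ((2 : ℝ) ^ s k)⁻¹) S,
            ENNReal.ofReal (pk ((2 : ℝ) ^ (m + s k))⁻¹ (u - y))) * ‖bad F h f y‖ₑ := by
        refine tsum_congr fun k => ?_
        rw [setLIntegral_poi _ (measurable_badMass hf _), lintegral_mul_badMass hf]
        apply Measurable.lintegral_prod_right' (f := fun p : ℝ × ℝ =>
          ENNReal.ofReal (pk ((2 : ℝ) ^ (m + s k))⁻¹ (p.2 - p.1)))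
        fun_prop
    _ ≤ ∑' k : ℕ, ∑' i : stopping F h,
        ENNReal.ofReal (min 1 (dyLen i / ((2 : ℝ) ^ (m + s k))⁻¹)) *
          (ENNReal.ofReal (400 * min 1 (((2 : ℝ) ^ s k)⁻¹ / dyLen i)) *
            ∫⁻ y in dyadic i, ‖bad F h f y‖ₑ) := by
        gcongr with k i
        rw [← lintegral_const_mul' _ _ ENNReal.ofReal_ne_top]
        refine setLIntegral_mono' (measurableSet_dyadic i) fun y hy => ?_
        gcongr
        exact hpt k i y hy
    _ = ∑' i : stopping F h, (400 * ∑' k : ℕ,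
        ENNReal.ofReal (min 1 ((2 : ℝ) ^ (i : ℤ × ℤ).1 / ((2 : ℝ) ^ (m + s k))⁻¹) *
          min 1 (((2 : ℝ) ^ s k)⁻¹ / (2 : ℝ) ^ (i : ℤ × ℤ).1))) *
            ∫⁻ y in dyadic i, ‖bad F h f y‖ₑ := by
        rw [ENNReal.tsum_comm]
        refine tsum_congr fun i => ?_
        rw [← ENNReal.tsum_mul_left, ← ENNReal.tsum_mul_right]
        refine tsum_congr fun k => ?_
        rw [← mul_assoc]
        congr 1
        rw [ENNReal.ofReal_mul (by norm_num), ENNReal.ofReal_mul (by positivity),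
          ENNReal.ofReal_ofNat, dyLen]
        ring
    _ ≤ ∑' i : stopping F h, (400 * ENNReal.ofReal (4 * (m + 1))) *
            ∫⁻ y in dyadic i, ‖bad F h f y‖ₑ := by
        gcongr with i
        exact sum_min_le m _ hs
    _ = (400 * ENNReal.ofReal (4 * (m + 1))) * ∫⁻ y in stopSet F h, ‖bad F h f y‖ₑ := by
        rw [ENNReal.tsum_mul_left, setLIntegral_stopSet]
    _ ≤ _ := by
        have : (400 : ℝ≥0∞) * ENNReal.ofReal (4 * (m + 1)) = ENNReal.ofReal (1600 * (m + 1)) := by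
          rw [show (400 : ℝ≥0∞) = ENNReal.ofReal 400 by simp, ← ENNReal.ofReal_mul (by norm_num)]
          congr 1; ring
        rw [this]
        exact mul_le_mul_right (setLIntegral_le_lintegral _ _) _

end CurvedTHT

/-! ### A Carleson type estimate for the square function of a bounded function -/

namespace CurvedTHT

open scoped ENNReal

variable {φ : ℝ → ℝ}

/-- `C` is a constant for the almost orthogonality of frequency bands. -/
def IsOrthogonalityBound (φ : ℝ → ℝ) (C : ℝ) : Prop :=
  0 < C ∧ ∀ f : ℝ → ℂ, Integrable f → MemLp f 2 volume → ∀ n : ℕ → ℤ, Function.Injective n →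
    ∑' k, ∫⁻ x, ‖bandPart φ (n k) f x‖ₑ ^ 2 ≤ ENNReal.ofReal C * ∫⁻ x, ‖f x‖ₑ ^ 2

lemma exists_isOrthogonalityBound (hφ : IsFrequencyCutoff φ) :
    ∃ C, IsOrthogonalityBound φ C := by
  obtain ⟨C, h0, hC⟩ := exists_sum_lintegral_sq_bandPart_le hφ
  refine ⟨C, h0, fun f hf hf2 n hn => ?_⟩
  rw [ENNReal.tsum_eq_iSup_sum]
  refine iSup_le fun N => ?_
  have := hC f hf hf2 (N.map ⟨n, hn⟩)
  rwa [Finset.sum_map] at this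

lemma memLp_two_of_bounded {G : ℝ → ℂ} (hG : Measurable G) {μ : ℝ} {V : ℝ≥0∞}
    (hμ : ∀ᵐ y, ‖G y‖ₑ ≤ ENNReal.ofReal μ) (hV : ∫⁻ y, ‖G y‖ₑ ≤ V) (hVtop : V ≠ ⊤) :
    ∫⁻ y, ‖G y‖ₑ ^ 2 ≤ ENNReal.ofReal μ * V ∧ MemLp G 2 volume := by
  have h1 : ∫⁻ y, ‖G y‖ₑ ^ 2 ≤ ENNReal.ofReal μ * V := by
    calc ∫⁻ y, ‖G y‖ₑ ^ 2 ≤ ∫⁻ y, ENNReal.ofReal μ * ‖G y‖ₑ := by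
          refine lintegral_mono_ae (hμ.mono fun y hy => ?_)
          rw [sq]; gcongr
      _ = ENNReal.ofReal μ * ∫⁻ y, ‖G y‖ₑ := lintegral_const_mul' _ _ ENNReal.ofReal_ne_top
      _ ≤ _ := by gcongr
  refine ⟨h1, hG.aestronglyMeasurable, ?_⟩
  have h2 := eLpNorm_nnreal_pow_eq_lintegral (f := G) (μ := volume) (p := 2) (by norm_num)
  simp only [NNReal.coe_ofNat, ENNReal.rpow_two, ENNReal.coe_ofNat] at h2
  by_contra htop
  rw [not_lt, top_le_iff] at htop
  rw [htop] at h2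
  rw [← h2] at h1
  simp only [ne_eq, OfNat.ofNat_ne_zero, not_false_eq_true, ENNReal.top_pow, top_le_iff] at h1
  exact ENNReal.mul_ne_top ENNReal.ofReal_ne_top hVtop h1

/-- A dyadic layer decomposition: the first n with c 2^(-n-1) < w also satisfies w ≤ c 2^(-n), so
its term alone dominates w. -/
lemma le_tsum_levels {w : ℝ≥0∞} {c : ℝ} (hw : w ≤ ENNReal.ofReal c) :
    w ≤ ∑' n : ℕ, ENNReal.ofReal (c * (1 / 2) ^ n) *
      {w : ℝ≥0∞ | ENNReal.ofReal (c * (1 / 2) ^ (n + 1)) < w}.indicator 1 w := by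
  rcases eq_or_ne w 0 with rfl | hw0
  · exact zero_le
  have hex : ∃ n : ℕ, ENNReal.ofReal (c * (1 / 2) ^ (n + 1)) < w := by
    have h1 : Filter.Tendsto (fun n : ℕ => ENNReal.ofReal (c * (1 / 2) ^ (n + 1))) Filter.atTop
        (nhds 0) := by
      have h2 : Filter.Tendsto (fun n : ℕ => c * (1 / 2 : ℝ) ^ (n + 1)) Filter.atTop (nhds 0) := by
        have := ((tendsto_pow_atTop_nhds_zero_of_lt_one (r := (1 / 2 : ℝ)) (by norm_num)
          (by norm_num)).comp (Filter.tendsto_add_atTop_nat 1)).const_mul c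
        simpa using this
      simpa using ENNReal.tendsto_ofReal h2
    exact (h1.eventually (gt_mem_nhds (pos_iff_ne_zero.2 hw0))).exists
  classical
  set n := Nat.find hex with hn
  have hlow := Nat.find_spec hex
  have hup : w ≤ ENNReal.ofReal (c * (1 / 2) ^ n) := by
    rcases Nat.eq_zero_or_pos n with h0 | hpos
    · rw [h0]; simpa using hw
    · have := Nat.find_min hex (m := n - 1) (by lia)
      rw [not_lt, Nat.sub_add_cancel hpos] at this
      exact this
  refine le_trans ?_ (ENNReal.le_tsum n)
  rw [indicator_of_mem (by exact hlow)]
  simpa using hup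

lemma strictMono_add_le {s : ℕ → ℤ} (hs : StrictMono s) (k l : ℕ) : s k + l ≤ s (k + l) := by
  induction l with
  | zero => simp
  | succ l ih =>
    have := hs (show k + l < k + (l + 1) by lia)
    push_cast
    lia

/-- If the balls `B(u, 2^(-s k))`, `k ∈ T`, are contained in `E`, then the Poisson averages of
`Eᶜ` at the smaller scales `2^(-m-s k)` are summable. -/
lemma tsum_poi_compl_le {E : Set ℝ} (hE : MeasurableSet E) (m : ℕ) {s : ℕ → ℤ}
    (hs : StrictMono s) (u : ℝ) (T : Set ℕ)
    (hT : ∀ k ∈ T, Metric.ball u ((2 : ℝ) ^ s k)⁻¹ ⊆ E) :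
    ∑' k : ℕ, T.indicator (fun k => poi ((2 : ℝ) ^ (m + s k))⁻¹ (Eᶜ.indicator 1) u) k ≤ 4 := by
  rcases T.eq_empty_or_nonempty with rfl | hne
  · simp
  classical
  -- The smallest index in T has the largest ball, so the complement of E is at distance at least
  -- 2^(-s k₀) from u. At later indices the kernel is narrower by at least 2^(-(k - k₀)), and the
  -- tails form a geometric series.
  set k₀ := Nat.find hne
  have hk₀ : k₀ ∈ T := Nat.find_spec hne
  have hball := hT k₀ hk₀
  have hmin : ∀ k ∈ T, k₀ ≤ k := fun k hk => Nat.find_min' hne hk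
  have hterm : ∀ k ∈ T, poi ((2 : ℝ) ^ (m + s k))⁻¹ (Eᶜ.indicator 1) u ≤
      2 * (2⁻¹ : ℝ≥0∞) ^ (k - k₀) := by
    intro k hk
    obtain ⟨l, rfl⟩ := Nat.exists_eq_add_of_le (hmin k hk)
    set r : ℝ := ((2 : ℝ) ^ (m + s (k₀ + l)))⁻¹ with hr
    set d : ℝ := ((2 : ℝ) ^ s k₀)⁻¹ with hd
    have hr0 : 0 < r := by positivity
    have hd0 : 0 < d := by positivity
    calc poi r (Eᶜ.indicator 1) u = ∫⁻ y in Eᶜ, ENNReal.ofReal (pk r (u - y)) := by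
          rw [poi, ← lintegral_indicator hE.compl]
          refine lintegral_congr fun y => ?_
          by_cases hy : y ∈ Eᶜ
          · rw [indicator_of_mem hy, indicator_of_mem hy]; simp
          · rw [indicator_of_notMem hy, indicator_of_notMem hy]; simp
      _ ≤ ∫⁻ y in (fun y => u - y) ⁻¹' {v : ℝ | d ≤ |v|}, ENNReal.ofReal (pk r (u - y)) := by
          refine lintegral_mono_set fun y hy => ?_
          by_contra! hlt
          refine hy (hball ?_)
          rw [Metric.mem_ball, dist_comm, Real.dist_eq]
          simpa using hlt
      _ = ∫⁻ v in {v : ℝ | d ≤ |v|}, ENNReal.ofReal (pk r v) := by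
          exact (Measure.measurePreserving_sub_left volume u).setLIntegral_comp_preimage
            (measurableSet_le measurable_const (by fun_prop))
            (f := fun v => ENNReal.ofReal (pk r v)) (by fun_prop)
      _ ≤ ENNReal.ofReal (2 * r / d) := lintegral_pk_far hr0 hd0
      _ ≤ ENNReal.ofReal (2 * (1 / 2) ^ l) := by
          refine ENNReal.ofReal_le_ofReal ?_
          rw [mul_div_assoc]
          gcongr
          rw [hr, hd, div_inv_eq_mul, inv_mul_le_iff₀ (by positivity), one_div, inv_pow,
            ← div_eq_mul_inv, le_div_iff₀ (by positivity), ← zpow_natCast, ← zpow_add₀ two_ne_zero]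
          have := strictMono_add_le hs k₀ l
          exact zpow_le_zpow_right₀ one_le_two (by lia)
      _ = _ := by
          rw [ENNReal.ofReal_mul (by norm_num), ENNReal.ofReal_pow (by norm_num), one_div,
            ENNReal.ofReal_inv_of_pos (by norm_num), ENNReal.ofReal_ofNat,
            Nat.add_sub_cancel_left]
  calc _ ≤ ∑' k : ℕ, (Ici k₀).indicator (fun k => 2 * (2⁻¹ : ℝ≥0∞) ^ (k - k₀)) k := by
        refine ENNReal.tsum_le_tsum fun k => ?_
        by_cases hk : k ∈ T
        · rw [indicator_of_mem hk, indicator_of_mem (mem_Ici.2 (hmin k hk))]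
          exact hterm k hk
        · rw [indicator_of_notMem hk]; exact zero_le
    _ = ∑' l : ℕ, 2 * (2⁻¹ : ℝ≥0∞) ^ l := by
        rw [← tsum_subtype, ← (Equiv.ofBijective (fun l : ℕ => (⟨k₀ + l, Nat.le_add_right _ _⟩ :
          Ici k₀)) ⟨fun a b hab =>
            Nat.add_left_cancel (Subtype.ext_iff.1 hab), fun ⟨k, hk⟩ =>
            ⟨k - k₀, Subtype.ext (Nat.add_sub_of_le hk)⟩⟩).tsum_eq]
        refine tsum_congr fun l => ?_
        change (2 : ℝ≥0∞) * 2⁻¹ ^ (k₀ + l - k₀) = _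
        rw [Nat.add_sub_cancel_left]
    _ ≤ 4 := by
        rw [ENNReal.tsum_mul_left, ENNReal.tsum_geometric, ENNReal.one_sub_inv_two, inv_inv]
        norm_num

lemma sq_enorm_add_le (a b : ℂ) : ‖a + b‖ₑ ^ 2 ≤ 2 * ‖a‖ₑ ^ 2 + 2 * ‖b‖ₑ ^ 2 := by
  have h : ‖a + b‖ ^ 2 ≤ 2 * ‖a‖ ^ 2 + 2 * ‖b‖ ^ 2 := by
    nlinarith [norm_add_le a b, norm_nonneg (a + b), sq_nonneg (‖a‖ - ‖b‖)]
  have := ENNReal.ofReal_le_ofReal h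
  rw [ENNReal.ofReal_add (by positivity) (by positivity), ENNReal.ofReal_mul (by norm_num),
    ENNReal.ofReal_mul (by norm_num)] at this
  simpa [ENNReal.ofReal_pow] using this

/-- Square function estimate on the region where the balls of radius `2^(-s k)` lie in `E`. -/
lemma tsum_setLIntegral_sq_bandPart_le {K C : ℝ} (hK : IsKernelBound φ K)
    (hC : IsOrthogonalityBound φ C) (hφ : IsFrequencyCutoff φ) {G : ℝ → ℂ} (hG : Measurable G)
    {μ : ℝ} {V : ℝ≥0∞} (hμ : ∀ᵐ y, ‖G y‖ₑ ≤ ENNReal.ofReal μ) (hV : ∫⁻ y, ‖G y‖ₑ ≤ V)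
    (hVtop : V ≠ ⊤) {E : Set ℝ} (hE : MeasurableSet E) (m : ℕ) {s : ℕ → ℤ}
    (hs : StrictMono s) {U : ℕ → Set ℝ} (hU : ∀ k, MeasurableSet (U k))
    (hUE : ∀ k, ∀ u ∈ U k, Metric.ball u ((2 : ℝ) ^ s k)⁻¹ ⊆ E) :
    ∑' k, ∫⁻ u in U k, ‖bandPart φ (m + s k) G u‖ₑ ^ 2 ≤
      ENNReal.ofReal (2 * C + 8 * Real.pi * K ^ 2) * (ENNReal.ofReal μ ^ 2 * volume E) := by
  have hGi : Integrable G := integrable_of_lintegral_ne_top hG (ne_top_of_le_ne_top hVtop hV)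
  -- The part inside E is handled by orthogonality, its squared norm being at most μ²|E|. The part
  -- outside E is seen from U k only through the tail of the kernel, and at each point these tails
  -- are summable in k.
  set G₁ : ℝ → ℂ := E.indicator G with hG₁
  set G₂ : ℝ → ℂ := Eᶜ.indicator G with hG₂
  have hm1 : Measurable G₁ := hG.indicator hE
  have hi1 : Integrable G₁ := hGi.indicator hE
  have hi2 : Integrable G₂ := hGi.indicator hE.compl
  have hsum : ∀ y, G₁ y + G₂ y = G y := fun y => indicator_self_add_compl_apply E G y
  have hle1 : ∀ y, ‖G₁ y‖ₑ ≤ ‖G y‖ₑ := fun y => by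
    by_cases hy : y ∈ E <;> simp [G₁, hy]
  have hsplit : ∀ k u, ‖bandPart φ (m + s k) G u‖ₑ ^ 2 ≤
      2 * ‖bandPart φ (m + s k) G₁ u‖ₑ ^ 2 + 2 * ‖bandPart φ (m + s k) G₂ u‖ₑ ^ 2 := by
    intro k u
    have := bandPart_add hφ (m + s k) hi1 hi2 u
    simp only [hsum] at this
    rw [this]
    exact sq_enorm_add_le _ _
  have hinj : Function.Injective fun k => (m : ℤ) + s k :=
    fun a b hab => hs.injective (by simpa using hab)
  have hfirst : ∑' k, ∫⁻ u, ‖bandPart φ (m + s k) G₁ u‖ₑ ^ 2 ≤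
      ENNReal.ofReal C * (ENNReal.ofReal μ ^ 2 * volume E) := by
    have hmem := (memLp_two_of_bounded hm1 (hμ.mono fun y hy => (hle1 y).trans hy)
      ((lintegral_mono hle1).trans hV) hVtop).2
    refine (hC.2 G₁ hi1 hmem _ hinj).trans ?_
    gcongr
    calc ∫⁻ y, ‖G₁ y‖ₑ ^ 2 ≤ ∫⁻ y, E.indicator (fun _ => ENNReal.ofReal μ ^ 2) y := by
          refine lintegral_mono_ae (hμ.mono fun y hy => ?_)
          by_cases hyE : y ∈ E
          · simp only [G₁, indicator_of_mem hyE]; gcongr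
          · simp [G₁, hyE]
      _ = _ := by rw [lintegral_indicator hE, setLIntegral_const]
  have hpt : ∀ k u, ‖bandPart φ (m + s k) G₂ u‖ₑ ^ 2 ≤
      ENNReal.ofReal (K ^ 2 * Real.pi) * ENNReal.ofReal μ ^ 2 *
        poi ((2 : ℝ) ^ (m + s k))⁻¹ (Eᶜ.indicator 1) u := by
    intro k u
    have hr : (0 : ℝ) < ((2 : ℝ) ^ (m + s k))⁻¹ := by positivity
    have h1 := hK.enorm_bandPart_le (m + s k) G₂ u
    have h2 : poi ((2 : ℝ) ^ (m + s k))⁻¹ (fun y => ‖G₂ y‖ₑ) u ≤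
        ENNReal.ofReal μ * poi ((2 : ℝ) ^ (m + s k))⁻¹ (Eᶜ.indicator 1) u := by
      unfold poi
      rw [← lintegral_const_mul' _ _ ENNReal.ofReal_ne_top]
      refine lintegral_mono_ae (hμ.mono fun y hy => ?_)
      rw [mul_left_comm]
      gcongr
      by_cases hyE : y ∈ E
      · simp [G₂, hyE]
      · have : y ∈ Eᶜ := hyE
        simp only [G₂, indicator_of_mem this, Pi.one_apply, mul_one]
        exact hy
    -- Of the two Poisson factors in the square one is discarded by this bound, so that the other
    -- can be summed linearly in k.
    have h3 : poi ((2 : ℝ) ^ (m + s k))⁻¹ (Eᶜ.indicator 1) u ≤ ENNReal.ofReal Real.pi := by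
      rw [← poi_one hr u]
      exact poi_mono _ (Filter.Eventually.of_forall fun y => indicator_le_self' (by simp) y) _
    calc _ ≤ (ENNReal.ofReal K * (ENNReal.ofReal μ *
            poi ((2 : ℝ) ^ (m + s k))⁻¹ (Eᶜ.indicator 1) u)) ^ 2 :=
          pow_le_pow_left' (h1.trans (by gcongr)) 2
      _ = ENNReal.ofReal K ^ 2 * ENNReal.ofReal μ ^ 2 *
          (poi ((2 : ℝ) ^ (m + s k))⁻¹ (Eᶜ.indicator 1) u *
            poi ((2 : ℝ) ^ (m + s k))⁻¹ (Eᶜ.indicator 1) u) := by ring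
      _ ≤ ENNReal.ofReal K ^ 2 * ENNReal.ofReal μ ^ 2 * (ENNReal.ofReal Real.pi *
            poi ((2 : ℝ) ^ (m + s k))⁻¹ (Eᶜ.indicator 1) u) := by gcongr
      _ = _ := by
          rw [ENNReal.ofReal_mul (by positivity), ENNReal.ofReal_pow hK.pos.le]; ring
  have hsecond : ∑' k, ∫⁻ u in U k, ‖bandPart φ (m + s k) G₂ u‖ₑ ^ 2 ≤
      ENNReal.ofReal (K ^ 2 * Real.pi) * ENNReal.ofReal μ ^ 2 * (4 * volume E) := by
    set c := ENNReal.ofReal (K ^ 2 * Real.pi) * ENNReal.ofReal μ ^ 2 with hc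
    have hctop : c ≠ ⊤ := ENNReal.mul_ne_top ENNReal.ofReal_ne_top (by simp)
    have hmp : ∀ k : ℕ, Measurable (poi ((2 : ℝ) ^ (m + s k))⁻¹ (Eᶜ.indicator 1)) := fun k =>
      measurable_poi _ (measurable_one.indicator hE.compl)
    calc ∑' k, ∫⁻ u in U k, ‖bandPart φ (m + s k) G₂ u‖ₑ ^ 2
        ≤ ∑' k, c * ∫⁻ u, (U k).indicator
            (poi ((2 : ℝ) ^ (m + s k))⁻¹ (Eᶜ.indicator 1)) u := by
          refine ENNReal.tsum_le_tsum fun k => ?_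
          rw [lintegral_indicator (hU k), ← lintegral_const_mul' _ _ hctop]
          exact lintegral_mono fun u => hpt k u
      _ = c * ∫⁻ u, ∑' k, (U k).indicator
            (poi ((2 : ℝ) ^ (m + s k))⁻¹ (Eᶜ.indicator 1)) u := by
          rw [ENNReal.tsum_mul_left, lintegral_tsum fun k => ((hmp k).indicator (hU k)).aemeasurable]
      _ ≤ c * ∫⁻ u, E.indicator (fun _ => 4) u := by
          gcongr with u
          have hset : ∀ k, (U k).indicator (poi ((2 : ℝ) ^ (m + s k))⁻¹ (Eᶜ.indicator 1)) u =
              {k | u ∈ U k}.indicator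
                (fun k => poi ((2 : ℝ) ^ (m + s k))⁻¹ (Eᶜ.indicator 1) u) k := by
            intro k
            by_cases hk : u ∈ U k
            · rw [indicator_of_mem hk, indicator_of_mem (by exact hk)]
            · rw [indicator_of_notMem hk, indicator_of_notMem (by exact hk)]
          simp_rw [hset]
          by_cases huE : u ∈ E
          · rw [indicator_of_mem huE]
            exact tsum_poi_compl_le hE m hs u _ fun k hk => hUE k u hk
          · have : {k | u ∈ U k} = ∅ := by
              rw [Set.eq_empty_iff_forall_notMem]
              intro k hk
              exact huE (hUE k u hk (Metric.mem_ball_self (by positivity)))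
            simp [this]
      _ = _ := by rw [lintegral_indicator hE, setLIntegral_const]
  have hcont : ∀ k, Measurable fun u => 2 * ‖bandPart φ (m + s k) G₁ u‖ₑ ^ 2 := fun k => by
    have := continuous_bandPart hφ (m + s k) hi1
    fun_prop
  calc ∑' k, ∫⁻ u in U k, ‖bandPart φ (m + s k) G u‖ₑ ^ 2
      ≤ ∑' k, (2 * (∫⁻ u, ‖bandPart φ (m + s k) G₁ u‖ₑ ^ 2) +
          2 * ∫⁻ u in U k, ‖bandPart φ (m + s k) G₂ u‖ₑ ^ 2) := by
        refine ENNReal.tsum_le_tsum fun k => ?_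
        refine (lintegral_mono fun u => hsplit k u).trans ?_
        rw [lintegral_add_left (hcont k), lintegral_const_mul' _ _ (by norm_num),
          lintegral_const_mul' _ _ (by norm_num)]
        exact add_le_add_left (mul_le_mul_right (setLIntegral_le_lintegral _ _) _) _
    _ = 2 * (∑' k, ∫⁻ u, ‖bandPart φ (m + s k) G₁ u‖ₑ ^ 2) +
          2 * ∑' k, ∫⁻ u in U k, ‖bandPart φ (m + s k) G₂ u‖ₑ ^ 2 := by
        rw [ENNReal.tsum_add, ENNReal.tsum_mul_left, ENNReal.tsum_mul_left]
    _ ≤ 2 * (ENNReal.ofReal C * (ENNReal.ofReal μ ^ 2 * volume E)) +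
          2 * (ENNReal.ofReal (K ^ 2 * Real.pi) * ENNReal.ofReal μ ^ 2 * (4 * volume E)) := by
        gcongr
    _ = _ := by
        have h2 : ENNReal.ofReal (2 * C + 8 * Real.pi * K ^ 2) =
            2 * ENNReal.ofReal C + 8 * ENNReal.ofReal (K ^ 2 * Real.pi) := by
          have := hC.1
          rw [ENNReal.ofReal_add (by positivity) (by positivity),
            show 8 * Real.pi * K ^ 2 = 8 * (K ^ 2 * Real.pi) by ring,
            ENNReal.ofReal_mul (by norm_num), ENNReal.ofReal_mul (p := 8) (by norm_num),
            ENNReal.ofReal_ofNat, ENNReal.ofReal_ofNat]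
        rw [h2]; ring

/-- A bounded function satisfies a Carleson type square function estimate with respect to the
Poisson averages of `F`. -/
lemma exists_tsum_sq_bandPart_mul_poi_le (hφ : IsFrequencyCutoff φ) :
    ∃ A : ℝ, 0 < A ∧ ∀ (G : ℝ → ℂ) (μ : ℝ) (V : ℝ≥0∞) (F : Set ℝ) (m : ℕ) (s : ℕ → ℤ),
      Measurable G → (∀ᵐ y, ‖G y‖ₑ ≤ ENNReal.ofReal μ) → ∫⁻ y, ‖G y‖ₑ ≤ V → V ≠ ⊤ →
      MeasurableSet F → volume F ≠ ⊤ → StrictMono s →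
      ∑' k, ∫⁻ u, ‖bandPart φ (m + s k) G u‖ₑ ^ 2 * poi ((2 : ℝ) ^ s k)⁻¹ (F.indicator 1) u ≤
        ENNReal.ofReal A * ∑' n : ℕ, min (ENNReal.ofReal μ ^ 2 * volume F)
          (ENNReal.ofReal ((1 / 2) ^ n) * (ENNReal.ofReal μ * V)) := by
  obtain ⟨K, hK⟩ := exists_isKernelBound hφ
  obtain ⟨C, hC⟩ := exists_isOrthogonalityBound hφ
  have hC0 := hC.1
  have hK0 := hK.pos
  set B := 2 * C + 8 * Real.pi * K ^ 2 with hB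
  have hB0 : 0 < B := by positivity
  refine ⟨3072 * Real.pi * B, by positivity, ?_⟩
  intro G μ V F m s hG hμ hV hVtop hFm hF hs
  set w : ℕ → ℝ → ℝ≥0∞ := fun k => poi ((2 : ℝ) ^ s k)⁻¹ (F.indicator 1) with hw
  have hwm : ∀ k, Measurable (w k) := fun k => measurable_poi _ (measurable_one.indicator hFm)
  have hGi : Integrable G := integrable_of_lintegral_ne_top hG (ne_top_of_le_ne_top hVtop hV)
  have hwπ : ∀ k u, w k u ≤ ENNReal.ofReal Real.pi := fun k u => by
    rw [← poi_one (r := ((2 : ℝ) ^ s k)⁻¹) (by positivity) u]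
    exact poi_mono _ (Filter.Eventually.of_forall fun y => indicator_le_self' (by simp) y) _
  set U : ℕ → ℕ → Set ℝ := fun n k =>
    w k ⁻¹' {w : ℝ≥0∞ | ENNReal.ofReal (Real.pi * (1 / 2) ^ (n + 1)) < w} with hUdef
  have hU : ∀ n k, MeasurableSet (U n k) := fun n k => hwm k measurableSet_Ioi
  have hbm : ∀ k, Measurable fun u => ‖bandPart φ (m + s k) G u‖ₑ ^ 2 := fun k => by
    have := continuous_bandPart hφ (m + s k) hGi
    fun_prop
  -- Two bounds compete on the region where the weight is about 2^(-n). Localization to a set of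
  -- measure at most a multiple of 2^n |F| compensates the weight and gives μ²|F|; global
  -- orthogonality gives 2^(-n) times the squared L² norm, at most 2^(-n) μ V. The second makes the
  -- sum over n converge.
  have hlevel : ∀ n : ℕ, ENNReal.ofReal (Real.pi * (1 / 2) ^ n) *
      ∑' k, ∫⁻ u in U n k, ‖bandPart φ (m + s k) G u‖ₑ ^ 2 ≤
      ENNReal.ofReal (3072 * Real.pi * B) * min (ENNReal.ofReal μ ^ 2 * volume F)
          (ENNReal.ofReal ((1 / 2) ^ n) * (ENNReal.ofReal μ * V)) := by
    intro n
    rw [mul_min]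
    refine le_min ?_ ?_
    -- A point outside the exceptional set has averages at most 32πh, and moving by one window
    -- length costs a factor 8. Then 8 · 32πh = π 2^(-n-1) is exactly the lower threshold of the
    -- level.
    · set h : ℝ := (1 / 2) ^ n / 512 with hh
      have hh0 : 0 < h := by positivity
      have hUE : ∀ k, ∀ u ∈ U n k, Metric.ball u ((2 : ℝ) ^ s k)⁻¹ ⊆ exceptional F h := by
        intro k u hu y hy
        by_contra hyE
        have hR : (0 : ℝ) < ((2 : ℝ) ^ s k)⁻¹ := by positivity
        have h1 := poi_indicator_le hh0 hF hFm hyE hR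
        rw [Metric.mem_ball, dist_comm, Real.dist_eq] at hy
        have h2 := poi_le_poi_of_abs_sub_le hR zero_le_one (F.indicator 1) (x := u) (x' := y)
          (by rw [one_mul]; exact hy.le)
        refine absurd hu.out (not_lt.2 (h2.trans ?_))
        calc _ ≤ ENNReal.ofReal (2 * (1 + 1) ^ 2) * ENNReal.ofReal (32 * Real.pi * min 1 h) := by
              gcongr
          _ ≤ _ := by
              rw [← ENNReal.ofReal_mul (by norm_num)]
              refine ENNReal.ofReal_le_ofReal ?_
              have : min 1 h ≤ h := min_le_right _ _
              calc _ ≤ 2 * (1 + 1) ^ 2 * (32 * Real.pi * h) := by gcongr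
                _ = _ := by rw [hh, pow_succ]; ring
      have hest := tsum_setLIntegral_sq_bandPart_le hK hC hφ hG hμ hV hVtop
        (isOpen_exceptional F h).measurableSet m hs (hU n) hUE
      calc _ ≤ ENNReal.ofReal (Real.pi * (1 / 2) ^ n) * (ENNReal.ofReal B *
            (ENNReal.ofReal μ ^ 2 * volume (exceptional F h))) := by gcongr
        _ = ENNReal.ofReal (512 * Real.pi * B) * (ENNReal.ofReal μ ^ 2 *
            (ENNReal.ofReal h * volume (exceptional F h))) := by
            rw [show Real.pi * (1 / 2) ^ n = Real.pi * 512 * h by rw [hh]; ring,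
              ENNReal.ofReal_mul (p := Real.pi * 512) (by positivity),
              show 512 * Real.pi * B = Real.pi * 512 * B by ring,
              ENNReal.ofReal_mul (p := Real.pi * 512) (by positivity)]
            ring
        _ ≤ ENNReal.ofReal (512 * Real.pi * B) * (ENNReal.ofReal μ ^ 2 * (6 * volume F)) := by
            exact mul_le_mul_right (mul_le_mul_right (volume_exceptional_le hh0 hFm) _) _
        _ = _ := by
            rw [show 3072 * Real.pi * B = 6 * (512 * Real.pi * B) by ring,
              ENNReal.ofReal_mul (p := 6) (by norm_num), ENNReal.ofReal_ofNat]
            ring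
    · have hmem := memLp_two_of_bounded hG hμ hV hVtop
      have hinj : Function.Injective fun k => (m : ℤ) + s k :=
        fun a b hab => hs.injective (by simpa using hab)
      calc _ ≤ ENNReal.ofReal (Real.pi * (1 / 2) ^ n) *
            ∑' k, ∫⁻ u, ‖bandPart φ (m + s k) G u‖ₑ ^ 2 :=
            mul_le_mul_right (ENNReal.tsum_le_tsum fun k => setLIntegral_le_lintegral _ _) _
        _ ≤ ENNReal.ofReal (Real.pi * (1 / 2) ^ n) * (ENNReal.ofReal C *
            (ENNReal.ofReal μ * V)) := by
            gcongr
            exact (hC.2 G hGi hmem.2 _ hinj).trans (by gcongr; exact hmem.1)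
        _ = ENNReal.ofReal (Real.pi * C) * (ENNReal.ofReal ((1 / 2) ^ n) *
            (ENNReal.ofReal μ * V)) := by
            rw [ENNReal.ofReal_mul (by positivity), ENNReal.ofReal_mul (p := Real.pi)
              (by positivity)]
            ring
        _ ≤ _ := by
            gcongr ?_ * _
            refine ENNReal.ofReal_le_ofReal ?_
            have h1 : C ≤ 3072 * B := by
              have : 0 < 8 * Real.pi * K ^ 2 := by positivity
              linarith
            calc Real.pi * C ≤ Real.pi * (3072 * B) := by gcongr
              _ = _ := by ring
  calc ∑' k, ∫⁻ u, ‖bandPart φ (m + s k) G u‖ₑ ^ 2 * w k u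
      ≤ ∑' k, ∫⁻ u, ∑' n, ENNReal.ofReal (Real.pi * (1 / 2) ^ n) *
          (U n k).indicator (fun u => ‖bandPart φ (m + s k) G u‖ₑ ^ 2) u := by
        refine ENNReal.tsum_le_tsum fun k => lintegral_mono fun u => ?_
        calc _ ≤ ‖bandPart φ (m + s k) G u‖ₑ ^ 2 * ∑' n : ℕ,
              ENNReal.ofReal (Real.pi * (1 / 2) ^ n) *
              {w : ℝ≥0∞ | ENNReal.ofReal (Real.pi * (1 / 2) ^ (n + 1)) < w}.indicator 1 (w k u) := by
              gcongr
              exact le_tsum_levels (hwπ k u)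
          _ = _ := by
              rw [← ENNReal.tsum_mul_left]
              refine tsum_congr fun n => ?_
              by_cases hu : u ∈ U n k
              · rw [indicator_of_mem hu, indicator_of_mem (by exact hu), Pi.one_apply, mul_one,
                  mul_comm]
              · rw [indicator_of_notMem hu, indicator_of_notMem (by exact hu), mul_zero, mul_zero]
    _ = ∑' k, ∑' n, ENNReal.ofReal (Real.pi * (1 / 2) ^ n) *
          ∫⁻ u in U n k, ‖bandPart φ (m + s k) G u‖ₑ ^ 2 := by
        refine tsum_congr fun k => ?_
        rw [lintegral_tsum fun n => (((hbm k).indicator (hU n k)).const_mul _).aemeasurable]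
        refine tsum_congr fun n => ?_
        rw [lintegral_const_mul' _ _ ENNReal.ofReal_ne_top, lintegral_indicator (hU n k)]
    _ = ∑' n : ℕ, ENNReal.ofReal (Real.pi * (1 / 2) ^ n) *
          ∑' k, ∫⁻ u in U n k, ‖bandPart φ (m + s k) G u‖ₑ ^ 2 := by
        rw [ENNReal.tsum_comm]
        simp_rw [ENNReal.tsum_mul_left]
    _ ≤ _ := by
        rw [← ENNReal.tsum_mul_left]
        exact ENNReal.tsum_le_tsum hlevel

lemma min_le_rpow_mul_rpow (a b : ℝ≥0∞) {θ : ℝ} (h0 : 0 ≤ θ) (h1 : θ ≤ 1) :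
    min a b ≤ a ^ (1 - θ) * b ^ θ := by
  calc min a b = min a b ^ (1 - θ) * min a b ^ θ := by
        rw [← ENNReal.rpow_add_of_nonneg _ _ (by linarith) h0]; simp
    _ ≤ _ := by
        refine mul_le_mul' ?_ ?_
        · exact ENNReal.rpow_le_rpow (min_le_left _ _) (by linarith)
        · exact ENNReal.rpow_le_rpow (min_le_right _ _) h0

/-- Logarithmic loss of the square function estimate, written as an arbitrarily small power. -/
lemma tsum_min_le {θ : ℝ} (h0 : 0 < θ) (h1 : θ < 1) :
    ∃ A : ℝ, 0 < A ∧ ∀ a b : ℝ≥0∞, ∑' n : ℕ, min a (ENNReal.ofReal ((1 / 2) ^ n) * b) ≤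
      ENNReal.ofReal A * (a ^ (1 - θ) * b ^ θ) := by
  set x : ℝ := (1 / 2) ^ θ with hx
  have hx0 : 0 < x := by positivity
  have hx1 : x < 1 := Real.rpow_lt_one (by norm_num) (by norm_num) h0
  refine ⟨(1 - x)⁻¹, inv_pos.2 (by linarith), fun a b => ?_⟩
  have hxe : (ENNReal.ofReal (1 / 2)) ^ θ = ENNReal.ofReal x := by
    rw [ENNReal.ofReal_rpow_of_pos (by norm_num)]
  calc ∑' n : ℕ, min a (ENNReal.ofReal ((1 / 2) ^ n) * b)
      ≤ ∑' n : ℕ, ENNReal.ofReal x ^ n * (a ^ (1 - θ) * b ^ θ) := by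
        refine ENNReal.tsum_le_tsum fun n => ?_
        refine (min_le_rpow_mul_rpow _ _ h0.le h1.le).trans (le_of_eq ?_)
        rw [ENNReal.mul_rpow_of_nonneg _ _ h0.le, ENNReal.ofReal_pow (by norm_num), ← hxe,
          ← ENNReal.rpow_natCast, ← ENNReal.rpow_natCast, ← ENNReal.rpow_mul, ← ENNReal.rpow_mul,
          mul_comm (n : ℝ) θ]
        ring
    _ = _ := by
        rw [ENNReal.tsum_mul_right, ENNReal.tsum_geometric, ← ENNReal.ofReal_one,
          ← ENNReal.ofReal_sub _ hx0.le, ENNReal.ofReal_inv_of_pos (by linarith)]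

end CurvedTHT

/-! ### Removing a factor by its averages; weights standing for the fourth function -/

namespace CurvedTHT

open scoped ENNReal

lemma poi_comp_add (R : ℝ) (h : ℝ → ℝ≥0∞) (τ x : ℝ) :
    poi R (fun y => h (y + τ)) x = poi R h (x + τ) := by
  unfold poi
  rw [← lintegral_add_right_eq_self (fun y => ENNReal.ofReal (pk R (x + τ - y)) * h y) τ]
  refine lintegral_congr fun y => ?_
  rw [add_sub_add_right_eq_sub]

/-- The constant in `setLIntegral_mul_poi_le`. -/
noncomputable def avgConst : ℝ := 2 * (poiConst * (2 * (1 + 66) ^ 2))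

lemma avgConst_pos : 0 < avgConst := by
  have := poiConst_pos
  unfold avgConst; positivity

/-- As g is essentially constant at scale R, only the mean of the translated factor over an R-ball
matters. By `poi_poi_le` this is a Poisson average of γ at scale R, at a point within 66R of S₀: 64R
for the translation and R for each of two neighbourhoods. -/
lemma setLIntegral_mul_poi_le {S S₀ : Set ℝ} (hS : MeasurableSet S) {g γ : ℝ → ℝ≥0∞}
    (hg : Measurable g) (hγ : Measurable γ) {r R τ : ℝ} (hr : 0 < r) (hrR : r ≤ R)
    (hτ : |τ| ≤ 64 * R) (hSS : S ⊆ Metric.thickening R S₀) {D N : ℝ≥0∞}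
    (hgD : ∀ x x', |x - x'| < R → g x ≤ D * g x') (hN : ∀ x ∈ S₀, poi R γ x ≤ N) :
    ∫⁻ x in S, g x * poi r γ (x + τ) ≤
      D * (ENNReal.ofReal avgConst * N) * ∫⁻ x in Metric.thickening R S, g x := by
  have hR : 0 < R := hr.trans_le hrR
  have hm := measurable_poi r hγ
  refine setLIntegral_mul_le_of_average_le hS hg (by fun_prop) hR hgD fun x hx => ?_
  obtain ⟨z, hz, hxz⟩ := Metric.mem_thickening_iff.1 hx
  obtain ⟨w, hw, hzw⟩ := Metric.mem_thickening_iff.1 (hSS hz)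
  rw [Real.dist_eq] at hxz hzw
  have hdist : |x + τ - w| ≤ 66 * R := by
    have h1 := abs_add_le (x - z) (z - w)
    rw [sub_add_sub_cancel] at h1
    have h2 := abs_add_le (x - w) τ
    rw [show x - w + τ = x + τ - w by ring] at h2
    linarith
  calc ∫⁻ y in Metric.ball x R, poi r γ (y + τ)
      ≤ ENNReal.ofReal (2 * R) * poi R (fun y => poi r γ (y + τ)) x :=
        setLIntegral_ball_le_poi hR _ x
    _ = ENNReal.ofReal (2 * R) * poi R (poi r γ) (x + τ) := by rw [poi_comp_add]
    _ ≤ ENNReal.ofReal (2 * R) * (ENNReal.ofReal poiConst *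
          (ENNReal.ofReal (2 * (1 + 66) ^ 2) * N)) := by
        gcongr
        refine (poi_poi_le hr hrR hγ _).trans ?_
        gcongr
        refine (poi_le_poi_of_abs_sub_le hR (by norm_num) γ hdist).trans ?_
        gcongr
        exact hN w hw
    _ = ENNReal.ofReal avgConst * N * ENNReal.ofReal R := by
        have := poiConst_pos
        rw [avgConst, ENNReal.ofReal_mul (p := 2) (q := R) (by norm_num),
          ENNReal.ofReal_mul (p := 2) (q := poiConst * _) (by norm_num),
          ENNReal.ofReal_mul this.le]
        ring

/-- The properties of the fourth function that are used: it is concentrated near `S` at scale `r`,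
and its averages are bounded by those of `F`. -/
structure IsTestWeight (Ψ : ℝ → ℝ≥0∞) (S F : Set ℝ) (r D : ℝ) : Prop where
  meas : Measurable Ψ
  nonneg : 0 ≤ D
  lintegral_mul_le : ∀ H : ℝ → ℝ≥0∞, Measurable H →
    (∀ x s, H (x + s) ≤ ENNReal.ofReal (8 * (1 + |s| / r) ^ 6) * H x) →
    ∫⁻ x, H x * Ψ x ≤ ENNReal.ofReal D * ∫⁻ x in S, H x
  poi_le : ∀ R, r ≤ R → ∀ x, poi R Ψ x ≤ ENNReal.ofReal D * poi R (F.indicator 1) x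

lemma isTestWeight_indicator {S F : Set ℝ} (hS : MeasurableSet S) (hSF : S ⊆ F) (r : ℝ) :
    IsTestWeight (S.indicator 1) S F r 1 where
  meas := measurable_one.indicator hS
  nonneg := zero_le_one
  lintegral_mul_le H _ _ := by
    rw [ENNReal.ofReal_one, one_mul, ← lintegral_indicator hS]
    refine (lintegral_congr fun x => ?_).le
    by_cases hx : x ∈ S <;> simp [hx]
  poi_le R _ x := by
    rw [ENNReal.ofReal_one, one_mul]
    exact poi_mono R (Filter.Eventually.of_forall fun y =>
      indicator_le_indicator_of_subset hSF (fun _ => zero_le) y) x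

lemma lintegral_decayKernel_mul_le {r : ℝ} (hr : 0 < r) :
    ∫⁻ s, ENNReal.ofReal (decayKernel r s) * ENNReal.ofReal (8 * (1 + |s| / r) ^ 6) ≤
      ENNReal.ofReal (8 * Real.pi) := by
  calc _ ≤ ∫⁻ s, ENNReal.ofReal 8 * ENNReal.ofReal (pk r s) := by
        refine lintegral_mono fun s => ?_
        rw [← ENNReal.ofReal_mul (decayKernel_nonneg hr s), ← ENNReal.ofReal_mul (by norm_num)]
        refine ENNReal.ofReal_le_ofReal ?_
        rw [pk_eq hr, decayKernel]
        set a := |s| / r with ha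
        have ha0 : 0 ≤ a := by positivity
        have h1 : 1 + a ^ 2 ≤ (1 + a) ^ 4 := by
          nlinarith [mul_nonneg ha0 ha0, mul_nonneg (mul_nonneg ha0 ha0) ha0,
            mul_nonneg (mul_nonneg ha0 ha0) (mul_nonneg ha0 ha0)]
        calc r⁻¹ / (1 + a) ^ 10 * (8 * (1 + a) ^ 6) = 8 * (r⁻¹ / (1 + a) ^ 4) := by
              field_simp
          _ ≤ _ := by gcongr
    _ = _ := by
        rw [lintegral_const_mul' _ _ ENNReal.ofReal_ne_top, lintegral_pk hr,
          ← ENNReal.ofReal_mul (by norm_num)]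

/-- This weight dominates the localized fourth function. The tenth power decay beats the sixth power
growth of the product of three Poisson averages and leaves an integrable kernel, so the integral
returns to S itself, where the averages of the other functions are under control. Quadratic decay
would not suffice. -/
lemma isTestWeight_decay {S F : Set ℝ} (hS : MeasurableSet S) (hF : MeasurableSet F) (hSF : S ⊆ F)
    {r K : ℝ} (hr : 0 < r) (hK : 0 ≤ K) :
    IsTestWeight (fun x => ENNReal.ofReal K *
      ∫⁻ y, ENNReal.ofReal (decayKernel r (x - y)) * S.indicator 1 y) S F r
      (K * (8 * Real.pi + poiConst)) := by
  have hSm : Measurable (S.indicator (1 : ℝ → ℝ≥0∞)) := measurable_one.indicator hS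
  have hm : Measurable fun x => ∫⁻ y, ENNReal.ofReal (decayKernel r (x - y)) * S.indicator 1 y := by
    apply Measurable.lintegral_prod_right' (f := fun p : ℝ × ℝ =>
      ENNReal.ofReal (decayKernel r (p.1 - p.2)) * S.indicator 1 p.2)
    fun_prop
  have hp := poiConst_pos
  refine ⟨hm.const_mul _, by positivity, fun H hH hHs => ?_, fun R hR x => ?_⟩
  · calc ∫⁻ x, H x * (ENNReal.ofReal K *
          ∫⁻ y, ENNReal.ofReal (decayKernel r (x - y)) * S.indicator 1 y)
        = ENNReal.ofReal K * ∫⁻ x, ∫⁻ y,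
            H x * (ENNReal.ofReal (decayKernel r (x - y)) * S.indicator 1 y) := by
          rw [← lintegral_const_mul' _ _ ENNReal.ofReal_ne_top]
          refine lintegral_congr fun x => ?_
          rw [lintegral_const_mul _ (by fun_prop)]
          ring
      _ = ENNReal.ofReal K * ∫⁻ y, ∫⁻ x,
            H x * (ENNReal.ofReal (decayKernel r (x - y)) * S.indicator 1 y) := by
          rw [lintegral_lintegral_swap
            (Measurable.aemeasurable (by unfold Function.uncurry; fun_prop))]
      _ ≤ ENNReal.ofReal K * ∫⁻ y, ENNReal.ofReal (8 * Real.pi) * S.indicator H y := by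
          gcongr with y
          by_cases hy : y ∈ S
          · simp only [indicator_of_mem hy, Pi.one_apply, mul_one]
            calc ∫⁻ x, H x * ENNReal.ofReal (decayKernel r (x - y))
                ≤ ∫⁻ x, (ENNReal.ofReal (decayKernel r (x - y)) *
                    ENNReal.ofReal (8 * (1 + |x - y| / r) ^ 6)) * H y := by
                  refine lintegral_mono fun x => ?_
                  have := hHs y (x - y)
                  rw [add_sub_cancel] at this
                  rw [mul_comm, mul_assoc]
                  gcongr
              _ = (∫⁻ x, ENNReal.ofReal (decayKernel r (x - y)) *
                    ENNReal.ofReal (8 * (1 + |x - y| / r) ^ 6)) * H y :=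
                  lintegral_mul_const _ (by fun_prop)
              _ ≤ _ := by
                  gcongr
                  rw [lintegral_sub_right_eq_self (fun s => ENNReal.ofReal (decayKernel r s) *
                    ENNReal.ofReal (8 * (1 + |s| / r) ^ 6)) y]
                  exact lintegral_decayKernel_mul_le hr
          · simp [hy]
      _ = ENNReal.ofReal (K * (8 * Real.pi)) * ∫⁻ x in S, H x := by
          rw [lintegral_const_mul' _ _ ENNReal.ofReal_ne_top, lintegral_indicator hS,
            ← mul_assoc, ← ENNReal.ofReal_mul hK]
      _ ≤ _ := by gcongr; linarith
  · have hR0 : 0 < R := hr.trans_le hR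
    calc _ ≤ poi R (fun x => ENNReal.ofReal K * poi r (F.indicator 1) x) x := by
          refine poi_mono R (Filter.Eventually.of_forall fun y => ?_) x
          unfold poi
          gcongr with z
          exact decayKernel_le_pk hr _
      _ = ENNReal.ofReal K * poi R (poi r (F.indicator 1)) x := by
          unfold poi
          rw [← lintegral_const_mul' _ _ ENNReal.ofReal_ne_top]
          refine lintegral_congr fun y => ?_
          rw [mul_left_comm]
      _ ≤ ENNReal.ofReal K * (ENNReal.ofReal poiConst * poi R (F.indicator 1) x) := by
          exact mul_le_mul_right (poi_poi_le hr hR (measurable_one.indicator hF) x) _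
      _ ≤ _ := by
          rw [← mul_assoc, ← ENNReal.ofReal_mul hK]
          refine mul_le_mul_left (ENNReal.ofReal_le_ofReal ?_) _
          gcongr
          linarith [Real.pi_pos]

lemma setLIntegral_comp_add_le (h : ℝ → ℝ≥0∞) {S T : Set ℝ} {τ : ℝ} (hST : ∀ x ∈ S, x + τ ∈ T) :
    ∫⁻ x in S, h (x + τ) ≤ ∫⁻ u in T, h u := by
  calc ∫⁻ x in S, h (x + τ) ≤ ∫⁻ x in (fun x => x + τ) ⁻¹' T, h (x + τ) :=
        lintegral_mono_set hST
    _ = _ := by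
        exact (measurePreserving_add_right volume τ).setLIntegral_comp_preimage_emb
          (measurableEmbedding_addRight τ) h T

lemma add_mem_thickening {S : Set ℝ} {x τ a b c : ℝ} (hx : x ∈ Metric.thickening a S)
    (hτ : |τ| ≤ b) (habc : a + b ≤ c) : x + τ ∈ Metric.thickening c S := by
  obtain ⟨z, hz, hxz⟩ := Metric.mem_thickening_iff.1 hx
  refine Metric.mem_thickening_iff.2 ⟨z, hz, ?_⟩
  rw [Real.dist_eq] at hxz ⊢
  have := abs_add_le (x - z) τ
  rw [show x - z + τ = x + τ - z by ring] at this
  linarith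

/-! ### The form for fixed t: successive removal of the faster oscillating factors -/

section Fiber

variable {Ψ : ℝ → ℝ≥0∞} {S F : Set ℝ} {ε R D : ℝ}

lemma poi_add_le_of_le {r r' : ℝ} (hr' : 0 < r') (hrr : r' ≤ r) (h : ℝ → ℝ≥0∞) (x s : ℝ) :
    poi r h (x + s) ≤ ENNReal.ofReal (2 * (1 + |s| / r') ^ 2) * poi r h x := by
  have hr := hr'.trans_le hrr
  have h0 : 0 ≤ |s| / r := by positivity
  refine (poi_add_le hr h x s).trans (mul_le_mul_left (ENNReal.ofReal_le_ofReal ?_) _)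
  gcongr

/-- The fiber of the form over a fixed `t`, with the whole decay on the first function. -/
lemma lintegral_fiber_first_le (hR : 0 < R) (hRε : R ≤ ε) (hε : ε ≤ 1) (hS : MeasurableSet S)
    (hΨ : IsTestWeight Ψ S F (ε * R ^ 3) D) {α β γ : ℝ → ℝ≥0∞} (hα : Measurable α)
    (hβ : Measurable β) (hγ : Measurable γ) {N₂ N₃ : ℝ≥0∞}
    (hN₂ : ∀ x ∈ S, poi (R ^ 2) β x ≤ N₂) (hN₃ : ∀ x ∈ S, poi (R ^ 3) γ x ≤ N₃)
    {t : ℝ} (ht : |t| ≤ 4 * R) :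
    ∫⁻ x, poi (ε * R) α (x - t) * poi (ε * R ^ 2) β (x + t ^ 2) * poi (ε * R ^ 3) γ (x + t ^ 3) *
      Ψ x ≤ ENNReal.ofReal (D * (512 * avgConst ^ 2)) * (N₂ * N₃) *
        ∫⁻ u in Metric.thickening (100 * R) S, poi (ε * R) α u := by
  have hε0 : 0 < ε := hR.trans_le hRε
  have hR1 : R ≤ 1 := hRε.trans hε
  -- Here R ≤ ε, that is k ≥ m, is used: the first average, of width ε R, does not change over the
  -- window R² of the second factor, and the second, of width ε R², does not change over the window
  -- R³ of the third.
  have hR2 : R ^ 2 ≤ ε * R := by nlinarith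
  have hR3 : R ^ 3 ≤ ε * R ^ 2 := by nlinarith [pow_pos hR 2]
  have h32 : ε * R ^ 3 ≤ ε * R ^ 2 := by
    gcongr ε * ?_; exact pow_le_pow_of_le_one hR.le hR1 (by norm_num)
  have h21 : ε * R ^ 2 ≤ ε * R := by
    gcongr ε * ?_; exact pow_le_of_le_one hR.le hR1 (by norm_num)
  have he1 : ε * R ≤ R := mul_le_of_le_one_left hR.le hε
  have he2 : ε * R ^ 2 ≤ R ^ 2 := mul_le_of_le_one_left (by positivity) hε
  have he3 : ε * R ^ 3 ≤ R ^ 3 := mul_le_of_le_one_left (by positivity) hε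
  have hR3' : R ^ 3 ≤ R ^ 2 := hR3.trans he2
  have ht2 : |t ^ 2| ≤ 16 * R ^ 2 := by
    rw [abs_pow]
    calc |t| ^ 2 ≤ (4 * R) ^ 2 := by gcongr
      _ = _ := by ring
  have ht3 : |t ^ 3| ≤ 64 * R ^ 3 := by
    rw [abs_pow]
    calc |t| ^ 3 ≤ (4 * R) ^ 3 := by gcongr
      _ = _ := by ring
  have hmα := measurable_poi (ε * R) hα
  have hmβ := measurable_poi (ε * R ^ 2) hβ
  have hmγ := measurable_poi (ε * R ^ 3) hγ
  have hr3 : 0 < ε * R ^ 3 := by positivity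
  have h8 : ENNReal.ofReal (2 * (1 + 1) ^ 2) = 8 := by norm_num
  have step1 := hΨ.lintegral_mul_le (fun x => poi (ε * R) α (x - t) *
    poi (ε * R ^ 2) β (x + t ^ 2) * poi (ε * R ^ 3) γ (x + t ^ 3)) (by fun_prop) (by
      intro x s
      have e1 := poi_add_le_of_le hr3 (h32.trans h21) α (x - t) s
      have e2 := poi_add_le_of_le hr3 h32 β (x + t ^ 2) s
      have e3 := poi_add_le_of_le hr3 le_rfl γ (x + t ^ 3) s
      rw [show x - t + s = x + s - t by ring] at e1
      rw [show x + t ^ 2 + s = x + s + t ^ 2 by ring] at e2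
      rw [show x + t ^ 3 + s = x + s + t ^ 3 by ring] at e3
      refine (mul_le_mul' (mul_le_mul' e1 e2) e3).trans (le_of_eq ?_)
      rw [show 8 * (1 + |s| / (ε * R ^ 3)) ^ 6 = (2 * (1 + |s| / (ε * R ^ 3)) ^ 2) ^ 3 by ring,
        ENNReal.ofReal_pow (by positivity)]
      ring)
  -- The third factor is removed on the window R³. The constant 64 = 8 · 8 is the variation of the
  -- first two averages over their own widths.
  have step2 := setLIntegral_mul_poi_le (S₀ := S) (r := ε * R ^ 3) (R := R ^ 3) (τ := t ^ 3)
    (D := 64) (N := N₃) hS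
    (g := fun x => poi (ε * R) α (x - t) * poi (ε * R ^ 2) β (x + t ^ 2)) (by fun_prop) hγ hr3 he3
    ht3 (Metric.self_subset_thickening (by positivity) S) (by
      intro x x' hxx
      have e1 := poi_le_poi_of_abs_sub_le (c := 1) (r := ε * R) (by positivity) zero_le_one α
        (x := x - t) (x' := x' - t) (by
          rw [sub_sub_sub_cancel_right, one_mul]; linarith)
      have e2 := poi_le_poi_of_abs_sub_le (c := 1) (r := ε * R ^ 2) (by positivity) zero_le_one β
        (x := x + t ^ 2) (x' := x' + t ^ 2) (by
          rw [add_sub_add_right_eq_sub, one_mul]; linarith)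
      rw [h8] at e1 e2
      refine (mul_le_mul' e1 e2).trans (le_of_eq (by ring))) hN₃
  -- The second factor is removed on the window R²; the domain is still within R² of S, where its
  -- averages are controlled. The translation of the first factor is then absorbed in the
  -- neighbourhood of size 100R.
  have step3 := setLIntegral_mul_poi_le (S := Metric.thickening (R ^ 3) S) (S₀ := S)
    (r := ε * R ^ 2) (R := R ^ 2) (τ := t ^ 2) (D := 8) (N := N₂)
    Metric.isOpen_thickening.measurableSet
    (g := fun x => poi (ε * R) α (x - t)) (by fun_prop) hβ (by positivity) he2
    (by linarith [pow_pos hR 2]) (Metric.thickening_mono hR3' S) (by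
      intro x x' hxx
      have e1 := poi_le_poi_of_abs_sub_le (c := 1) (r := ε * R) (by positivity) zero_le_one α
        (x := x - t) (x' := x' - t) (by
          rw [sub_sub_sub_cancel_right, one_mul]; linarith)
      rwa [h8] at e1) hN₂
  have step4 : ∫⁻ x in Metric.thickening (R ^ 2) (Metric.thickening (R ^ 3) S),
      poi (ε * R) α (x - t) ≤ ∫⁻ u in Metric.thickening (100 * R) S, poi (ε * R) α u := by
    refine setLIntegral_comp_add_le (poi (ε * R) α) (τ := -t) (fun x hx => ?_)
    refine add_mem_thickening (Metric.thickening_thickening_subset _ _ _ hx)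
      (b := 4 * R) (by rwa [abs_neg]) (by linarith)
  calc _ ≤ _ := step1
    _ ≤ ENNReal.ofReal D * (64 * (ENNReal.ofReal avgConst * N₃) *
          (8 * (ENNReal.ofReal avgConst * N₂) *
            ∫⁻ u in Metric.thickening (100 * R) S, poi (ε * R) α u)) := by
        gcongr
        refine step2.trans ?_
        gcongr
        exact step3.trans (by gcongr)
    _ = _ := by
        have := avgConst_pos
        rw [ENNReal.ofReal_mul hΨ.nonneg, ENNReal.ofReal_mul (by norm_num),
          ENNReal.ofReal_pow this.le, ENNReal.ofReal_ofNat]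
        ring

/-- The fiber of the form over a fixed `t`, with the whole decay on the second function. -/
lemma lintegral_fiber_second_le (hR : 0 < R) (hRε : R ≤ ε) (hε : ε ≤ 1) (hS : MeasurableSet S)
    (hΨ : IsTestWeight Ψ S F (ε * R ^ 3) D) {β γ : ℝ → ℝ≥0∞}
    (hβ : Measurable β) (hγ : Measurable γ) {N₃ : ℝ≥0∞}
    (hN₃ : ∀ x ∈ S, poi (R ^ 3) γ x ≤ N₃) {t : ℝ} (ht : |t| ≤ 4 * R) :
    ∫⁻ x, poi (ε * R ^ 2) β (x + t ^ 2) * poi (ε * R ^ 3) γ (x + t ^ 3) * Ψ x ≤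
      ENNReal.ofReal (D * (8 * avgConst)) * N₃ *
        ∫⁻ u in Metric.thickening (100 * R ^ 2) S, poi (ε * R ^ 2) β u := by
  have hε0 : 0 < ε := hR.trans_le hRε
  have hR1 : R ≤ 1 := hRε.trans hε
  have hR3 : R ^ 3 ≤ ε * R ^ 2 := by nlinarith [pow_pos hR 2]
  have h32 : ε * R ^ 3 ≤ ε * R ^ 2 := by
    gcongr ε * ?_; exact pow_le_pow_of_le_one hR.le hR1 (by norm_num)
  have he2 : ε * R ^ 2 ≤ R ^ 2 := mul_le_of_le_one_left (by positivity) hε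
  have he3 : ε * R ^ 3 ≤ R ^ 3 := mul_le_of_le_one_left (by positivity) hε
  have ht2 : |t ^ 2| ≤ 16 * R ^ 2 := by
    rw [abs_pow]
    calc |t| ^ 2 ≤ (4 * R) ^ 2 := by gcongr
      _ = _ := by ring
  have ht3 : |t ^ 3| ≤ 64 * R ^ 3 := by
    rw [abs_pow]
    calc |t| ^ 3 ≤ (4 * R) ^ 3 := by gcongr
      _ = _ := by ring
  have hmβ := measurable_poi (ε * R ^ 2) hβ
  have hmγ := measurable_poi (ε * R ^ 3) hγ
  have hr3 : 0 < ε * R ^ 3 := by positivity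
  have h8 : ENNReal.ofReal (2 * (1 + 1) ^ 2) = 8 := by norm_num
  have step1 := hΨ.lintegral_mul_le (fun x =>
    poi (ε * R ^ 2) β (x + t ^ 2) * poi (ε * R ^ 3) γ (x + t ^ 3)) (by fun_prop) (by
      intro x s
      have e2 := poi_add_le_of_le hr3 h32 β (x + t ^ 2) s
      have e3 := poi_add_le_of_le hr3 le_rfl γ (x + t ^ 3) s
      rw [show x + t ^ 2 + s = x + s + t ^ 2 by ring] at e2
      rw [show x + t ^ 3 + s = x + s + t ^ 3 by ring] at e3
      refine (mul_le_mul' e2 e3).trans ?_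
      rw [mul_mul_mul_comm, ← ENNReal.ofReal_mul (by positivity)]
      refine mul_le_mul_left (ENNReal.ofReal_le_ofReal ?_) _
      have h1 : (1 : ℝ) ≤ 1 + |s| / (ε * R ^ 3) := by
        have : 0 ≤ |s| / (ε * R ^ 3) := by positivity
        linarith
      calc _ = 4 * (1 + |s| / (ε * R ^ 3)) ^ 4 := by ring
        _ ≤ 8 * (1 + |s| / (ε * R ^ 3)) ^ 6 := by
          gcongr <;> norm_num)
  have step2 := setLIntegral_mul_poi_le (S₀ := S) (r := ε * R ^ 3) (R := R ^ 3) (τ := t ^ 3)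
    (D := 8) (N := N₃) hS
    (g := fun x => poi (ε * R ^ 2) β (x + t ^ 2)) (by fun_prop) hγ hr3 he3
    ht3 (Metric.self_subset_thickening (by positivity) S) (by
      intro x x' hxx
      have e2 := poi_le_poi_of_abs_sub_le (c := 1) (r := ε * R ^ 2) (by positivity) zero_le_one β
        (x := x + t ^ 2) (x' := x' + t ^ 2) (by
          rw [add_sub_add_right_eq_sub, one_mul]; linarith)
      rwa [h8] at e2) hN₃
  have step4 : ∫⁻ x in Metric.thickening (R ^ 3) S,
      poi (ε * R ^ 2) β (x + t ^ 2) ≤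
        ∫⁻ u in Metric.thickening (100 * R ^ 2) S, poi (ε * R ^ 2) β u :=
    setLIntegral_comp_add_le (poi (ε * R ^ 2) β) (fun x hx =>
      add_mem_thickening hx ht2 (by linarith [pow_pos hR 2]))
  calc _ ≤ _ := step1
    _ ≤ ENNReal.ofReal D * (8 * (ENNReal.ofReal avgConst * N₃) *
          ∫⁻ u in Metric.thickening (100 * R ^ 2) S, poi (ε * R ^ 2) β u) := by
        gcongr
        exact step2.trans (by gcongr)
    _ = _ := by
        rw [ENNReal.ofReal_mul hΨ.nonneg, ENNReal.ofReal_mul (by norm_num),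
          ENNReal.ofReal_ofNat]
        ring

/-- The fiber of the form over a fixed `t`, with the whole decay on the third function. -/
lemma lintegral_fiber_third_le (hR : 0 < R) (hRε : R ≤ ε)
    (hΨ : IsTestWeight Ψ S F (ε * R ^ 3) D) {γ : ℝ → ℝ≥0∞} (hγ : Measurable γ) {t : ℝ}
    (ht : |t| ≤ 4 * R) :
    ∫⁻ x, poi (ε * R ^ 3) γ (x + t ^ 3) * Ψ x ≤
      ENNReal.ofReal D * ∫⁻ u in Metric.thickening (100 * R ^ 3) S, poi (ε * R ^ 3) γ u := by
  have hε0 : 0 < ε := hR.trans_le hRε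
  have ht3 : |t ^ 3| ≤ 64 * R ^ 3 := by
    rw [abs_pow]
    calc |t| ^ 3 ≤ (4 * R) ^ 3 := by gcongr
      _ = _ := by ring
  have hmγ := measurable_poi (ε * R ^ 3) hγ
  have hr3 : 0 < ε * R ^ 3 := by positivity
  have step1 := hΨ.lintegral_mul_le (fun x => poi (ε * R ^ 3) γ (x + t ^ 3)) (by fun_prop) (by
      intro x s
      have e3 := poi_add_le_of_le hr3 le_rfl γ (x + t ^ 3) s
      rw [show x + t ^ 3 + s = x + s + t ^ 3 by ring] at e3
      refine e3.trans (mul_le_mul_left (ENNReal.ofReal_le_ofReal ?_) _)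
      have : 0 ≤ |s| / (ε * R ^ 3) := by positivity
      gcongr
      · norm_num
      · linarith
      · norm_num)
  refine step1.trans (mul_le_mul_right ?_ _)
  refine setLIntegral_comp_add_le (poi (ε * R ^ 3) γ) (fun x hx => ?_)
  exact add_mem_thickening (Metric.self_subset_thickening (δ := R ^ 3) (by positivity) S hx) ht3
    (by linarith [pow_pos hR 3])

end Fiber

end CurvedTHT

/-! ### The positive form at one scale and its Cauchy–Schwarz inequality -/

namespace CurvedTHT

open scoped ENNReal

lemma poi_mul_le {c R : ℝ} (hc : 1 ≤ c) (hR : 0 < R) (h : ℝ → ℝ≥0∞) (x : ℝ) :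
    poi (c * R) h x ≤ ENNReal.ofReal c * poi R h x := by
  unfold poi
  rw [← lintegral_const_mul' _ _ ENNReal.ofReal_ne_top]
  refine lintegral_mono fun y => ?_
  rw [← mul_assoc, ← ENNReal.ofReal_mul (by linarith)]
  refine mul_le_mul_left (ENNReal.ofReal_le_ofReal ?_) _
  unfold pk
  rw [mul_div_assoc]
  gcongr
  nlinarith

lemma poi_comp_sub (R : ℝ) (h : ℝ → ℝ≥0∞) (u : ℝ) :
    poi R (fun v => h (u - v)) 0 = poi R h u := by
  unfold poi
  rw [← lintegral_sub_left_eq_self (fun y => ENNReal.ofReal (pk R (u - y)) * h y) u]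
  refine lintegral_congr fun y => ?_
  have : pk R (0 - y) = pk R (u - (u - y)) := by simp [pk]
  rw [this]

/-- The properties of the truncated Hilbert kernel at scale `R`. -/
structure IsKernelWeight (σ : ℝ → ℝ≥0∞) (R M : ℝ) : Prop where
  meas : Measurable σ
  nonneg : 0 ≤ M
  le : ∀ t, σ t ≤ ENNReal.ofReal (M / R)
  supp : ∀ t, σ t ≠ 0 → R / 4 ≤ |t| ∧ |t| ≤ 4 * R

variable {σ : ℝ → ℝ≥0∞} {R M : ℝ}

lemma IsKernelWeight.lintegral_mul_le (hσ : IsKernelWeight σ R M) {H : ℝ → ℝ≥0∞}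
    {T : Set ℝ} (hT : MeasurableSet T) (hTs : ∀ t, σ t ≠ 0 → t ∈ T) :
    ∫⁻ t, σ t * H t ≤ ENNReal.ofReal (M / R) * ∫⁻ t in T, H t := by
  rw [← lintegral_const_mul' _ _ ENNReal.ofReal_ne_top, ← lintegral_indicator hT]
  refine lintegral_mono fun t => ?_
  by_cases h0 : σ t = 0
  · rw [h0, zero_mul]; exact zero_le
  · rw [indicator_of_mem (hTs t h0)]
    exact mul_le_mul_left (hσ.le t) _

lemma IsKernelWeight.mem_ball (hσ : IsKernelWeight σ R M) (hR : 0 < R) (t : ℝ) (ht : σ t ≠ 0) :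
    t ∈ Metric.ball 0 (5 * R) := by
  rw [Metric.mem_ball, Real.dist_eq, sub_zero]
  linarith [(hσ.supp t ht).2]

lemma IsKernelWeight.lintegral_le (hσ : IsKernelWeight σ R M) (hR : 0 < R) :
    ∫⁻ t, σ t ≤ ENNReal.ofReal (10 * M) := by
  have := hσ.lintegral_mul_le (H := fun _ => 1) measurableSet_ball (hσ.mem_ball hR)
  simp only [mul_one, setLIntegral_one, Real.volume_ball] at this
  have hM := hσ.nonneg
  refine this.trans (le_of_eq ?_)
  rw [← ENNReal.ofReal_mul (by positivity)]
  congr 1; field_simp; ring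

lemma IsKernelWeight.lintegral_add_le (hσ : IsKernelWeight σ R M) (hR : 0 < R)
    (h : ℝ → ℝ≥0∞) (u : ℝ) :
    ∫⁻ t, σ t * h (u + t) ≤ ENNReal.ofReal (50 * M) * poi R h u := by
  have hM := hσ.nonneg
  calc _ ≤ ENNReal.ofReal (M / R) * ∫⁻ t in Metric.ball 0 (5 * R), h (u + t) :=
        hσ.lintegral_mul_le measurableSet_ball (hσ.mem_ball hR)
    _ ≤ ENNReal.ofReal (M / R) * (ENNReal.ofReal (2 * (5 * R)) *
          (ENNReal.ofReal 5 * poi R h u)) := by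
        gcongr
        refine (setLIntegral_ball_le_poi (by positivity) _ _).trans ?_
        simp_rw [add_comm u]
        rw [poi_comp_add (5 * R) h u 0, zero_add]
        gcongr
        exact poi_mul_le (by norm_num) hR h u
    _ = _ := by
        rw [← mul_assoc, ← mul_assoc, ← ENNReal.ofReal_mul (by positivity),
          ← ENNReal.ofReal_mul (by positivity)]
        congr 2; field_simp; ring

/-- The substitution v = t² has Jacobian 2t ≥ R/2 on this interval; the separation of the support
from t = 0 is essential. The image lies in [0, 16R²], inside the open ball of radius 17R². -/
lemma setLIntegral_comp_sq_le (hR : 0 < R) (H : ℝ → ℝ≥0∞) :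
    ∫⁻ t in Icc (R / 4) (4 * R), H (t ^ 2) ≤
      ENNReal.ofReal (2 / R) * ∫⁻ v in Metric.ball 0 (17 * R ^ 2), H v := by
  have himg := lintegral_image_eq_lintegral_abs_deriv_mul (f := fun t : ℝ => t ^ 2)
    (f' := fun t => 2 * t) (measurableSet_Icc (a := R / 4) (b := 4 * R))
    (fun x _ => by simpa using (hasDerivAt_pow 2 x).hasDerivWithinAt)
    (fun x hx y hy hxy => by
      have hx0 : 0 ≤ x := le_trans (by positivity) hx.1
      have hy0 : 0 ≤ y := le_trans (by positivity) hy.1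
      exact (pow_left_inj₀ hx0 hy0 two_ne_zero).1 hxy) H
  calc ∫⁻ t in Icc (R / 4) (4 * R), H (t ^ 2)
      ≤ ∫⁻ t in Icc (R / 4) (4 * R), ENNReal.ofReal (2 / R) *
          (ENNReal.ofReal |2 * t| * H (t ^ 2)) := by
        refine setLIntegral_mono' measurableSet_Icc fun t ht => ?_
        rw [← mul_assoc, ← ENNReal.ofReal_mul (by positivity)]
        refine le_mul_of_one_le_left zero_le ?_
        rw [ENNReal.one_le_ofReal, abs_of_nonneg (by linarith [ht.1]), div_mul_eq_mul_div,
          le_div_iff₀ hR]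
        linarith [ht.1]
    _ = ENNReal.ofReal (2 / R) * ∫⁻ v in (fun t : ℝ => t ^ 2) '' Icc (R / 4) (4 * R), H v := by
        rw [himg, lintegral_const_mul' _ _ ENNReal.ofReal_ne_top]
    _ ≤ _ := by
        refine mul_le_mul_right (lintegral_mono_set ?_) _
        rintro _ ⟨t, ht, rfl⟩
        rw [Metric.mem_ball, Real.dist_eq, sub_zero, abs_of_nonneg (sq_nonneg t)]
        have h0 : 0 ≤ t := le_trans (by positivity) ht.1
        nlinarith [ht.2, mul_pos hR hR]

/-- Averaging along the parabola at scale R is, after the substitution on each of the two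
half-lines, an ordinary average at scale R². It produces the weight against which the square
function of the second factor is tested. -/
lemma IsKernelWeight.lintegral_sub_sq_le (hσ : IsKernelWeight σ R M) (hR : 0 < R)
    (h : ℝ → ℝ≥0∞) (u : ℝ) :
    ∫⁻ t, σ t * h (u - t ^ 2) ≤ ENNReal.ofReal (2312 * M) * poi (R ^ 2) h u := by
  have hM := hσ.nonneg
  set H : ℝ → ℝ≥0∞ := fun v => h (u - v) with hH
  have hR2 : 0 < R ^ 2 := by positivity
  have hneg : ∫⁻ t in Neg.neg ⁻¹' Icc (R / 4) (4 * R), H (t ^ 2) =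
      ∫⁻ t in Icc (R / 4) (4 * R), H (t ^ 2) := by
    have := (Measure.measurePreserving_neg (volume : Measure ℝ)).setLIntegral_comp_preimage_emb
      (MeasurableEquiv.neg ℝ).measurableEmbedding (fun t => H (t ^ 2)) (Icc (R / 4) (4 * R))
    simpa using this
  calc ∫⁻ t, σ t * h (u - t ^ 2)
      ≤ ENNReal.ofReal (M / R) *
          ∫⁻ t in Icc (R / 4) (4 * R) ∪ Neg.neg ⁻¹' Icc (R / 4) (4 * R), H (t ^ 2) := by
        refine hσ.lintegral_mul_le
          (measurableSet_Icc.union (measurable_neg measurableSet_Icc)) fun t ht => ?_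
        obtain ⟨h1, h2⟩ := hσ.supp t ht
        rcases abs_cases t with ⟨h3, -⟩ | ⟨h3, -⟩
        · left; rw [h3] at h1 h2; exact ⟨h1, h2⟩
        · right; rw [h3] at h1 h2; exact ⟨h1, h2⟩
    _ ≤ ENNReal.ofReal (M / R) * (2 * (ENNReal.ofReal (2 / R) *
          (ENNReal.ofReal (2 * (17 * R ^ 2)) * (ENNReal.ofReal 17 * poi (R ^ 2) h u)))) := by
        gcongr
        refine (lintegral_union_le _ _ _).trans ?_
        rw [hneg, ← two_mul]
        gcongr
        refine (setLIntegral_comp_sq_le hR H).trans ?_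
        gcongr
        refine (setLIntegral_ball_le_poi (by positivity) _ _).trans ?_
        gcongr
        rw [hH, poi_comp_sub]
        exact poi_mul_le (by norm_num) hR2 h u
    _ = _ := by
        rw [show (2 : ℝ≥0∞) = ENNReal.ofReal 2 by simp]
        simp only [← mul_assoc]
        rw [← ENNReal.ofReal_mul (by positivity), ← ENNReal.ofReal_mul (by positivity),
          ← ENNReal.ofReal_mul (by positivity), ← ENNReal.ofReal_mul (by positivity)]
        congr 2; field_simp; ring

/-- The positive form at one scale. -/
noncomputable def triForm (a b c Ψ σ : ℝ → ℝ≥0∞) : ℝ≥0∞ :=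
  ∫⁻ p : ℝ × ℝ, a (p.1 - p.2) * b (p.1 + p.2 ^ 2) * c (p.1 + p.2 ^ 3) * Ψ p.1 * σ p.2

lemma triForm_mono {a a' b b' c c' Ψ Ψ' σ : ℝ → ℝ≥0∞} (ha : ∀ x, a x ≤ a' x)
    (hb : ∀ x, b x ≤ b' x) (hc : ∀ x, c x ≤ c' x) (hΨ : ∀ x, Ψ x ≤ Ψ' x) :
    triForm a b c Ψ σ ≤ triForm a' b' c' Ψ' σ := by
  refine lintegral_mono fun p => ?_
  exact mul_le_mul_left (mul_le_mul' (mul_le_mul' (mul_le_mul' (ha _) (hb _)) (hc _)) (hΨ _)) _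

variable {a a' b b' c c' Ψ : ℝ → ℝ≥0∞}

lemma triForm_const_mul {A B C : ℝ≥0∞} (hA : A ≠ ⊤) (hB : B ≠ ⊤) (hC : C ≠ ⊤) :
    triForm (fun x => A * a x) (fun x => B * b x) (fun x => C * c x) Ψ σ =
      A * B * C * triForm a b c Ψ σ := by
  unfold triForm
  rw [← lintegral_const_mul' _ _ (by finiteness)]
  refine lintegral_congr fun p => ?_
  ring

lemma triForm_eq (ha : Measurable a) (hb : Measurable b) (hc : Measurable c) (hΨ : Measurable Ψ)
    (hσ : Measurable σ) : triForm a b c Ψ σ =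
      ∫⁻ t, σ t * ∫⁻ x, a (x - t) * b (x + t ^ 2) * c (x + t ^ 3) * Ψ x := by
  rw [triForm, Measure.volume_eq_prod, lintegral_prod_symm _ (Measurable.aemeasurable (by fun_prop))]
  refine lintegral_congr fun t => ?_
  rw [← lintegral_const_mul _ (by fun_prop)]
  refine lintegral_congr fun x => ?_
  ring

/-- A fiber bound uniform in t uses only the total mass of σ. -/
lemma triForm_le_of_fiber (ha : Measurable a) (hb : Measurable b) (hc : Measurable c)
    (hΨ : Measurable Ψ) (hσ : IsKernelWeight σ R M) (hR : 0 < R) {L : ℝ≥0∞}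
    (hL : ∀ t, |t| ≤ 4 * R →
      ∫⁻ x, a (x - t) * b (x + t ^ 2) * c (x + t ^ 3) * Ψ x ≤ L) :
    triForm a b c Ψ σ ≤ ENNReal.ofReal (10 * M) * L := by
  rw [triForm_eq ha hb hc hΨ hσ.meas]
  calc _ ≤ ∫⁻ t, σ t * L := by
        refine lintegral_mono fun t => ?_
        by_cases h0 : σ t = 0
        · rw [h0, zero_mul, zero_mul]
        · exact mul_le_mul_right (hL t (hσ.supp t h0).2) _
    _ = (∫⁻ t, σ t) * L := lintegral_mul_const _ hσ.meas
    _ ≤ _ := mul_le_mul_left (hσ.lintegral_le hR) _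

lemma triForm_add_le (ha : ∀ x, a x ≤ a' x + c' x) (ha' : Measurable a')
    (hb : Measurable b) (hc : Measurable c) (hΨ : Measurable Ψ) (hσ : Measurable σ) :
    triForm a b c Ψ σ ≤ triForm a' b c Ψ σ + triForm c' b c Ψ σ := by
  unfold triForm
  rw [← lintegral_add_left (by fun_prop)]
  refine lintegral_mono fun p => ?_
  calc _ ≤ (a' (p.1 - p.2) + c' (p.1 - p.2)) * b (p.1 + p.2 ^ 2) * c (p.1 + p.2 ^ 3) * Ψ p.1 *
        σ p.2 := by gcongr; exact ha _
    _ = _ := by ring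

lemma triForm_add_le₂ (hb : ∀ x, b x ≤ b' x + c' x) (hb' : Measurable b')
    (ha : Measurable a) (hc : Measurable c) (hΨ : Measurable Ψ) (hσ : Measurable σ) :
    triForm a b c Ψ σ ≤ triForm a b' c Ψ σ + triForm a c' c Ψ σ := by
  unfold triForm
  rw [← lintegral_add_left (by fun_prop)]
  refine lintegral_mono fun p => ?_
  calc _ ≤ a (p.1 - p.2) * (b' (p.1 + p.2 ^ 2) + c' (p.1 + p.2 ^ 2)) * c (p.1 + p.2 ^ 3) * Ψ p.1 *
        σ p.2 := by gcongr; exact hb _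
    _ = _ := by ring

lemma triForm_add_le₃ (hc : ∀ x, c x ≤ b' x + c' x) (hb' : Measurable b')
    (ha : Measurable a) (hb : Measurable b) (hΨ : Measurable Ψ) (hσ : Measurable σ) :
    triForm a b c Ψ σ ≤ triForm a b b' Ψ σ + triForm a b c' Ψ σ := by
  unfold triForm
  rw [← lintegral_add_left (by fun_prop)]
  refine lintegral_mono fun p => ?_
  calc _ ≤ a (p.1 - p.2) * b (p.1 + p.2 ^ 2) * (b' (p.1 + p.2 ^ 3) + c' (p.1 + p.2 ^ 3)) * Ψ p.1 *
        σ p.2 := by gcongr; exact hc _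
    _ = _ := by ring

/-- The Cauchy--Schwarz inequality for the form, with the weights averaged in `t`. -/
lemma sq_triForm_one_le {S F : Set ℝ} {r D : ℝ} (ha : Measurable a) (hb : Measurable b)
    (hΨ : IsTestWeight Ψ S F r D) (hσ : IsKernelWeight σ R M) (hR : 0 < R) (hr1 : r ≤ R)
    (hr2 : r ≤ R ^ 2) :
    triForm a b 1 Ψ σ ^ 2 ≤
      (ENNReal.ofReal (50 * M * D) * ∫⁻ u, a u ^ 2 * poi R (F.indicator 1) u) *
      (ENNReal.ofReal (2312 * M * D) * ∫⁻ u, b u ^ 2 * poi (R ^ 2) (F.indicator 1) u) := by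
  have hΨm := hΨ.meas
  have hσm := hσ.meas
  have hM := hσ.nonneg
  have hD := hΨ.nonneg
  have hcs := sq_lintegral_weight_mul_le (volume : Measure (ℝ × ℝ))
    (w := fun p => Ψ p.1 * σ p.2) (f := fun p => a (p.1 - p.2)) (g := fun p => b (p.1 + p.2 ^ 2))
    (by fun_prop) (by fun_prop) (by fun_prop)
  have h1 : ∫⁻ p : ℝ × ℝ, Ψ p.1 * σ p.2 * a (p.1 - p.2) ^ 2 ≤
      ENNReal.ofReal (50 * M * D) * ∫⁻ u, a u ^ 2 * poi R (F.indicator 1) u := by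
    calc ∫⁻ p : ℝ × ℝ, Ψ p.1 * σ p.2 * a (p.1 - p.2) ^ 2
        = ∫⁻ t, ∫⁻ x, Ψ x * σ t * a (x - t) ^ 2 := by
          rw [Measure.volume_eq_prod,
            lintegral_prod_symm _ (Measurable.aemeasurable (by fun_prop))]
      _ = ∫⁻ t, ∫⁻ u, Ψ (u + t) * σ t * a u ^ 2 := by
          refine lintegral_congr fun t => ?_
          rw [← lintegral_add_right_eq_self _ t]
          simp only [add_sub_cancel_right]
      _ = ∫⁻ u, a u ^ 2 * ∫⁻ t, σ t * Ψ (u + t) := by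
          rw [lintegral_lintegral_swap
            (Measurable.aemeasurable (by unfold Function.uncurry; fun_prop))]
          refine lintegral_congr fun u => ?_
          rw [← lintegral_const_mul _ (by fun_prop)]
          refine lintegral_congr fun t => ?_
          ring
      _ ≤ ∫⁻ u, ENNReal.ofReal (50 * M * D) * (a u ^ 2 * poi R (F.indicator 1) u) := by
          refine lintegral_mono fun u => ?_
          calc _ ≤ a u ^ 2 * (ENNReal.ofReal (50 * M) *
                (ENNReal.ofReal D * poi R (F.indicator 1) u)) := by
                gcongr
                refine (hσ.lintegral_add_le hR Ψ u).trans ?_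
                gcongr
                exact hΨ.poi_le R hr1 u
            _ = _ := by rw [ENNReal.ofReal_mul (p := 50 * M) (by positivity)]; ring
      _ = _ := lintegral_const_mul' _ _ ENNReal.ofReal_ne_top
  have h2 : ∫⁻ p : ℝ × ℝ, Ψ p.1 * σ p.2 * b (p.1 + p.2 ^ 2) ^ 2 ≤
      ENNReal.ofReal (2312 * M * D) * ∫⁻ u, b u ^ 2 * poi (R ^ 2) (F.indicator 1) u := by
    calc ∫⁻ p : ℝ × ℝ, Ψ p.1 * σ p.2 * b (p.1 + p.2 ^ 2) ^ 2
        = ∫⁻ t, ∫⁻ x, Ψ x * σ t * b (x + t ^ 2) ^ 2 := by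
          rw [Measure.volume_eq_prod,
            lintegral_prod_symm _ (Measurable.aemeasurable (by fun_prop))]
      _ = ∫⁻ t, ∫⁻ u, Ψ (u - t ^ 2) * σ t * b u ^ 2 := by
          refine lintegral_congr fun t => ?_
          rw [← lintegral_sub_right_eq_self _ (t ^ 2)]
          simp only [sub_add_cancel]
      _ = ∫⁻ u, b u ^ 2 * ∫⁻ t, σ t * Ψ (u - t ^ 2) := by
          rw [lintegral_lintegral_swap
            (Measurable.aemeasurable (by unfold Function.uncurry; fun_prop))]
          refine lintegral_congr fun u => ?_
          rw [← lintegral_const_mul _ (by fun_prop)]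
          refine lintegral_congr fun t => ?_
          ring
      _ ≤ ∫⁻ u, ENNReal.ofReal (2312 * M * D) * (b u ^ 2 * poi (R ^ 2) (F.indicator 1) u) := by
          refine lintegral_mono fun u => ?_
          calc _ ≤ b u ^ 2 * (ENNReal.ofReal (2312 * M) *
                (ENNReal.ofReal D * poi (R ^ 2) (F.indicator 1) u)) := by
                gcongr
                refine (hσ.lintegral_sub_sq_le hR Ψ u).trans ?_
                gcongr
                exact hΨ.poi_le (R ^ 2) hr2 u
            _ = _ := by rw [ENNReal.ofReal_mul (p := 2312 * M) (by positivity)]; ring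
      _ = _ := lintegral_const_mul' _ _ ENNReal.ofReal_ne_top
  have h0 : triForm a b 1 Ψ σ =
      ∫⁻ p : ℝ × ℝ, Ψ p.1 * σ p.2 * (a (p.1 - p.2) * b (p.1 + p.2 ^ 2)) := by
    refine lintegral_congr fun p => ?_
    simp only [Pi.one_apply]; ring
  rw [h0]
  exact hcs.trans (mul_le_mul' h1 h2)

lemma sq_tsum_le {ι : Type*} [Countable ι] {T X Y : ι → ℝ≥0∞} (h : ∀ k, T k ^ 2 ≤ X k * Y k) :
    (∑' k, T k) ^ 2 ≤ (∑' k, X k) * ∑' k, Y k := by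
  have hsq : ∀ x : ℝ≥0∞, (x ^ (1 / 2 : ℝ)) ^ 2 = x := fun x => by
    rw [← ENNReal.rpow_natCast, ← ENNReal.rpow_mul]; norm_num
  have hT : ∀ k, T k ≤ X k ^ (1 / 2 : ℝ) * Y k ^ (1 / 2 : ℝ) := by
    intro k
    rw [← ENNReal.mul_rpow_of_nonneg _ _ (by norm_num)]
    calc T k = (T k ^ 2) ^ (1 / 2 : ℝ) := by
          rw [← ENNReal.rpow_natCast, ← ENNReal.rpow_mul]; norm_num
      _ ≤ _ := ENNReal.rpow_le_rpow (h k) (by norm_num)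
  let _ : MeasurableSpace ι := ⊤
  have := sq_lintegral_mul_le (Measure.count : Measure ι)
    (f := fun k => X k ^ (1 / 2 : ℝ)) (g := fun k => Y k ^ (1 / 2 : ℝ))
    (measurable_of_countable _).aemeasurable (measurable_of_countable _).aemeasurable
  simp only [lintegral_count, hsq] at this
  exact (pow_le_pow_left' (ENNReal.tsum_le_tsum hT) 2).trans this

end CurvedTHT

/-! ### The standing assumptions on one function and their consequences -/

namespace CurvedTHT

open scoped ENNReal

/-- The assumptions on one of the first three functions: `f` is dominated by `F`, the set `S` avoids
the set where the averages of `F` exceed `h`, and `h` is at least the relative size of `F`. -/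
structure IsDatum (f : ℝ → ℂ) (F S : Set ℝ) (h : ℝ) (V : ℝ≥0∞) : Prop where
  meas : Measurable f
  height_pos : 0 < h
  measurableSet : MeasurableSet F
  volume_ne_top : volume F ≠ ⊤
  enorm_le : ∀ᵐ y, ‖f y‖ₑ ≤ F.indicator 1 y
  notMem : ∀ x ∈ S, x ∉ exceptional F h
  volume_le : volume F ≤ ENNReal.ofReal h * V

namespace IsDatum

variable {f : ℝ → ℂ} {F S : Set ℝ} {h K : ℝ} {V : ℝ≥0∞} {φ : ℝ → ℝ}

lemma lintegral_le (hf : IsDatum f F S h V) : ∫⁻ y, ‖f y‖ₑ ≤ volume F :=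
  lintegral_le_of_dominated hf.measurableSet hf.enorm_le

lemma integrable (hf : IsDatum f F S h V) : Integrable f :=
  integrable_of_lintegral_ne_top hf.meas (ne_top_of_le_ne_top hf.volume_ne_top hf.lintegral_le)

lemma integrable_good (hf : IsDatum f F S h V) : Integrable (good F h f) :=
  integrable_of_lintegral_ne_top (measurable_good hf.meas)
    (ne_top_of_le_ne_top hf.volume_ne_top (lintegral_good_le.trans hf.lintegral_le))

lemma integrable_bad (hf : IsDatum f F S h V) : Integrable (bad F h f) :=
  hf.integrable.sub hf.integrable_good

/-- For h ≥ 1 the bad part vanishes; for h < 1 the minimum is h, and |F| ≤ h V. -/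
lemma lintegral_bad_le (hf : IsDatum f F S h V) :
    ∫⁻ y, ‖bad F h f y‖ₑ ≤ ENNReal.ofReal (2 * min 1 h) * V := by
  rcases le_or_gt 1 h with h1 | h1
  · simp [bad_eq_zero h1]
  · rw [min_eq_right h1.le, ENNReal.ofReal_mul zero_le_two, mul_assoc, ENNReal.ofReal_ofNat]
    exact (CurvedTHT.lintegral_bad_le hf.meas).trans
      (mul_le_mul_right (hf.lintegral_le.trans hf.volume_le) _)

lemma enorm_bandPart_le (hf : IsDatum f F S h V) (hK : IsKernelBound φ K) (n : ℤ) (x : ℝ) :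
    ‖bandPart φ n f x‖ₑ ≤ ENNReal.ofReal K * poi ((2 : ℝ) ^ n)⁻¹ (F.indicator 1) x :=
  (hK.enorm_bandPart_le n f x).trans (mul_le_mul_right (poi_mono _ hf.enorm_le x) _)

lemma enorm_bandPart_good_le (hf : IsDatum f F S h V) (hK : IsKernelBound φ K) (n : ℤ) (x : ℝ) :
    ‖bandPart φ n (good F h f) x‖ₑ ≤ ENNReal.ofReal (K * (2 * Real.pi * min 1 h)) * 1 := by
  have hμ : 0 ≤ min 1 h := le_min zero_le_one hf.height_pos.le
  rw [ENNReal.ofReal_mul hK.pos.le, mul_one]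
  refine (hK.enorm_bandPart_le n _ x).trans (mul_le_mul_right ?_ _)
  calc poi ((2 : ℝ) ^ n)⁻¹ (fun y => ‖good F h f y‖ₑ) x
      ≤ poi ((2 : ℝ) ^ n)⁻¹ (fun _ => ENNReal.ofReal (2 * min 1 h)) x :=
        poi_mono _ (CurvedTHT.enorm_good_le hf.height_pos hf.volume_ne_top hf.measurableSet
          hf.enorm_le) x
    _ = ENNReal.ofReal (2 * min 1 h) * poi ((2 : ℝ) ^ n)⁻¹ (fun _ => 1) x := by
        unfold poi
        rw [← lintegral_const_mul' _ _ ENNReal.ofReal_ne_top]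
        exact lintegral_congr fun y => by ring
    _ = _ := by
        rw [poi_one (by positivity), ← ENNReal.ofReal_mul (by positivity)]
        congr 1; ring

lemma enorm_bandPart_bad_le (hf : IsDatum f F S h V) (hK : IsKernelBound φ K)
    (hφ : IsFrequencyCutoff φ) (n : ℤ) (x : ℝ) :
    ‖bandPart φ n (bad F h f) x‖ₑ ≤
      ENNReal.ofReal K * poi ((2 : ℝ) ^ n)⁻¹ (badMass F h f ((2 : ℝ) ^ n)⁻¹) x :=
  hK.enorm_bandPart_bad_le hφ n hf.meas hf.integrable x

lemma enorm_bandPart_le_add (hf : IsDatum f F S h V) (hφ : IsFrequencyCutoff φ) (n : ℤ) (x : ℝ) :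
    ‖bandPart φ n f x‖ₑ ≤ ‖bandPart φ n (bad F h f) x‖ₑ + ‖bandPart φ n (good F h f) x‖ₑ := by
  have := bandPart_add hφ n hf.integrable_bad hf.integrable_good x
  simp_rw [add_comm (bad F h f _), good_add_bad] at this
  rw [this]
  exact enorm_add_le _ _

lemma poi_le (hf : IsDatum f F S h V) {R : ℝ} (hR : 0 < R) (x : ℝ) (hx : x ∈ S) :
    poi R (F.indicator 1) x ≤ ENNReal.ofReal (32 * Real.pi * min 1 h) :=
  poi_indicator_le hf.height_pos hf.volume_ne_top hf.measurableSet (hf.notMem x hx) hR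

lemma measurable_indicator (hf : IsDatum f F S h V) : Measurable (F.indicator (1 : ℝ → ℝ≥0∞)) :=
  measurable_one.indicator hf.measurableSet

lemma tsum_bad_le (hf : IsDatum f F S h V) (m : ℕ) {s : ℕ → ℤ} (hs : Function.Injective s) :
    ∑' k : Ici m, ∫⁻ u in Metric.thickening (100 * ((2 : ℝ) ^ s k)⁻¹) S,
      poi ((2 : ℝ) ^ (m + s k))⁻¹ (badMass F h f ((2 : ℝ) ^ (m + s k))⁻¹) u ≤
      ENNReal.ofReal (3200 * (m + 1) * min 1 h) * V := by
  refine (ENNReal.tsum_comp_le_tsum_of_injective Subtype.val_injective _).trans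
    ((tsum_setLIntegral_badMass_le hf.meas hf.notMem m hs).trans ?_)
  refine (mul_le_mul_right hf.lintegral_bad_le _).trans (le_of_eq ?_)
  rw [← mul_assoc, ← ENNReal.ofReal_mul (by positivity)]
  congr 2; ring

end IsDatum

lemma min_one_le_rpow {h θ : ℝ} (hh : 0 < h) (h0 : 0 ≤ θ) (h1 : θ ≤ 1) : min 1 h ≤ h ^ θ := by
  rcases le_total 1 h with h2 | h2
  · rw [min_eq_left h2]; exact Real.one_le_rpow h2 h0
  · rw [min_eq_right h2]
    simpa using Real.rpow_le_rpow_of_exponent_ge hh h2 h1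

/-- The bases are the two competing bounds of the Carleson type estimate, with μ = 2 min(1, h) and V
= h |F₄|. The powers of min(1, h) recombine to the first power, which is at most h^θ, and V supplies
another h^θ. The outcome is the square of the desired factor, since Cauchy–Schwarz takes the root.
-/
lemma min_one_rpow_mul_le {h θ : ℝ} (hh : 0 < h) (h0 : 0 < θ) (h1 : θ < 1) :
    ((2 * min 1 h) ^ 2) ^ (1 - θ) * (2 * min 1 h * h) ^ θ ≤ 4 * (h ^ θ) ^ 2 := by
  have hμ : 0 < min 1 h := lt_min one_pos hh
  set μ := min 1 h
  have hμ1 : μ ≤ 1 := min_le_left _ _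
  have hμh : μ ≤ h := min_le_right _ _
  calc ((2 * μ) ^ 2) ^ (1 - θ) * (2 * μ * h) ^ θ
      ≤ (4 * μ) ^ (1 - θ) * (4 * μ * h) ^ θ := by
        gcongr
        · nlinarith
        · nlinarith
    _ = 4 * μ * h ^ θ := by
        rw [Real.mul_rpow (x := 4 * μ) (by positivity) hh.le, ← mul_assoc,
          ← Real.rpow_add (by positivity), sub_add_cancel, Real.rpow_one]
    _ ≤ 4 * h ^ θ * h ^ θ := by
        gcongr
        exact min_one_le_rpow hh h0.le h1.le
    _ = _ := by ring

/-- The square function of the good part, tested against averages of `F₄`. -/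
lemma exists_tsum_sq_good_le {φ : ℝ → ℝ} (hφ : IsFrequencyCutoff φ) {θ : ℝ} (h0 : 0 < θ)
    (h1 : θ < 1) : ∃ A : ℝ, 0 < A ∧ ∀ (f : ℝ → ℂ) (F S F₄ : Set ℝ) (h : ℝ) (m : ℕ) (s : ℕ → ℤ),
      IsDatum f F S h (volume F₄) → MeasurableSet F₄ → volume F₄ ≠ ⊤ → StrictMono s →
      ∑' k : Ici m, ∫⁻ u, ‖bandPart φ (m + s k) (good F h f) u‖ₑ ^ 2 *
        poi ((2 : ℝ) ^ s k)⁻¹ (F₄.indicator 1) u ≤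
        ENNReal.ofReal (A * (h ^ θ) ^ 2) * volume F₄ := by
  obtain ⟨A, hA, H⟩ := exists_tsum_sq_bandPart_mul_poi_le hφ
  obtain ⟨B, hB, H'⟩ := tsum_min_le h0 h1
  refine ⟨A * B * 4, by positivity, fun f F S F₄ h m s hf hm₄ hF₄ hs => ?_⟩
  have hh := hf.height_pos
  have hμ : 0 < min 1 h := lt_min one_pos hh
  refine (ENNReal.tsum_comp_le_tsum_of_injective Subtype.val_injective _).trans
    ((H (good F h f) (2 * min 1 h) (ENNReal.ofReal h * volume F₄) F₄ m s (measurable_good hf.meas)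
    (enorm_good_le hf.height_pos hf.volume_ne_top hf.measurableSet hf.enorm_le)
    (lintegral_good_le.trans (hf.lintegral_le.trans hf.volume_le)) (by finiteness) hm₄ hF₄
    hs).trans ?_)
  refine (mul_le_mul_right (H' _ _) _).trans ?_
  have hV : volume F₄ ^ (1 - θ) * volume F₄ ^ θ = volume F₄ := by
    rw [← ENNReal.rpow_add_of_nonneg _ _ (by linarith) h0.le, sub_add_cancel, ENNReal.rpow_one]
  calc _ = ENNReal.ofReal A * (ENNReal.ofReal B * (ENNReal.ofReal
        (((2 * min 1 h) ^ 2) ^ (1 - θ) * (2 * min 1 h * h) ^ θ) *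
          (volume F₄ ^ (1 - θ) * volume F₄ ^ θ))) := by
        rw [← mul_assoc (ENNReal.ofReal (2 * min 1 h)), ← ENNReal.ofReal_pow (by positivity),
          ← ENNReal.ofReal_mul (by positivity), ENNReal.mul_rpow_of_nonneg _ _ (by linarith),
          ENNReal.mul_rpow_of_nonneg _ _ h0.le, ENNReal.ofReal_rpow_of_pos (by positivity),
          ENNReal.ofReal_rpow_of_pos (by positivity), mul_mul_mul_comm,
          ← ENNReal.ofReal_mul (by positivity)]
    _ ≤ ENNReal.ofReal A * (ENNReal.ofReal B * (ENNReal.ofReal (4 * (h ^ θ) ^ 2) *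
          volume F₄)) := by
        rw [hV]
        refine mul_le_mul_right (mul_le_mul_right (mul_le_mul_left (ENNReal.ofReal_le_ofReal ?_) _) _) _
        exact min_one_rpow_mul_le hh h0 h1
    _ = _ := by
        rw [← mul_assoc, ← mul_assoc, ← ENNReal.ofReal_mul hA.le,
          ← ENNReal.ofReal_mul (by positivity)]
        congr 2; ring

end CurvedTHT

/-! ### The form at scale k with one bad part -/

namespace CurvedTHT

open scoped ENNReal

section Scales

variable {φ : ℝ → ℝ} {f₁ f₂ f₃ : ℝ → ℂ} {F₁ F₂ F₃ F S : Set ℝ} {h₁ h₂ h₃ K M D : ℝ} {V : ℝ≥0∞}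
  {Ψ σ : ℝ → ℝ≥0∞} {m k : ℕ}

lemma inv_zpow_add_natCast (m k : ℕ) :
    ((2 : ℝ) ^ ((m : ℤ) + k))⁻¹ = ((2 : ℝ) ^ m)⁻¹ * ((2 : ℝ) ^ k)⁻¹ := by
  rw [zpow_add₀ two_ne_zero, zpow_natCast, zpow_natCast, mul_inv]

lemma inv_zpow_mul_natCast (j k : ℕ) :
    ((2 : ℝ) ^ ((j : ℤ) * k))⁻¹ = ((2 : ℝ) ^ k)⁻¹ ^ j := by
  rw [mul_comm, zpow_mul, zpow_natCast, zpow_natCast, inv_pow]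

lemma inv_zpow_add_mul_natCast (m j k : ℕ) :
    ((2 : ℝ) ^ ((m : ℤ) + j * k))⁻¹ = ((2 : ℝ) ^ m)⁻¹ * ((2 : ℝ) ^ k)⁻¹ ^ j := by
  rw [zpow_add₀ two_ne_zero, mul_inv, inv_zpow_mul_natCast, zpow_natCast]

lemma measurable_enorm_bandPart (hφ : IsFrequencyCutoff φ) (n : ℤ) {f : ℝ → ℂ}
    (hf : Integrable f) : Measurable fun x => ‖bandPart φ n f x‖ₑ :=
  (continuous_bandPart hφ n hf).enorm.measurable

/-- The second and third functions enter only through their averages over windows R² and R³ near S,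
at most 32π min(1, h_j) there. They need not be split. -/
lemma triForm_bad_first_le (hφ : IsFrequencyCutoff φ) (hK : IsKernelBound φ K)
    (hf₁ : IsDatum f₁ F₁ S h₁ V) (hf₂ : IsDatum f₂ F₂ S h₂ V) (hf₃ : IsDatum f₃ F₃ S h₃ V)
    (hS : MeasurableSet S) (hΨ : IsTestWeight Ψ S F (((2 : ℝ) ^ m)⁻¹ * ((2 : ℝ) ^ k)⁻¹ ^ 3) D)
    (hσ : IsKernelWeight σ ((2 : ℝ) ^ k)⁻¹ M) (hmk : m ≤ k) :
    triForm (fun x => ‖bandPart φ (m + k) (bad F₁ h₁ f₁) x‖ₑ)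
      (fun x => ‖bandPart φ (m + 2 * k) f₂ x‖ₑ) (fun x => ‖bandPart φ (m + 3 * k) f₃ x‖ₑ) Ψ σ ≤
      ENNReal.ofReal (K ^ 3 * (10 * M) * (D * (512 * avgConst ^ 2)) * (32 * Real.pi) ^ 2 *
        (min 1 h₂ * min 1 h₃)) *
        ∫⁻ u in Metric.thickening (100 * ((2 : ℝ) ^ (k : ℤ))⁻¹) S,
          poi ((2 : ℝ) ^ ((m : ℤ) + k))⁻¹ (badMass F₁ h₁ f₁ ((2 : ℝ) ^ ((m : ℤ) + k))⁻¹) u := by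
  have hK0 := hK.pos
  have hM := hσ.nonneg
  have hD := hΨ.nonneg
  have ha := avgConst_pos
  have hμ₂ : 0 < min 1 h₂ := lt_min one_pos hf₂.height_pos
  have hμ₃ : 0 < min 1 h₃ := lt_min one_pos hf₃.height_pos
  have hR : 0 < ((2 : ℝ) ^ k)⁻¹ := by positivity
  have hRε : ((2 : ℝ) ^ k)⁻¹ ≤ ((2 : ℝ) ^ m)⁻¹ := by gcongr; norm_num
  have hε : ((2 : ℝ) ^ m)⁻¹ ≤ 1 := inv_le_one_of_one_le₀ (one_le_pow₀ one_le_two)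
  have e1 := inv_zpow_add_natCast m k
  have e2 := inv_zpow_add_mul_natCast m 2 k
  have e3 := inv_zpow_add_mul_natCast m 3 k
  push_cast at e2 e3
  have hm₁ := measurable_badMass (F := F₁) (h := h₁) hf₁.meas ((2 : ℝ) ^ ((m : ℤ) + k))⁻¹
  calc _ ≤ _ := triForm_mono (hf₁.enorm_bandPart_bad_le hK hφ _) (hf₂.enorm_bandPart_le hK _)
          (hf₃.enorm_bandPart_le hK _) fun _ => le_rfl
    _ ≤ ENNReal.ofReal K * ENNReal.ofReal K * ENNReal.ofReal K * (ENNReal.ofReal (10 * M) *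
          (ENNReal.ofReal (D * (512 * avgConst ^ 2)) *
            (ENNReal.ofReal (32 * Real.pi * min 1 h₂) * ENNReal.ofReal (32 * Real.pi * min 1 h₃)) *
          ∫⁻ u in Metric.thickening (100 * ((2 : ℝ) ^ (k : ℤ))⁻¹) S,
            poi ((2 : ℝ) ^ ((m : ℤ) + k))⁻¹
              (badMass F₁ h₁ f₁ ((2 : ℝ) ^ ((m : ℤ) + k))⁻¹) u)) := by
        rw [triForm_const_mul ENNReal.ofReal_ne_top ENNReal.ofReal_ne_top ENNReal.ofReal_ne_top]
        refine mul_le_mul_right (triForm_le_of_fiber (measurable_poi _ hm₁)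
          (measurable_poi _ hf₂.measurable_indicator) (measurable_poi _ hf₃.measurable_indicator)
          hΨ.meas hσ hR fun t ht => ?_) _
        rw [e2, e3]
        -- Hides the wavelength inside `badMass`, so that the following rewriting affects only the
        -- Poisson averages.
        generalize badMass F₁ h₁ f₁ ((2 : ℝ) ^ ((m : ℤ) + k))⁻¹ = α at hm₁ ⊢
        rw [e1, zpow_natCast]
        exact lintegral_fiber_first_le hR hRε hε hS hΨ hm₁ hf₂.measurable_indicator
          hf₃.measurable_indicator (hf₂.poi_le (by positivity)) (hf₃.poi_le (by positivity)) ht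
    _ = _ := by
        simp only [← mul_assoc]
        repeat rw [← ENNReal.ofReal_mul (by positivity)]
        congr 2; ring

/-- For fixed t the first factor is evaluated at x - t, up to 4R away from S, where its average at
width ε R is not controlled. Hence the first function must already be good: it is bounded everywhere
and leaves the integral as a constant. This dictates the order of the splitting. -/
lemma triForm_bad_second_le (hφ : IsFrequencyCutoff φ) (hK : IsKernelBound φ K)
    (hf₁ : IsDatum f₁ F₁ S h₁ V) (hf₂ : IsDatum f₂ F₂ S h₂ V) (hf₃ : IsDatum f₃ F₃ S h₃ V)
    (hS : MeasurableSet S) (hΨ : IsTestWeight Ψ S F (((2 : ℝ) ^ m)⁻¹ * ((2 : ℝ) ^ k)⁻¹ ^ 3) D)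
    (hσ : IsKernelWeight σ ((2 : ℝ) ^ k)⁻¹ M) (hmk : m ≤ k) :
    triForm (fun x => ‖bandPart φ (m + k) (good F₁ h₁ f₁) x‖ₑ)
      (fun x => ‖bandPart φ (m + 2 * k) (bad F₂ h₂ f₂) x‖ₑ)
      (fun x => ‖bandPart φ (m + 3 * k) f₃ x‖ₑ) Ψ σ ≤
      ENNReal.ofReal (K ^ 3 * (10 * M) * (D * (8 * avgConst)) * (64 * Real.pi ^ 2) *
        (min 1 h₁ * min 1 h₃)) *
        ∫⁻ u in Metric.thickening (100 * ((2 : ℝ) ^ (2 * k : ℤ))⁻¹) S,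
          poi ((2 : ℝ) ^ ((m : ℤ) + 2 * k))⁻¹
            (badMass F₂ h₂ f₂ ((2 : ℝ) ^ ((m : ℤ) + 2 * k))⁻¹) u := by
  have hK0 := hK.pos
  have hM := hσ.nonneg
  have hD := hΨ.nonneg
  have ha := avgConst_pos
  have hμ₁ : 0 < min 1 h₁ := lt_min one_pos hf₁.height_pos
  have hμ₃ : 0 < min 1 h₃ := lt_min one_pos hf₃.height_pos
  have hR : 0 < ((2 : ℝ) ^ k)⁻¹ := by positivity
  have hRε : ((2 : ℝ) ^ k)⁻¹ ≤ ((2 : ℝ) ^ m)⁻¹ := by gcongr; norm_num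
  have hε : ((2 : ℝ) ^ m)⁻¹ ≤ 1 := inv_le_one_of_one_le₀ (one_le_pow₀ one_le_two)
  have e2 := inv_zpow_add_mul_natCast m 2 k
  have e2' := inv_zpow_mul_natCast 2 k
  have e3 := inv_zpow_add_mul_natCast m 3 k
  push_cast at e2 e2' e3
  have hm₂ := measurable_badMass (F := F₂) (h := h₂) hf₂.meas ((2 : ℝ) ^ ((m : ℤ) + 2 * k))⁻¹
  calc _ ≤ _ := triForm_mono (hf₁.enorm_bandPart_good_le hK _) (hf₂.enorm_bandPart_bad_le hK hφ _)
          (hf₃.enorm_bandPart_le hK _) fun _ => le_rfl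
    _ ≤ ENNReal.ofReal (K * (2 * Real.pi * min 1 h₁)) * ENNReal.ofReal K * ENNReal.ofReal K *
          (ENNReal.ofReal (10 * M) * (ENNReal.ofReal (D * (8 * avgConst)) *
            ENNReal.ofReal (32 * Real.pi * min 1 h₃) *
          ∫⁻ u in Metric.thickening (100 * ((2 : ℝ) ^ (2 * k : ℤ))⁻¹) S,
            poi ((2 : ℝ) ^ ((m : ℤ) + 2 * k))⁻¹
              (badMass F₂ h₂ f₂ ((2 : ℝ) ^ ((m : ℤ) + 2 * k))⁻¹) u)) := by
        rw [triForm_const_mul ENNReal.ofReal_ne_top ENNReal.ofReal_ne_top ENNReal.ofReal_ne_top]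
        refine mul_le_mul_right (triForm_le_of_fiber measurable_const (measurable_poi _ hm₂)
          (measurable_poi _ hf₃.measurable_indicator) hΨ.meas hσ hR fun t ht => ?_) _
        rw [e3, e2']
        generalize badMass F₂ h₂ f₂ ((2 : ℝ) ^ ((m : ℤ) + 2 * k))⁻¹ = α at hm₂ ⊢
        rw [e2]
        simp only [one_mul]
        exact lintegral_fiber_second_le hR hRε hε hS hΨ hm₂ hf₃.measurable_indicator
          (hf₃.poi_le (by positivity)) ht
    _ = _ := by
        simp only [← mul_assoc]
        repeat rw [← ENNReal.ofReal_mul (by positivity)]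
        congr 2; ring

/-- The two good factors are bounded everywhere, and the translation by t³ of the remaining one is
absorbed in the neighbourhood of size 100R³. -/
lemma triForm_bad_third_le (hφ : IsFrequencyCutoff φ) (hK : IsKernelBound φ K)
    (hf₁ : IsDatum f₁ F₁ S h₁ V) (hf₂ : IsDatum f₂ F₂ S h₂ V) (hf₃ : IsDatum f₃ F₃ S h₃ V)
    (hΨ : IsTestWeight Ψ S F (((2 : ℝ) ^ m)⁻¹ * ((2 : ℝ) ^ k)⁻¹ ^ 3) D)
    (hσ : IsKernelWeight σ ((2 : ℝ) ^ k)⁻¹ M) (hmk : m ≤ k) :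
    triForm (fun x => ‖bandPart φ (m + k) (good F₁ h₁ f₁) x‖ₑ)
      (fun x => ‖bandPart φ (m + 2 * k) (good F₂ h₂ f₂) x‖ₑ)
      (fun x => ‖bandPart φ (m + 3 * k) (bad F₃ h₃ f₃) x‖ₑ) Ψ σ ≤
      ENNReal.ofReal (K ^ 3 * (10 * M) * D * (2 * Real.pi) ^ 2 * (min 1 h₁ * min 1 h₂)) *
        ∫⁻ u in Metric.thickening (100 * ((2 : ℝ) ^ (3 * k : ℤ))⁻¹) S,
          poi ((2 : ℝ) ^ ((m : ℤ) + 3 * k))⁻¹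
            (badMass F₃ h₃ f₃ ((2 : ℝ) ^ ((m : ℤ) + 3 * k))⁻¹) u := by
  have hK0 := hK.pos
  have hM := hσ.nonneg
  have hD := hΨ.nonneg
  have hμ₁ : 0 < min 1 h₁ := lt_min one_pos hf₁.height_pos
  have hμ₂ : 0 < min 1 h₂ := lt_min one_pos hf₂.height_pos
  have hR : 0 < ((2 : ℝ) ^ k)⁻¹ := by positivity
  have hRε : ((2 : ℝ) ^ k)⁻¹ ≤ ((2 : ℝ) ^ m)⁻¹ := by gcongr; norm_num
  have e3 := inv_zpow_add_mul_natCast m 3 k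
  have e3' := inv_zpow_mul_natCast 3 k
  push_cast at e3 e3'
  have hm₃ := measurable_badMass (F := F₃) (h := h₃) hf₃.meas ((2 : ℝ) ^ ((m : ℤ) + 3 * k))⁻¹
  calc _ ≤ _ := triForm_mono (hf₁.enorm_bandPart_good_le hK _) (hf₂.enorm_bandPart_good_le hK _)
          (hf₃.enorm_bandPart_bad_le hK hφ _) fun _ => le_rfl
    _ ≤ ENNReal.ofReal (K * (2 * Real.pi * min 1 h₁)) * ENNReal.ofReal (K * (2 * Real.pi * min 1 h₂))
          * ENNReal.ofReal K * (ENNReal.ofReal (10 * M) * (ENNReal.ofReal D *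
          ∫⁻ u in Metric.thickening (100 * ((2 : ℝ) ^ (3 * k : ℤ))⁻¹) S,
            poi ((2 : ℝ) ^ ((m : ℤ) + 3 * k))⁻¹
              (badMass F₃ h₃ f₃ ((2 : ℝ) ^ ((m : ℤ) + 3 * k))⁻¹) u)) := by
        rw [triForm_const_mul ENNReal.ofReal_ne_top ENNReal.ofReal_ne_top ENNReal.ofReal_ne_top]
        refine mul_le_mul_right (triForm_le_of_fiber measurable_const measurable_const
          (measurable_poi _ hm₃) hΨ.meas hσ hR fun t ht => ?_) _
        rw [e3']
        generalize badMass F₃ h₃ f₃ ((2 : ℝ) ^ ((m : ℤ) + 3 * k))⁻¹ = α at hm₃ ⊢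
        rw [e3]
        simp only [one_mul]
        exact lintegral_fiber_third_le hR hRε hΨ hm₃ ht
    _ = _ := by
        simp only [← mul_assoc]
        repeat rw [← ENNReal.ofReal_mul (by positivity)]
        congr 2; ring

lemma triForm_good_le (hK : IsKernelBound φ K) (hf₃ : IsDatum f₃ F₃ S h₃ V) {a b : ℝ → ℝ≥0∞} :
    triForm a b (fun x => ‖bandPart φ (m + 3 * k) (good F₃ h₃ f₃) x‖ₑ) Ψ σ ≤
      ENNReal.ofReal (K * (2 * Real.pi * min 1 h₃)) * triForm a b 1 Ψ σ := by
  calc _ ≤ triForm (fun x => 1 * a x) (fun x => 1 * b x)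
          (fun x => ENNReal.ofReal (K * (2 * Real.pi * min 1 h₃)) * (1 : ℝ → ℝ≥0∞) x) Ψ σ :=
        triForm_mono (fun x => (one_mul _).ge) (fun x => (one_mul _).ge)
          (hf₃.enorm_bandPart_good_le hK _) fun _ => le_rfl
    _ = _ := by
        rw [triForm_const_mul ENNReal.one_ne_top ENNReal.one_ne_top ENNReal.ofReal_ne_top, one_mul,
          one_mul]

/-- Splitting the three functions one after the other into good and bad parts. -/
lemma triForm_le_add (hφ : IsFrequencyCutoff φ) (hK : IsKernelBound φ K)
    (hf₁ : IsDatum f₁ F₁ S h₁ V) (hf₂ : IsDatum f₂ F₂ S h₂ V) (hf₃ : IsDatum f₃ F₃ S h₃ V)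
    (hΨ : Measurable Ψ) (hσ : Measurable σ) :
    triForm (fun x => ‖bandPart φ (m + k) f₁ x‖ₑ) (fun x => ‖bandPart φ (m + 2 * k) f₂ x‖ₑ)
        (fun x => ‖bandPart φ (m + 3 * k) f₃ x‖ₑ) Ψ σ ≤
      triForm (fun x => ‖bandPart φ (m + k) (bad F₁ h₁ f₁) x‖ₑ)
        (fun x => ‖bandPart φ (m + 2 * k) f₂ x‖ₑ) (fun x => ‖bandPart φ (m + 3 * k) f₃ x‖ₑ) Ψ σ +
      (triForm (fun x => ‖bandPart φ (m + k) (good F₁ h₁ f₁) x‖ₑ)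
        (fun x => ‖bandPart φ (m + 2 * k) (bad F₂ h₂ f₂) x‖ₑ)
        (fun x => ‖bandPart φ (m + 3 * k) f₃ x‖ₑ) Ψ σ +
      (triForm (fun x => ‖bandPart φ (m + k) (good F₁ h₁ f₁) x‖ₑ)
        (fun x => ‖bandPart φ (m + 2 * k) (good F₂ h₂ f₂) x‖ₑ)
        (fun x => ‖bandPart φ (m + 3 * k) (bad F₃ h₃ f₃) x‖ₑ) Ψ σ +
      ENNReal.ofReal (K * (2 * Real.pi * min 1 h₃)) *
        triForm (fun x => ‖bandPart φ (m + k) (good F₁ h₁ f₁) x‖ₑ)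
          (fun x => ‖bandPart φ (m + 2 * k) (good F₂ h₂ f₂) x‖ₑ) 1 Ψ σ)) := by
  have hm := @measurable_enorm_bandPart φ hφ
  refine (triForm_add_le (hf₁.enorm_bandPart_le_add hφ _) (hm _ hf₁.integrable_bad)
    (hm _ hf₂.integrable) (hm _ hf₃.integrable) hΨ hσ).trans (add_le_add_right ?_ _)
  refine (triForm_add_le₂ (hf₂.enorm_bandPart_le_add hφ _) (hm _ hf₂.integrable_bad)
    (hm _ hf₁.integrable_good) (hm _ hf₃.integrable) hΨ hσ).trans (add_le_add_right ?_ _)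
  refine (triForm_add_le₃ (hf₃.enorm_bandPart_le_add hφ _) (hm _ hf₃.integrable_bad)
    (hm _ hf₁.integrable_good) (hm _ hf₂.integrable_good) hΨ hσ).trans (add_le_add_right ?_ _)
  exact triForm_good_le hK hf₃

end Scales

end CurvedTHT

/-! ### Summation over the scales -/

namespace CurvedTHT

open scoped ENNReal

lemma tsum_le_of_le_const_mul {ι : Type*} {T X : ι → ℝ≥0∞} {c x y : ℝ} {V : ℝ≥0∞} (hc : 0 ≤ c)
    (hT : ∀ k, T k ≤ ENNReal.ofReal c * X k) (hX : ∑' k, X k ≤ ENNReal.ofReal x * V)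
    (hxy : c * x ≤ y) : ∑' k, T k ≤ ENNReal.ofReal y * V := by
  calc ∑' k, T k ≤ ∑' k, ENNReal.ofReal c * X k := ENNReal.tsum_le_tsum hT
    _ ≤ ENNReal.ofReal c * (ENNReal.ofReal x * V) := by
        rw [ENNReal.tsum_mul_left]; exact mul_le_mul_right hX _
    _ = ENNReal.ofReal (c * x) * V := by rw [ENNReal.ofReal_mul hc, mul_assoc]
    _ ≤ _ := mul_le_mul_left (ENNReal.ofReal_le_ofReal hxy) _

lemma strictMono_natCast_mul (j : ℕ) (hj : 0 < j) : StrictMono fun k : ℕ => (j : ℤ) * k := by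
  intro a b hab
  have : (0 : ℤ) < j := by exact_mod_cast hj
  exact mul_lt_mul_of_pos_left (by exact_mod_cast hab) this

/-- The sum over the scales of the form of the good parts of the first two functions. -/
lemma exists_tsum_triForm_good_le {φ : ℝ → ℝ} (hφ : IsFrequencyCutoff φ) {M D θ₁ θ₂ : ℝ}
    (hM : 0 ≤ M) (hD : 0 ≤ D) (hθ₁ : θ₁ ∈ Ioo (0 : ℝ) 1) (hθ₂ : θ₂ ∈ Ioo (0 : ℝ) 1) :
    ∃ B : ℝ, 0 < B ∧ ∀ (m : ℕ) (f₁ f₂ : ℝ → ℂ) (F₁ F₂ F S : Set ℝ) (h₁ h₂ : ℝ)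
      (Ψ σ : ℕ → ℝ → ℝ≥0∞), MeasurableSet F → volume F ≠ ⊤ →
      IsDatum f₁ F₁ S h₁ (volume F) → IsDatum f₂ F₂ S h₂ (volume F) →
      (∀ k, IsTestWeight (Ψ k) S F (((2 : ℝ) ^ m)⁻¹ * ((2 : ℝ) ^ k)⁻¹ ^ 3) D) →
      (∀ k, IsKernelWeight (σ k) ((2 : ℝ) ^ k)⁻¹ M) →
      ∑' k : Ici m, triForm (fun x => ‖bandPart φ (m + (k : ℕ)) (good F₁ h₁ f₁) x‖ₑ)
        (fun x => ‖bandPart φ (m + 2 * (k : ℕ)) (good F₂ h₂ f₂) x‖ₑ) 1 (Ψ k) (σ k) ≤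
        ENNReal.ofReal (B * (h₁ ^ θ₁ * h₂ ^ θ₂)) * volume F := by
  obtain ⟨A₁, hA₁, H₁⟩ := exists_tsum_sq_good_le hφ hθ₁.1 hθ₁.2
  obtain ⟨A₂, hA₂, H₂⟩ := exists_tsum_sq_good_le hφ hθ₂.1 hθ₂.2
  -- Any B whose square dominates (50 M D A₁)(2312 M D A₂) will do; the summand 1 keeps B positive
  -- when M D = 0.
  refine ⟨2312 * M * D * (A₁ + A₂) + 1, by positivity, ?_⟩
  intro m f₁ f₂ F₁ F₂ F S h₁ h₂ Ψ σ hF hFt hf₁ hf₂ hΨ hσ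
  have h₁0 := hf₁.height_pos
  have h₂0 := hf₂.height_pos
  have hm := @measurable_enorm_bandPart φ hφ
  have X₁ := H₁ f₁ F₁ S F h₁ m (fun k => k) hf₁ hF hFt Nat.strictMono_cast
  have X₂ := H₂ f₂ F₂ S F h₂ m (fun k => 2 * k) hf₂ hF hFt (strictMono_natCast_mul 2 two_pos)
  refine (ENNReal.pow_le_pow_left_iff two_ne_zero).1 ?_
  refine (sq_tsum_le (X := fun k : Ici m => ENNReal.ofReal (50 * M * D) *
      ∫⁻ u, ‖bandPart φ (m + (k : ℕ)) (good F₁ h₁ f₁) u‖ₑ ^ 2 *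
        poi ((2 : ℝ) ^ ((k : ℕ) : ℤ))⁻¹ (F.indicator 1) u)
    (Y := fun k : Ici m => ENNReal.ofReal (2312 * M * D) *
      ∫⁻ u, ‖bandPart φ (m + 2 * (k : ℕ)) (good F₂ h₂ f₂) u‖ₑ ^ 2 *
        poi ((2 : ℝ) ^ (2 * (k : ℕ) : ℤ))⁻¹ (F.indicator 1) u) fun k => ?_).trans ?_
  · have e := inv_zpow_mul_natCast 2 k
    push_cast at e
    rw [e, zpow_natCast]
    have hR : 0 < ((2 : ℝ) ^ (k : ℕ))⁻¹ := by positivity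
    have hR1 : ((2 : ℝ) ^ (k : ℕ))⁻¹ ≤ 1 := inv_le_one_of_one_le₀ (one_le_pow₀ one_le_two)
    have hε : ((2 : ℝ) ^ m)⁻¹ ≤ 1 := inv_le_one_of_one_le₀ (one_le_pow₀ one_le_two)
    refine sq_triForm_one_le (hm _ hf₁.integrable_good) (hm _ hf₂.integrable_good) (hΨ k) (hσ k) hR
      ?_ ?_
    · exact (mul_le_of_le_one_left (by positivity) hε).trans
        (pow_le_of_le_one hR.le hR1 (by norm_num))
    · exact (mul_le_of_le_one_left (by positivity) hε).trans
        (pow_le_pow_of_le_one hR.le hR1 (by norm_num))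
  · rw [ENNReal.tsum_mul_left, ENNReal.tsum_mul_left]
    refine (mul_le_mul' (mul_le_mul_right X₁ _) (mul_le_mul_right X₂ _)).trans ?_
    have e : ∀ a b c d : ℝ, 0 ≤ a → 0 ≤ b → 0 ≤ c → ENNReal.ofReal a * (ENNReal.ofReal b *
        volume F) * (ENNReal.ofReal c * (ENNReal.ofReal d * volume F)) =
        ENNReal.ofReal (a * b * (c * d)) * volume F ^ 2 := by
      intro a b c d ha hb hc
      rw [ENNReal.ofReal_mul (p := a * b) (by positivity), ENNReal.ofReal_mul ha,
        ENNReal.ofReal_mul hc]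
      ring
    rw [e _ _ _ _ (by positivity) (by positivity) (by positivity), mul_pow,
      ← ENNReal.ofReal_pow (by positivity)]
    refine mul_le_mul_left (ENNReal.ofReal_le_ofReal ?_) _
    have hMD : 0 ≤ M * D := by positivity
    have hP : 0 ≤ (h₁ ^ θ₁ * h₂ ^ θ₂) ^ 2 := by positivity
    have key : 50 * M * D * A₁ * (2312 * M * D * A₂) ≤ (2312 * M * D * (A₁ + A₂) + 1) ^ 2 := by
      have h1 : 50 * M * D * A₁ ≤ 2312 * M * D * (A₁ + A₂) + 1 := by
        nlinarith [mul_nonneg hMD hA₁.le, mul_nonneg hMD hA₂.le]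
      have h2 : 2312 * M * D * A₂ ≤ 2312 * M * D * (A₁ + A₂) + 1 := by
        nlinarith [mul_nonneg hMD hA₁.le, mul_nonneg hMD hA₂.le]
      rw [sq]
      exact mul_le_mul h1 h2 (by positivity) (by positivity)
    calc _ = 50 * M * D * A₁ * (2312 * M * D * A₂) * (h₁ ^ θ₁ * h₂ ^ θ₂) ^ 2 := by ring
      _ ≤ (2312 * M * D * (A₁ + A₂) + 1) ^ 2 * (h₁ ^ θ₁ * h₂ ^ θ₂) ^ 2 := by gcongr
      _ = _ := by ring

/-- The sum over the scales of the positive forms. -/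
theorem exists_tsum_triForm_le {φ : ℝ → ℝ} (hφ : IsFrequencyCutoff φ) {M D θ₁ θ₂ θ₃ : ℝ}
    (hM : 0 ≤ M) (hD : 0 ≤ D) (hθ₁ : θ₁ ∈ Ioo (0 : ℝ) 1) (hθ₂ : θ₂ ∈ Ioo (0 : ℝ) 1)
    (hθ₃ : θ₃ ∈ Ioo (0 : ℝ) 1) :
    ∃ B : ℝ, 0 < B ∧ ∀ (m : ℕ) (f₁ f₂ f₃ : ℝ → ℂ) (F₁ F₂ F₃ F S : Set ℝ) (h₁ h₂ h₃ : ℝ)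
      (Ψ σ : ℕ → ℝ → ℝ≥0∞), 1 ≤ m → MeasurableSet F → volume F ≠ ⊤ → MeasurableSet S →
      IsDatum f₁ F₁ S h₁ (volume F) → IsDatum f₂ F₂ S h₂ (volume F) →
      IsDatum f₃ F₃ S h₃ (volume F) →
      (∀ k, IsTestWeight (Ψ k) S F (((2 : ℝ) ^ m)⁻¹ * ((2 : ℝ) ^ k)⁻¹ ^ 3) D) →
      (∀ k, IsKernelWeight (σ k) ((2 : ℝ) ^ k)⁻¹ M) →
      ∑' k : Ici m, triForm (fun x => ‖bandPart φ (m + (k : ℕ)) f₁ x‖ₑ)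
        (fun x => ‖bandPart φ (m + 2 * (k : ℕ)) f₂ x‖ₑ)
        (fun x => ‖bandPart φ (m + 3 * (k : ℕ)) f₃ x‖ₑ) (Ψ k) (σ k) ≤
        ENNReal.ofReal (B * m * (h₁ ^ θ₁ * h₂ ^ θ₂ * h₃ ^ θ₃)) * volume F := by
  obtain ⟨K, hK⟩ := exists_isKernelBound hφ
  obtain ⟨B, hB, HB⟩ := exists_tsum_triForm_good_le hφ hM hD hθ₁ hθ₂
  have hK0 := hK.pos
  have hav := avgConst_pos
  set c₁ := K ^ 3 * (10 * M) * (D * (512 * avgConst ^ 2)) * (32 * Real.pi) ^ 2 with hc₁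
  set c₂ := K ^ 3 * (10 * M) * (D * (8 * avgConst)) * (64 * Real.pi ^ 2) with hc₂
  set c₃ := K ^ 3 * (10 * M) * D * (2 * Real.pi) ^ 2 with hc₃
  have hc₁0 : 0 ≤ c₁ := by positivity
  have hc₂0 : 0 ≤ c₂ := by positivity
  have hc₃0 : 0 ≤ c₃ := by positivity
  -- Each bad part contributes 3200 (m + 1) ≤ 6400 m, which uses m ≥ 1. The last summand belongs to
  -- the good parts, which lose no power of m.
  refine ⟨6400 * c₁ + (6400 * c₂ + (6400 * c₃ + K * (2 * Real.pi) * B)), by positivity, ?_⟩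
  intro m f₁ f₂ f₃ F₁ F₂ F₃ F S h₁ h₂ h₃ Ψ σ hm hF hFt hS hf₁ hf₂ hf₃ hΨ hσ
  have hm1 : (1 : ℝ) ≤ m := by exact_mod_cast hm
  have hμ₁ : 0 < min 1 h₁ := lt_min one_pos hf₁.height_pos
  have hμ₂ : 0 < min 1 h₂ := lt_min one_pos hf₂.height_pos
  have hμ₃ : 0 < min 1 h₃ := lt_min one_pos hf₃.height_pos
  have e₁ := min_one_le_rpow hf₁.height_pos hθ₁.1.le hθ₁.2.le
  have e₂ := min_one_le_rpow hf₂.height_pos hθ₂.1.le hθ₂.2.le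
  have e₃ := min_one_le_rpow hf₃.height_pos hθ₃.1.le hθ₃.2.le
  have hμ : min 1 h₁ * min 1 h₂ * min 1 h₃ ≤ h₁ ^ θ₁ * h₂ ^ θ₂ * h₃ ^ θ₃ :=
    mul_le_mul (mul_le_mul e₁ e₂ hμ₂.le (hμ₁.le.trans e₁)) e₃ hμ₃.le
      (mul_nonneg (hμ₁.le.trans e₁) (hμ₂.le.trans e₂))
  have hH : 0 ≤ h₁ ^ θ₁ * h₂ ^ θ₂ * h₃ ^ θ₃ := le_trans (by positivity) hμ
  have hbad : ∀ c : ℝ, 0 ≤ c → c * (3200 * (m + 1) * (min 1 h₁ * min 1 h₂ * min 1 h₃)) ≤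
      6400 * c * m * (h₁ ^ θ₁ * h₂ ^ θ₂ * h₃ ^ θ₃) := by
    intro c hc
    calc _ ≤ c * (3200 * (m + m) * (h₁ ^ θ₁ * h₂ ^ θ₂ * h₃ ^ θ₃)) := by gcongr
      _ = _ := by ring
  refine (ENNReal.tsum_le_tsum fun k : Ici m =>
    triForm_le_add hφ hK hf₁ hf₂ hf₃ (hΨ k).meas (hσ k).meas).trans ?_
  rw [ENNReal.tsum_add, ENNReal.tsum_add, ENNReal.tsum_add, add_mul, add_mul, add_mul, add_mul,
    add_mul, add_mul, ENNReal.ofReal_add (by positivity) (by positivity),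
    ENNReal.ofReal_add (by positivity) (by positivity),
    ENNReal.ofReal_add (by positivity) (by positivity), add_mul, add_mul, add_mul]
  refine add_le_add ?_ (add_le_add ?_ (add_le_add ?_ ?_))
  · refine tsum_le_of_le_const_mul (by positivity) (fun k => triForm_bad_first_le hφ hK hf₁ hf₂ hf₃
      hS (hΨ k) (hσ k) k.2) (hf₁.tsum_bad_le m (s := fun k => k) Nat.cast_injective) ?_
    refine le_trans (le_of_eq ?_) (hbad c₁ hc₁0)
    ring
  · refine tsum_le_of_le_const_mul (by positivity) (fun k => triForm_bad_second_le hφ hK hf₁ hf₂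
      hf₃ hS (hΨ k) (hσ k) k.2) (hf₂.tsum_bad_le m (s := fun k => 2 * k)
      (strictMono_natCast_mul 2 two_pos).injective) ?_
    refine le_trans (le_of_eq ?_) (hbad c₂ hc₂0)
    ring
  · refine tsum_le_of_le_const_mul (by positivity) (fun k => triForm_bad_third_le hφ hK hf₁ hf₂
      hf₃ (hΨ k) (hσ k) k.2) (hf₃.tsum_bad_le m (s := fun k => 3 * k)
      (strictMono_natCast_mul 3 three_pos).injective) ?_
    refine le_trans (le_of_eq ?_) (hbad c₃ hc₃0)
    ring
  · refine tsum_le_of_le_const_mul (by positivity) (fun k => le_rfl)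
      (HB m f₁ f₂ F₁ F₂ F S h₁ h₂ Ψ σ hF hFt hf₁ hf₂ hΨ hσ) ?_
    have hh₁ := hf₁.height_pos
    have hh₂ := hf₂.height_pos
    calc _ = K * (2 * Real.pi) * B * (h₁ ^ θ₁ * h₂ ^ θ₂ * min 1 h₃) := by ring
      _ ≤ K * (2 * Real.pi) * B * (h₁ ^ θ₁ * h₂ ^ θ₂ * h₃ ^ θ₃) := by gcongr
      _ ≤ K * (2 * Real.pi) * B * m * (h₁ ^ θ₁ * h₂ ^ θ₂ * h₃ ^ θ₃) := by
        exact mul_le_mul_of_nonneg_right (le_mul_of_one_le_right (by positivity) hm1) hH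

end CurvedTHT

/-! ### From the positive forms to the original ones; normalization of the heights -/

namespace CurvedTHT

open scoped ENNReal

lemma IsSpatialCutoff.exists_isKernelWeight {ρ : ℝ → ℝ} (hρ : IsSpatialCutoff ρ) :
    ∃ M : ℝ, 0 ≤ M ∧ ∀ k : ℕ, IsKernelWeight
      (fun t => ‖(((2 : ℝ) ^ (k : ℤ) * ρ ((2 : ℝ) ^ (k : ℤ) * t) : ℝ) : ℂ)‖ₑ)
      ((2 : ℝ) ^ k)⁻¹ M := by
  obtain ⟨M, hM⟩ := hρ.hasCompactSupport.exists_bound_of_continuous hρ.smooth.continuous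
  have hM0 : 0 ≤ M := (norm_nonneg _).trans (hM 0)
  have hc := hρ.smooth.continuous
  refine ⟨M, hM0, fun k => ⟨by fun_prop, hM0, fun t => ?_, fun t ht => ?_⟩⟩
  · rw [← ofReal_norm, Complex.norm_real, norm_mul, zpow_natCast, div_inv_eq_mul, mul_comm M,
      Real.norm_of_nonneg (by positivity : (0 : ℝ) ≤ 2 ^ k)]
    exact ENNReal.ofReal_le_ofReal (mul_le_mul_of_nonneg_left (hM _) (by positivity))
  · have h0 : ρ ((2 : ℝ) ^ k * t) ≠ 0 := by
      intro h
      simp [h] at ht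
    obtain ⟨h1, h2⟩ := hρ.supp (subset_tsupport ρ h0)
    have h3 : |(2 : ℝ) ^ k * t| ≤ 4 := abs_le.2 h1
    have h4 : 1 / 4 < |(2 : ℝ) ^ k * t| := not_le.1 fun h => h2 (abs_le.1 h)
    have hk : (0 : ℝ) < 2 ^ k := by positivity
    rw [abs_mul, abs_of_pos hk] at h3 h4
    constructor
    · rw [inv_eq_one_div, div_div, div_le_iff₀ (by positivity)]
      linarith
    · rw [← div_eq_mul_inv, le_div_iff₀ hk]
      linarith

/-- Absolute values inside the integral discard all oscillation between the factors. The
cancellation used later is that of single functions: the mean zero of bad parts and the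
orthogonality of the bands. -/
lemma enorm_formPiece_le (ρ φ : ℝ → ℝ) (j l m k : ℤ) (f₁ f₂ f₃ : ℝ → ℂ) {g : ℝ → ℂ}
    {Ψ : ℝ → ℝ≥0∞} (hg : ∀ᵐ x, ‖g x‖ₑ ≤ Ψ x) :
    ‖formPiece ρ φ j l m k f₁ f₂ f₃ g‖ₑ ≤ triForm (fun x => ‖bandPart φ (j + k) f₁ x‖ₑ)
      (fun x => ‖bandPart φ (l + 2 * k) f₂ x‖ₑ) (fun x => ‖bandPart φ (m + 3 * k) f₃ x‖ₑ) Ψ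
      (fun t => ‖(((2 : ℝ) ^ k * ρ ((2 : ℝ) ^ k * t) : ℝ) : ℂ)‖ₑ) := by
  refine (enorm_integral_le_lintegral_enorm _).trans (lintegral_mono_ae ?_)
  have : ∀ᵐ p : ℝ × ℝ, ‖g p.1‖ₑ ≤ Ψ p.1 := Measure.quasiMeasurePreserving_fst.ae hg
  filter_upwards [this] with p hp
  simp only [enorm_mul]
  exact mul_le_mul_left (mul_le_mul_right hp _) _

lemma exists_tsum_enorm_diagPiece_le {ρ φ : ℝ → ℝ} (hρ : IsSpatialCutoff ρ)
    (hφ : IsFrequencyCutoff φ) {D θ₁ θ₂ θ₃ : ℝ} (hD : 0 ≤ D) (hθ₁ : θ₁ ∈ Ioo (0 : ℝ) 1)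
    (hθ₂ : θ₂ ∈ Ioo (0 : ℝ) 1) (hθ₃ : θ₃ ∈ Ioo (0 : ℝ) 1) :
    ∃ B : ℝ, 0 < B ∧ ∀ (m : ℕ) (f₁ f₂ f₃ : ℝ → ℂ) (g : ℕ → ℝ → ℂ) (F₁ F₂ F₃ F S : Set ℝ)
      (h₁ h₂ h₃ : ℝ) (Ψ : ℕ → ℝ → ℝ≥0∞), 1 ≤ m → MeasurableSet F → volume F ≠ ⊤ →
      MeasurableSet S → IsDatum f₁ F₁ S h₁ (volume F) → IsDatum f₂ F₂ S h₂ (volume F) →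
      IsDatum f₃ F₃ S h₃ (volume F) →
      (∀ k, IsTestWeight (Ψ k) S F (((2 : ℝ) ^ m)⁻¹ * ((2 : ℝ) ^ k)⁻¹ ^ 3) D) →
      (∀ k, ∀ᵐ x, ‖g k x‖ₑ ≤ Ψ k x) →
      ∑' k : Ici m, ‖diagPiece ρ φ m k f₁ f₂ f₃ (g k)‖ₑ ≤
        ENNReal.ofReal (B * m * (h₁ ^ θ₁ * h₂ ^ θ₂ * h₃ ^ θ₃)) * volume F := by
  obtain ⟨M, hM, hσ⟩ := hρ.exists_isKernelWeight
  obtain ⟨B, hB, H⟩ := exists_tsum_triForm_le hφ hM hD hθ₁ hθ₂ hθ₃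
  refine ⟨B, hB, ?_⟩
  intro m f₁ f₂ f₃ g F₁ F₂ F₃ F S h₁ h₂ h₃ Ψ hm hF hFt hS hf₁ hf₂ hf₃ hΨ hg
  exact (ENNReal.tsum_le_tsum fun k : Ici m => enorm_formPiece_le ρ φ _ _ _ _ _ _ _ (hg k)).trans
    (H m f₁ f₂ f₃ F₁ F₂ F₃ F S h₁ h₂ h₃ Ψ _ hm hF hFt hS hf₁ hf₂ hf₃ hΨ hσ)

/-- With heights proportional to v_j / v₄ the powers of v₄ collect to 1 - θ₁ - θ₂ - θ₃, and 36^θ ≤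
36. -/
lemma rpow_div_mul_le {v₁ v₂ v₃ v₄ θ₁ θ₂ θ₃ : ℝ} (h₁ : 0 < v₁) (h₂ : 0 < v₂) (h₃ : 0 < v₃)
    (h₄ : 0 < v₄) (hθ₁ : θ₁ ≤ 1) (hθ₂ : θ₂ ≤ 1) (hθ₃ : θ₃ ≤ 1) :
    (36 * (v₁ / v₄)) ^ θ₁ * (36 * (v₂ / v₄)) ^ θ₂ * (36 * (v₃ / v₄)) ^ θ₃ * v₄ ≤
      36 ^ 3 * (v₁ ^ θ₁ * v₂ ^ θ₂ * v₃ ^ θ₃ * v₄ ^ (1 - θ₁ - θ₂ - θ₃)) := by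
  have key : ∀ {v θ : ℝ}, 0 < v → θ ≤ 1 → (36 * (v / v₄)) ^ θ ≤ 36 * (v ^ θ / v₄ ^ θ) := by
    intro v θ hv hθ
    rw [Real.mul_rpow (by norm_num) (by positivity), Real.div_rpow hv.le h₄.le]
    gcongr
    simpa using Real.rpow_le_rpow_of_exponent_le (x := 36) (by norm_num) hθ
  calc _ ≤ 36 * (v₁ ^ θ₁ / v₄ ^ θ₁) * (36 * (v₂ ^ θ₂ / v₄ ^ θ₂)) * (36 * (v₃ ^ θ₃ / v₄ ^ θ₃)) *
        v₄ := by
        gcongr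
        · exact key h₁ hθ₁
        · exact key h₂ hθ₂
        · exact key h₃ hθ₃
    _ = _ := by
        rw [Real.rpow_sub h₄, Real.rpow_sub h₄, Real.rpow_sub h₄, Real.rpow_one]
        field_simp

/-- The bounds for both forms in terms of the measures of the four sets. -/
lemma exists_tsum_enorm_le {ρ φ : ℝ → ℝ} (hρ : IsSpatialCutoff ρ) (hφ : IsFrequencyCutoff φ)
    {θ₁ θ₂ θ₃ : ℝ} (hθ₁ : θ₁ ∈ Ioo (0 : ℝ) 1) (hθ₂ : θ₂ ∈ Ioo (0 : ℝ) 1)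
    (hθ₃ : θ₃ ∈ Ioo (0 : ℝ) 1) :
    ∃ C : ℝ, 0 ≤ C ∧ ∀ (m : ℕ) (f₁ f₂ f₃ f₄ : ℝ → ℂ) (F₁ F₂ F₃ F S : Set ℝ) (v₁ v₂ v₃ v₄ : ℝ),
      1 ≤ m → 0 < v₁ → 0 < v₂ → 0 < v₃ → 0 < v₄ → MeasurableSet F →
      volume F = ENNReal.ofReal v₄ → MeasurableSet S → S ⊆ F →
      IsDatum f₁ F₁ S (36 * (v₁ / v₄)) (volume F) → IsDatum f₂ F₂ S (36 * (v₂ / v₄)) (volume F) →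
      IsDatum f₃ F₃ S (36 * (v₃ / v₄)) (volume F) → (∀ᵐ x, ‖f₄ x‖ₑ ≤ S.indicator 1 x) →
      ∑' k : Ici m, ‖diagPiece ρ φ m k f₁ f₂ f₃ f₄‖ₑ ≤ ENNReal.ofReal (C * (m : ℝ) ^ 10 *
        v₁ ^ θ₁ * v₂ ^ θ₂ * v₃ ^ θ₃ * v₄ ^ (1 - θ₁ - θ₂ - θ₃)) ∧
      ∑' k : Ici m, ‖diagPieceLoc ρ φ m k f₁ f₂ f₃ f₄‖ₑ ≤ ENNReal.ofReal (C * (m : ℝ) ^ 10 *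
        v₁ ^ θ₁ * v₂ ^ θ₂ * v₃ ^ θ₃ * v₄ ^ (1 - θ₁ - θ₂ - θ₃)) := by
  obtain ⟨K, hK⟩ := exists_isKernelBound hφ
  have hp := poiConst_pos
  have hK0 := hK.pos
  obtain ⟨B₁, hB₁, H₁⟩ := exists_tsum_enorm_diagPiece_le hρ hφ zero_le_one hθ₁ hθ₂ hθ₃
  obtain ⟨B₂, hB₂, H₂⟩ := exists_tsum_enorm_diagPiece_le hρ hφ
    (D := K * (8 * Real.pi + poiConst)) (by positivity) hθ₁ hθ₂ hθ₃
  refine ⟨36 ^ 3 * (B₁ + B₂), by positivity, ?_⟩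
  intro m f₁ f₂ f₃ f₄ F₁ F₂ F₃ F S v₁ v₂ v₃ v₄ hm h₁ h₂ h₃ h₄ hF hFv hS hSF hf₁ hf₂ hf₃ hf₄
  have hFt : volume F ≠ ⊤ := by rw [hFv]; exact ENNReal.ofReal_ne_top
  have hm1 : (1 : ℝ) ≤ m := by exact_mod_cast hm
  have fin : ∀ B : ℝ, 0 < B → B ≤ B₁ + B₂ →
      ENNReal.ofReal (B * m * ((36 * (v₁ / v₄)) ^ θ₁ * (36 * (v₂ / v₄)) ^ θ₂ *
        (36 * (v₃ / v₄)) ^ θ₃)) * volume F ≤ ENNReal.ofReal (36 ^ 3 * (B₁ + B₂) * (m : ℝ) ^ 10 *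
        v₁ ^ θ₁ * v₂ ^ θ₂ * v₃ ^ θ₃ * v₄ ^ (1 - θ₁ - θ₂ - θ₃)) := by
    intro B hB hBB
    rw [hFv, ← ENNReal.ofReal_mul (by positivity)]
    refine ENNReal.ofReal_le_ofReal ?_
    calc _ = B * m * ((36 * (v₁ / v₄)) ^ θ₁ * (36 * (v₂ / v₄)) ^ θ₂ *
          (36 * (v₃ / v₄)) ^ θ₃ * v₄) := by ring
      _ ≤ (B₁ + B₂) * (m : ℝ) ^ 10 *
          (36 ^ 3 * (v₁ ^ θ₁ * v₂ ^ θ₂ * v₃ ^ θ₃ * v₄ ^ (1 - θ₁ - θ₂ - θ₃))) :=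
        mul_le_mul (mul_le_mul hBB (le_self_pow₀ hm1 (by norm_num)) (by positivity) (by positivity))
          (rpow_div_mul_le h₁ h₂ h₃ h₄ hθ₁.2.le hθ₂.2.le hθ₃.2.le) (by positivity) (by positivity)
      _ = _ := by ring
  constructor
  · exact (H₁ m f₁ f₂ f₃ (fun _ => f₄) F₁ F₂ F₃ F S _ _ _ (fun _ => S.indicator 1) hm hF hFt hS
      hf₁ hf₂ hf₃ (fun k => isTestWeight_indicator hS hSF _) fun _ => hf₄).trans
        (fin B₁ hB₁ (by linarith))
  · refine (H₂ m f₁ f₂ f₃ (fun k => bandPart φ (m + 3 * k) f₄) F₁ F₂ F₃ F S _ _ _ _ hm hF hFt hS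
      hf₁ hf₂ hf₃ (fun k => isTestWeight_decay hS hF hSF (by positivity) hK0.le) fun k => ?_).trans
        (fin B₂ hB₂ (by linarith))
    refine Filter.Eventually.of_forall fun x => ?_
    have e := inv_zpow_add_mul_natCast m 3 k
    push_cast at e
    rw [← e]
    refine (hK.enorm_bandPart_le_decay _ f₄ x).trans (mul_le_mul_right (lintegral_mono_ae ?_) _)
    filter_upwards [hf₄] with y hy
    exact mul_le_mul_right hy _

lemma summable_and_norm_tsum_le {ι : Type*} {f : ι → ℂ} {B : ℝ} (hB : 0 ≤ B)
    (h : ∑' i, ‖f i‖ₑ ≤ ENNReal.ofReal B) : Summable f ∧ ‖∑' i, f i‖ ≤ B := by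
  have hs : Summable fun i => ‖f i‖ := by
    simpa using ENNReal.summable_toReal (ne_top_of_le_ne_top ENNReal.ofReal_ne_top h)
  refine ⟨hs.of_norm, (norm_tsum_le_tsum_norm hs).trans ?_⟩
  have : ∑' i, ‖f i‖ = (∑' i, ‖f i‖ₑ).toReal := by
    rw [ENNReal.tsum_toReal_eq fun i => enorm_ne_top]
    simp
  rw [this]
  exact ENNReal.toReal_le_of_le_ofReal hB h

variable {f f₁ f₂ f₃ f₄ : ℝ → ℂ} {F : Set ℝ}

lemma Dominated.ae_eq_zero (hf : Dominated f F) (hF : volume F = 0) : f =ᵐ[volume] 0 := by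
  filter_upwards [hf.2, measure_eq_zero_iff_ae_notMem.1 hF] with x hx hxF
  rw [indicator_of_notMem hxF] at hx
  simpa using hx

/-- A dominated function has a measurable representative satisfying the standing assumptions. -/
lemma Dominated.exists_isDatum {S : Set ℝ} {h : ℝ} {V : ℝ≥0∞} (hf : Dominated f F) (hh : 0 < h)
    (hF : volume F ≠ ⊤) (hS : ∀ x ∈ S, x ∉ exceptional (toMeasurable volume F) h)
    (hV : volume F ≤ ENNReal.ofReal h * V) :
    ∃ g, f =ᵐ[volume] g ∧ IsDatum g (toMeasurable volume F) S h V := by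
  refine ⟨hf.1.mk f, hf.1.ae_eq_mk, hf.1.measurable_mk, hh, measurableSet_toMeasurable _ _,
    by rwa [measure_toMeasurable], ?_, hS, by rwa [measure_toMeasurable]⟩
  filter_upwards [hf.1.ae_eq_mk, enorm_le_of_dominated hf.2] with y hy hy'
  rw [← hy]
  exact hy'.trans (indicator_le_indicator_of_subset (subset_toMeasurable _ _)
    (fun _ => zero_le) y)

lemma diagPiece_congr_ae (ρ φ : ℝ → ℝ) (m k : ℕ) {g₁ g₂ g₃ : ℝ → ℂ} (h₁ : f₁ =ᵐ[volume] g₁)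
    (h₂ : f₂ =ᵐ[volume] g₂) (h₃ : f₃ =ᵐ[volume] g₃) (f₄ : ℝ → ℂ) :
    diagPiece ρ φ m k f₁ f₂ f₃ f₄ = diagPiece ρ φ m k g₁ g₂ g₃ f₄ := by
  simp only [diagPiece, formPiece, bandPart_congr_ae φ _ h₁, bandPart_congr_ae φ _ h₂,
    bandPart_congr_ae φ _ h₃]

lemma bandPart_eq_zero (φ : ℝ → ℝ) (n : ℤ) (hf : f =ᵐ[volume] 0) : bandPart φ n f = 0 := by
  rw [bandPart_congr_ae φ n hf]
  ext x
  simp [bandPart_apply]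

lemma diagPiece_eq_zero (ρ φ : ℝ → ℝ) (m k : ℕ)
    (h : f₁ =ᵐ[volume] 0 ∨ f₂ =ᵐ[volume] 0 ∨ f₃ =ᵐ[volume] 0 ∨ f₄ =ᵐ[volume] 0) :
    diagPiece ρ φ m k f₁ f₂ f₃ f₄ = 0 := by
  rcases h with h | h | h | h
  · simp [diagPiece, formPiece, bandPart_eq_zero φ _ h]
  · simp [diagPiece, formPiece, bandPart_eq_zero φ _ h]
  · simp [diagPiece, formPiece, bandPart_eq_zero φ _ h]
  · refine integral_eq_zero_of_ae ?_
    have : ∀ᵐ p : ℝ × ℝ, f₄ p.1 = 0 := Measure.quasiMeasurePreserving_fst.ae h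
    filter_upwards [this] with p hp
    simp [hp]

lemma diagPieceLoc_eq_zero (ρ φ : ℝ → ℝ) (m k : ℕ)
    (h : f₁ =ᵐ[volume] 0 ∨ f₂ =ᵐ[volume] 0 ∨ f₃ =ᵐ[volume] 0 ∨ f₄ =ᵐ[volume] 0) :
    diagPieceLoc ρ φ m k f₁ f₂ f₃ f₄ = 0 := by
  refine diagPiece_eq_zero ρ φ m k (h.imp_right (Or.imp_right (Or.imp_right fun h => ?_)))
  rw [bandPart_eq_zero φ _ h]

/-- 36 = 6 · 6: one factor cancels the weak type constant, the other makes three exceptional sets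
together take at most half of v. -/
lemma volume_exceptional_le_div {v : ℝ} (hv : 0 < v) (hF : volume F ≠ ⊤)
    (hF0 : volume F ≠ 0) :
    volume (exceptional (toMeasurable volume F) (36 * (volume.real F / v))) ≤
      ENNReal.ofReal (v / 6) := by
  have hFv : 0 < volume.real F := ENNReal.toReal_pos hF0 hF
  have hh : 0 < 36 * (volume.real F / v) := by positivity
  have := volume_exceptional_le hh (measurableSet_toMeasurable volume F)
  rw [measure_toMeasurable, ← ofReal_measureReal hF] at this
  refine (ENNReal.mul_le_mul_iff_right (by simpa using hh) ENNReal.ofReal_ne_top).1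
    (this.trans (le_of_eq ?_))
  rw [← ENNReal.ofReal_mul hh.le, ← ENNReal.ofReal_ofNat, ← ENNReal.ofReal_mul (by norm_num)]
  congr 1
  field_simp
  norm_num

/-- The removal of the exceptional sets leaves at least half of `F`. -/
lemma half_le_measureReal_diff {T E₁ E₂ E₃ : Set ℝ} {v : ℝ} (hv : 0 < v)
    (hT : volume.real T = v) (h₁ : volume E₁ ≤ ENNReal.ofReal (v / 6))
    (h₂ : volume E₂ ≤ ENNReal.ofReal (v / 6)) (h₃ : volume E₃ ≤ ENNReal.ofReal (v / 6)) :
    1 / 2 * v ≤ volume.real (T \ (E₁ ∪ E₂ ∪ E₃)) := by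
  have hr : ∀ {E : Set ℝ}, volume E ≤ ENNReal.ofReal (v / 6) → volume.real E ≤ v / 6 := fun h =>
    ENNReal.toReal_le_of_le_ofReal (by positivity) h
  have hE : volume (E₁ ∪ E₂ ∪ E₃) ≠ ⊤ := by
    have := ENNReal.ofReal_ne_top (r := v / 6)
    exact measure_union_ne_top (measure_union_ne_top (ne_top_of_le_ne_top this h₁)
      (ne_top_of_le_ne_top this h₂)) (ne_top_of_le_ne_top this h₃)
  have hTt : volume T ≠ ⊤ := fun h => by simp [Measure.real, h] at hT; linarith
  have e1 := measureReal_union_le (μ := volume) (E₁ ∪ E₂) E₃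
  have e2 := measureReal_union_le (μ := volume) E₁ E₂
  have e3 : volume.real T ≤ volume.real (T \ (E₁ ∪ E₂ ∪ E₃)) + volume.real (E₁ ∪ E₂ ∪ E₃) :=
    (measureReal_mono (by rw [sdiff_union_self]; exact subset_union_left)
      (measure_union_ne_top (measure_ne_top_of_subset sdiff_subset hTt) hE)).trans
      (measureReal_union_le _ _)
  linarith [hr h₁, hr h₂, hr h₃]

end CurvedTHT

/-! ### Choice of the major subset and conclusion -/

theorem proposition2p1 (ρ φ : ℝ → ℝ)
    (hρ : CurvedTHT.IsSpatialCutoff ρ) (hφ : CurvedTHT.IsFrequencyCutoff φ) :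
    ∃ C : ℝ → ℝ → ℝ → ℝ, ∀ m : ℕ, 1 ≤ m → ∀ F₁ F₂ F₃ F₄ : Set ℝ,
      NullMeasurableSet F₁ volume → NullMeasurableSet F₂ volume →
      NullMeasurableSet F₃ volume → NullMeasurableSet F₄ volume →
      volume F₁ < ⊤ → volume F₂ < ⊤ → volume F₃ < ⊤ → volume F₄ < ⊤ →
      ∃ F₄' : Set ℝ, F₄' ⊆ F₄ ∧ MeasurableSet F₄' ∧
        (1 / 2 : ℝ) * volume.real F₄ ≤ volume.real F₄' ∧
        ∀ f₁ f₂ f₃ f₄ : ℝ → ℂ,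
          CurvedTHT.Dominated f₁ F₁ → CurvedTHT.Dominated f₂ F₂ →
          CurvedTHT.Dominated f₃ F₃ → CurvedTHT.Dominated f₄ F₄' →
          (Summable (fun k : Ici m => CurvedTHT.diagPiece ρ φ m k f₁ f₂ f₃ f₄) ∧
            Summable (fun k : Ici m => CurvedTHT.diagPieceLoc ρ φ m k f₁ f₂ f₃ f₄)) ∧
          ∀ θ₁ θ₂ θ₃ : ℝ, θ₁ ∈ Ioo (0 : ℝ) 1 → θ₂ ∈ Ioo (0 : ℝ) 1 → θ₃ ∈ Ioo (0 : ℝ) 1 →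
            ‖CurvedTHT.multiscaleForm ρ φ m f₁ f₂ f₃ f₄‖ ≤
              C θ₁ θ₂ θ₃ * (m : ℝ) ^ 10 * volume.real F₁ ^ θ₁ * volume.real F₂ ^ θ₂ *
                volume.real F₃ ^ θ₃ * volume.real F₄ ^ (1 - θ₁ - θ₂ - θ₃) ∧
            ‖CurvedTHT.multiscaleFormLoc ρ φ m f₁ f₂ f₃ f₄‖ ≤
              C θ₁ θ₂ θ₃ * (m : ℝ) ^ 10 * volume.real F₁ ^ θ₁ * volume.real F₂ ^ θ₂ *
                volume.real F₃ ^ θ₃ * volume.real F₄ ^ (1 - θ₁ - θ₂ - θ₃) := by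
  classical
  -- The constants are fixed for each triple of exponents before m and the sets are given; outside
  -- the open unit cube the value of C is an irrelevant default.
  choose! C hC0 hC using fun (θ₁ θ₂ θ₃ : ℝ)
    (h : θ₁ ∈ Ioo (0 : ℝ) 1 ∧ θ₂ ∈ Ioo (0 : ℝ) 1 ∧ θ₃ ∈ Ioo (0 : ℝ) 1) =>
    CurvedTHT.exists_tsum_enorm_le hρ hφ h.1 h.2.1 h.2.2
  refine ⟨C, fun m hm F₁ F₂ F₃ F₄ _ _ _ hF₄ ht₁ ht₂ ht₃ ht₄ => ?_⟩
  -- F₄ is only null measurable, while the major subset has to be measurable.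
  obtain ⟨T, hTF, hTm, hT⟩ := hF₄.exists_measurable_subset_ae_eq
  have hTv : volume.real T = volume.real F₄ := measureReal_congr hT
  -- The heights below need positive measures. If one set is null, every piece vanishes and any
  -- major subset serves.
  by_cases h0 : volume F₁ = 0 ∨ volume F₂ = 0 ∨ volume F₃ = 0 ∨ volume F₄ = 0
  · refine ⟨T, hTF, hTm, by rw [hTv]; linarith [measureReal_nonneg (μ := volume) (s := F₄)], ?_⟩
    intro f₁ f₂ f₃ f₄ hf₁ hf₂ hf₃ hf₄
    have hz : f₁ =ᵐ[volume] 0 ∨ f₂ =ᵐ[volume] 0 ∨ f₃ =ᵐ[volume] 0 ∨ f₄ =ᵐ[volume] 0 :=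
      h0.imp hf₁.ae_eq_zero (Or.imp hf₂.ae_eq_zero (Or.imp hf₃.ae_eq_zero fun h =>
        hf₄.ae_eq_zero (measure_mono_null hTF h)))
    simp only [CurvedTHT.multiscaleForm, CurvedTHT.multiscaleFormLoc,
      CurvedTHT.diagPiece_eq_zero ρ φ m _ hz, CurvedTHT.diagPieceLoc_eq_zero ρ φ m _ hz, tsum_zero,
      norm_zero, summable_zero, and_self, true_and]
    intro θ₁ θ₂ θ₃ h₁ h₂ h₃
    have := hC0 θ₁ θ₂ θ₃ ⟨h₁, h₂, h₃⟩
    positivity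
  · push Not at h0
    obtain ⟨hn₁, hn₂, hn₃, hn₄⟩ := h0
    have hv₁ : 0 < volume.real F₁ := ENNReal.toReal_pos hn₁ ht₁.ne
    have hv₂ : 0 < volume.real F₂ := ENNReal.toReal_pos hn₂ ht₂.ne
    have hv₃ : 0 < volume.real F₃ := ENNReal.toReal_pos hn₃ ht₃.ne
    have hv₄ : 0 < volume.real F₄ := ENNReal.toReal_pos hn₄ ht₄.ne
    -- The removed sets depend on F₁, …, F₄ alone, so one major subset serves all exponents and all
    -- functions. Measurable hulls have the same measures and still dominate the functions.
    set E : Set ℝ → Set ℝ := fun F =>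
      CurvedTHT.exceptional (toMeasurable volume F) (36 * (volume.real F / volume.real F₄)) with hE
    have hEm : ∀ F, MeasurableSet (E F) := fun F =>
      (CurvedTHT.isOpen_exceptional _ _).measurableSet
    have hSm : MeasurableSet (T \ (E F₁ ∪ E F₂ ∪ E F₃)) :=
      hTm.diff (((hEm F₁).union (hEm F₂)).union (hEm F₃))
    refine ⟨T \ (E F₁ ∪ E F₂ ∪ E F₃), sdiff_subset.trans hTF, hSm,
      CurvedTHT.half_le_measureReal_diff hv₄ hTv
        (CurvedTHT.volume_exceptional_le_div hv₄ ht₁.ne hn₁)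
        (CurvedTHT.volume_exceptional_le_div hv₄ ht₂.ne hn₂)
        (CurvedTHT.volume_exceptional_le_div hv₄ ht₃.ne hn₃), ?_⟩
    intro f₁ f₂ f₃ f₄ hf₁ hf₂ hf₃ hf₄
    have hV : ∀ {F : Set ℝ}, volume F < ⊤ → 0 < volume.real F → volume F ≤
        ENNReal.ofReal (36 * (volume.real F / volume.real F₄)) *
          volume (toMeasurable volume F₄) := by
      intro F hFt hF0
      rw [measure_toMeasurable, ← ofReal_measureReal ht₄.ne, ← ofReal_measureReal hFt.ne,
        ← ENNReal.ofReal_mul (by positivity)]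
      refine ENNReal.ofReal_le_ofReal ?_
      rw [mul_assoc, div_mul_cancel₀ _ hv₄.ne']
      linarith
    obtain ⟨g₁, e₁, hg₁⟩ := hf₁.exists_isDatum (S := T \ (E F₁ ∪ E F₂ ∪ E F₃))
      (V := volume (toMeasurable volume F₄)) (h := 36 * (volume.real F₁ / volume.real F₄))
      (by positivity) ht₁.ne (fun x hx h => hx.2 (Or.inl (Or.inl h))) (hV ht₁ hv₁)
    obtain ⟨g₂, e₂, hg₂⟩ := hf₂.exists_isDatum (S := T \ (E F₁ ∪ E F₂ ∪ E F₃))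
      (V := volume (toMeasurable volume F₄)) (h := 36 * (volume.real F₂ / volume.real F₄))
      (by positivity) ht₂.ne (fun x hx h => hx.2 (Or.inl (Or.inr h))) (hV ht₂ hv₂)
    obtain ⟨g₃, e₃, hg₃⟩ := hf₃.exists_isDatum (S := T \ (E F₁ ∪ E F₂ ∪ E F₃))
      (V := volume (toMeasurable volume F₄)) (h := 36 * (volume.real F₃ / volume.real F₄))
      (by positivity) ht₃.ne (fun x hx h => hx.2 (Or.inr h)) (hV ht₃ hv₃)
    have main : ∀ θ₁ θ₂ θ₃ : ℝ, θ₁ ∈ Ioo (0 : ℝ) 1 → θ₂ ∈ Ioo (0 : ℝ) 1 → θ₃ ∈ Ioo (0 : ℝ) 1 → _ :=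
      fun θ₁ θ₂ θ₃ h₁ h₂ h₃ => hC θ₁ θ₂ θ₃ ⟨h₁, h₂, h₃⟩ m g₁ g₂ g₃ f₄ _ _ _ _ _ _ _ _ _ hm hv₁ hv₂
        hv₃ hv₄ (measurableSet_toMeasurable volume F₄)
        (by rw [measure_toMeasurable, ofReal_measureReal ht₄.ne]) hSm
        ((sdiff_subset.trans hTF).trans (subset_toMeasurable _ _)) hg₁ hg₂ hg₃
        (CurvedTHT.enorm_le_of_dominated hf₄.2)
    have hnn : ∀ θ₁ θ₂ θ₃ : ℝ, θ₁ ∈ Ioo (0 : ℝ) 1 → θ₂ ∈ Ioo (0 : ℝ) 1 → θ₃ ∈ Ioo (0 : ℝ) 1 →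
        0 ≤ C θ₁ θ₂ θ₃ * (m : ℝ) ^ 10 * volume.real F₁ ^ θ₁ * volume.real F₂ ^ θ₂ *
          volume.real F₃ ^ θ₃ * volume.real F₄ ^ (1 - θ₁ - θ₂ - θ₃) := by
      intro θ₁ θ₂ θ₃ h₁ h₂ h₃
      have := hC0 θ₁ θ₂ θ₃ ⟨h₁, h₂, h₃⟩
      positivity
    simp only [CurvedTHT.multiscaleForm, CurvedTHT.multiscaleFormLoc, CurvedTHT.diagPieceLoc,
      CurvedTHT.diagPiece_congr_ae ρ φ m _ e₁ e₂ e₃]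
    -- Summability does not involve the exponents, so a single triple suffices for it.
    have half : (1 / 2 : ℝ) ∈ Ioo (0 : ℝ) 1 := by norm_num
    obtain ⟨s₁, s₂⟩ := main _ _ _ half half half
    have n := hnn _ _ _ half half half
    refine ⟨⟨(CurvedTHT.summable_and_norm_tsum_le n s₁).1,
      (CurvedTHT.summable_and_norm_tsum_le n s₂).1⟩, fun θ₁ θ₂ θ₃ h₁ h₂ h₃ => ?_⟩
    obtain ⟨b₁, b₂⟩ := main θ₁ θ₂ θ₃ h₁ h₂ h₃
    exact ⟨(CurvedTHT.summable_and_norm_tsum_le (hnn _ _ _ h₁ h₂ h₃) b₁).2,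
      (CurvedTHT.summable_and_norm_tsum_le (hnn _ _ _ h₁ h₂ h₃) b₂).2⟩
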